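/- Work on $\mathbb{R}^n$ with coordinates $x=(x_1,\dots,x_n)$, and let $\xi=(\xi_1,\dots,\xi_n)$ be a second copy of these coordinates. A $(1,1)$-super-current is a form $T=\sum_{i,j}T_{ij}\,dx_i\wedge d\xi_j$ whose coefficients $T_{ij}$ are real distributions on $\mathbb{R}^n$. Its support is the union of the supports of the $T_{ij}$. It is closed if $dT=\sum_{i,j,k}\partial_kT_{ij}\,dx_k\wedge dx_i\wedge d\xi_j=0$, and positive if $T_{ij}=T_{ji}$ and $\langle T,\sigma_{n-1}\,\beta\wedge J(\beta)\rangle\ge 0$ for every smooth compactly supported $(n-1,0)$-form $\beta$, where $J$ replaces each $dx_i$ by $d\xi_i$, $\sigma_{k}=(-1)^{k(k-1)/2}$, and the pairing is normalized by $dx_1\wedge d\xi_1\wedge\dots\wedge dx_n\wedge d\xi_n$. For a locally integrable function $f$ put $dd^{\#}f=\sum_{i,j}\partial_i\partial_jf\,dx_i\wedge d\xi_j$. A convex function $f$ with $T=dd^{\#}f$ is called a convex potential of $T$. A closed set $S\subset\mathbb{R}^n$ is called piecewise smooth of dimension $n-1$ if it is the union of finitely many (possibly no) connected embedded smooth submanifolds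 $M_i$ of dimension $n-1$ and finitely many embedded smooth submanifolds $W_j$ of dimension less than $n-1$, such that $M_i\cap M_{i'}\subset\bigcup_jW_j$ for $i\ne i'$ and each $W_j$ is contained in the closure of $\bigcup_iM_i$. A vector $v$ is a normal vector of a function $f$ at a point $x$ if there are $a\neq b$ in $\mathbb{R}^n$ with $v=a-b$ and $f(y)=\max\{f(x)+a\cdot(y-x),\,f(x)+b\cdot(y-x)\}$ for all $y$ near $x$; it is a normal vector of a $(1,1)$-super-current $T$ at $x$ if it is one of some convex potential of $T$. A tropical polynomial is a function $f(x)=\max_{\alpha\in A}(-\nu(\alpha)+\alpha\cdot x)$ with $A\subset\mathbb{Z}^n$ finite and non-empty and $\nu:A\to\mathbb{R}$. Its tropical hypersurface $V_f$ is the set where $f$ is not smooth, together with the normal vectors $\pm v$ of $f$ at the points of this set (that is, $V_f$ is considered with the integral normal vectors, equivalently the weights, of its facets). Proposition. The assignment $V_f\mapsto dd^{\#}f$, for $f$ a tropical polynomial, is a well defined bijection from the set of tropical hypersurfaces in $\mathbb{R}^n$ onto the set of closed, positive $(1,1)$-super-currents $T$ on $\mathbb{R}^n$ whose support is piecewise smooth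 of dimension $n-1$ and all of whose normal vectors lie in $\mathbb{Z}^n$. Under this bijection, the support of $T=dd^{\#}f$ is the underlying set of $V_f$, and the normal vectors of $T$ are those of $V_f$. Moreover, every such $T$ is $dd^{\#}f$ for a tropical polynomial $f$, and every convex potential of $T$ becomes a tropical polynomial after a linear function is added to it. -/

import Mathlib

open Set MeasureTheory Topology TopologicalSpace
open scoped Distributions LineDeriv ContDiff RealInnerProductSpace

namespace SuperCurrent

/-- `ℝⁿ` with its Euclidean structure. -/
abbrev E (n : ℕ) : Type := EuclideanSpace ℝ (Fin n)

/-- Real distributions on `ℝⁿ`. -/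
abbrev Distr (n : ℕ) : Type := 𝓓'((⊤ : Opens (E n)), ℝ)

/-- Real smooth compactly supported functions on `ℝⁿ`. -/
abbrev Test (n : ℕ) : Type := 𝓓((⊤ : Opens (E n)), ℝ)

/-- The `i`-th standard basis vector. -/
noncomputable abbrev stdVec {n : ℕ} (i : Fin n) : E n := EuclideanSpace.single i 1

/-- The product of two test functions. -/
noncomputable def mulTest {n : ℕ} (φ ψ : Test n) : Test n where
  toFun x := φ x * ψ x
  contDiff' := φ.contDiff.mul ψ.contDiff
  hasCompactSupport' := φ.hasCompactSupport.mul_right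
  tsupport_subset' := fun _ _ => Set.mem_univ _

/-- The distribution `φ ↦ ∫ φ f` of a locally integrable function `f`. -/
noncomputable def ofFun {n : ℕ} (f : E n → ℝ) : Distr n :=
  TestFunction.integralAgainstBilinCLM (ContinuousLinearMap.mul ℝ ℝ) volume f

/-! ### Super currents of low bidegree

A super current of bidegree `(p, q)` is a form in `dx` and `dξ` whose coefficients are
distributions on `ℝⁿ` (they do not depend on `ξ`). -/

/-- `(0,1)`-currents `∑ j, S j dξ_j`. -/
abbrev Current01 (n : ℕ) : Type := Fin n → Distr n

/-- `(1,1)`-currents `∑ i j, T i j dx_i ∧ dξ_j`. -/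
abbrev Current11 (n : ℕ) : Type := Fin n → Fin n → Distr n

/-- `d^# f = ∑ j, ∂_j f dξ_j`, for a locally integrable function `f`. -/
noncomputable def dSharp {n : ℕ} (f : E n → ℝ) : Current01 n :=
  fun j => ∂_{stdVec j} (ofFun f)

/-- `d S = ∑ i j, ∂_i (S j) dx_i ∧ dξ_j`, for a `(0,1)`-current `S`. -/
noncomputable def d01 {n : ℕ} (S : Current01 n) : Current11 n :=
  fun i j => ∂_{stdVec i} (S j)

/-- `dd^# f`, for a locally integrable function `f`. -/
noncomputable def ddSharp {n : ℕ} (f : E n → ℝ) : Current11 n := d01 (dSharp f)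

/-- `d T = ∑_{k < i} ∑ j, (∂_k T_{ij} - ∂_i T_{kj}) dx_k ∧ dx_i ∧ dξ_j` for a `(1,1)`-current `T`;
this is the coefficient of `dx_k ∧ dx_i ∧ dξ_j`. -/
noncomputable def d11 {n : ℕ} (T : Current11 n) (k i j : Fin n) : Distr n :=
  ∂_{stdVec k} (T i j) - ∂_{stdVec i} (T k j)

/-- `d T = 0`. -/
def IsDClosed {n : ℕ} (T : Current11 n) : Prop :=
  ∀ k i j : Fin n, k < i → d11 T k i j = 0

/-- Test forms of bidegree `(n-1,n-1)`. The family `α` stands for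
`∑ i j, α i j σ_{n-1} dx̂_i ∧ dξ̂_j`, where `dx̂_i` is the product of all `dx_k`, `k ≠ i`, in
increasing order, `dξ̂_j` is defined in the same way, and `σ_k = (-1)^{k(k-1)/2}`. -/
abbrev TestForm (n : ℕ) : Type := Fin n → Fin n → Test n

/-- The pairing `⟨T, α⟩` of a `(1,1)`-current with a test form. The sign comes from
`dx_i ∧ dξ_j ∧ σ_{n-1} dx̂_i ∧ dξ̂_j = (-1)^{i+j} dx_1 ∧ dξ_1 ∧ ⋯ ∧ dx_n ∧ dξ_n`. -/
noncomputable def pairing {n : ℕ} (T : Current11 n) (α : TestForm n) : ℝ :=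
  ∑ i : Fin n, ∑ j : Fin n, (-1 : ℝ) ^ ((i : ℕ) + (j : ℕ)) * T i j (α i j)

/-- The test form `σ_{n-1} β ∧ J(β)`, where `β = ∑ i, b i dx̂_i` is an `(n-1,0)`-form and
`J(β) = ∑ j, b j dξ̂_j`. -/
noncomputable def squareForm {n : ℕ} (b : Fin n → Test n) : TestForm n := fun i j => mulTest (b i) (b j)

/-- A `(1,1)`-current is positive if it is symmetric and `⟨T, σ_{n-1} β ∧ J(β)⟩ ≥ 0` for all
smooth compactly supported `(n-1,0)`-forms `β`. -/
def IsPositive {n : ℕ} (T : Current11 n) : Prop :=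
  (∀ i j, T i j = T j i) ∧ ∀ b : Fin n → Test n, 0 ≤ pairing T (squareForm b)

/-- The support of a `(1,1)`-current: the union of the supports of its coefficients. -/
def support {n : ℕ} (T : Current11 n) : Set (E n) :=
  ⋃ i, ⋃ j, Distribution.dsupport (T i j)

/-! ### Piecewise smooth sets -/

/-- `M` is an embedded smooth submanifold (without boundary) of `ℝⁿ` of dimension `d`: near each of
its points, a smooth change of coordinates takes `M` to the set where all the coordinates of index
at least `d` (counted from `0`) vanish. -/
def IsSmoothSubmanifold {n : ℕ} (d : ℕ) (M : Set (E n)) : Prop :=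
  d ≤ n ∧ ∀ x ∈ M, ∃ φ : OpenPartialHomeomorph (E n) (E n), x ∈ φ.source ∧
    ContDiffOn ℝ ∞ φ φ.source ∧ ContDiffOn ℝ ∞ φ.symm φ.target ∧
    ∀ y ∈ φ.source, (y ∈ M ↔ ∀ i : Fin n, d ≤ (i : ℕ) → φ y i = 0)

/-- `S` is piecewise smooth of dimension `n - 1`: it consists of finitely many connected smooth
manifolds `M i` of dimension `n - 1`, glued together along finitely many manifolds `W j` of lower
dimension. The empty set is included, as the case of no pieces. -/
def IsPiecewiseSmoothHypersurface {n : ℕ} (S : Set (E n)) : Prop :=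
  ∃ (k m : ℕ) (M : Fin k → Set (E n)) (W : Fin m → Set (E n)),
    (∀ i, IsConnected (M i) ∧ ∃ d, d + 1 = n ∧ IsSmoothSubmanifold d (M i)) ∧
    (∀ j, ∃ d, d + 1 < n ∧ IsSmoothSubmanifold d (W j)) ∧
    (∀ i i', i ≠ i' → M i ∩ M i' ⊆ ⋃ j, W j) ∧
    (∀ j, W j ⊆ closure (⋃ i, M i)) ∧
    S = (⋃ i, M i) ∪ ⋃ j, W j

/-! ### Normal vectors -/

/-- `v` is a normal vector of `f` at `x`: near `x`, `f` is the maximum of two affine functions which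
agree at `x` and have distinct linear parts `a`, `b`, and `v = a - b`. So `x` is in the relative
interior of a facet of the singular set of `f`, and `f` has there the two normal vectors `v`
and `-v`. -/
def IsNormalVector {n : ℕ} (f : E n → ℝ) (x v : E n) : Prop :=
  ∃ a b : E n, a ≠ b ∧ v = a - b ∧
    ∀ᶠ y in 𝓝 x, f y = max (f x + ⟪a, y - x⟫) (f x + ⟪b, y - x⟫)

/-- `v` is a normal vector of the current `T` at `x` if it is one of a convex potential of `T`. -/
def IsCurrentNormal {n : ℕ} (T : Current11 n) (x v : E n) : Prop :=
  ∃ f : E n → ℝ, ConvexOn ℝ univ f ∧ T = ddSharp f ∧ IsNormalVector f x v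

/-- `v ∈ ℤⁿ`. -/
def IsIntegral {n : ℕ} (v : E n) : Prop := ∃ m : Fin n → ℤ, ∀ i, v i = m i

/-- The closed, positive `(1,1)`-currents on `ℝⁿ` whose support is piecewise smooth of dimension
`n - 1` and whose normal vectors are integral. -/
structure IsTropicalCurrent {n : ℕ} (T : Current11 n) : Prop where
  closed : IsDClosed T
  positive : IsPositive T
  support_dim : IsPiecewiseSmoothHypersurface (support T)
  integral : ∀ x v, IsCurrentNormal T x v → IsIntegral v

/-! ### Tropical polynomials and hypersurfaces -/

/-- `f(x) = max_{α ∈ A} (-ν(α) + α · x)` for a nonempty finite set `A ⊆ ℤⁿ`. -/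
def IsTropicalPolynomial {n : ℕ} (f : E n → ℝ) : Prop :=
  ∃ (A : Finset (Fin n → ℤ)) (hA : A.Nonempty) (ν : (Fin n → ℤ) → ℝ),
    ∀ x, f x = A.sup' hA fun α => -ν α + ∑ i, (α i : ℝ) * x i

/-- The set where `f` is not smooth. -/
def singularSet {n : ℕ} (f : E n → ℝ) : Set (E n) := {x | ¬ ContDiffAt ℝ ∞ f x}

/-- A tropical hypersurface: the set where a tropical polynomial is not smooth, together with the
normal vectors `±v` of its facets (`normals x` is `{v, -v}` if `x` is in the relative interior of a
facet with normal vector `v`, and empty otherwise). -/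
@[ext]
structure TropicalHypersurface (n : ℕ) where
  carrier : Set (E n)
  normals : E n → Set (E n)
  exists_polynomial : ∃ f : E n → ℝ, IsTropicalPolynomial f ∧
    carrier = singularSet f ∧ normals = fun x => {v | IsNormalVector f x v}

/-- The tropical hypersurface `V_f` of a tropical polynomial `f`. -/
def TropicalHypersurface.ofPolynomial {n : ℕ} (f : E n → ℝ) (hf : IsTropicalPolynomial f) :
    TropicalHypersurface n where
  carrier := singularSet f
  normals := fun x => {v | IsNormalVector f x v}
  exists_polynomial := ⟨f, hf, rfl, rfl⟩

end SuperCurrent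

/-!
A tropical polynomial `f` is a convex piecewise affine function, so `dd^# f` is closed and positive
(`isDClosed_ddSharp`, `isPositive_ddSharp`); its support is the set of points near which `f` is not
affine (`support_ddSharp`), and this set consists of facets, along which two linear terms of `f`
agree, and of lower dimensional cells in their closure (`isPiecewiseSmoothHypersurface_kinks`).
Convex functions with the same `dd^#` differ by an affine function, by Weyl's lemma
(`exists_affine_of_ddSharp_eq`), so the normal vectors of `dd^# f` are those of `f`, which are
differences of exponents.

Conversely, let `T` be a closed positive current. Its contractions with vectors are positive
functionals, hence measures (`IsPositive.exists_measure`). The smearings of `T` with mollifiers are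
then smooth closed symmetric matrices, which are Hessians of convex functions by Poincaré's lemma.
Normalized to vanish to first order at the origin, these functions are locally bounded in terms of
their Laplacians, and a locally uniform limit is a convex potential of `T`
(`exists_convexOn_eq_ddSharp`).

Let `f` be a convex potential of `T`, and assume that the support of `T` is piecewise smooth and the
normal vectors are integral. Two slopes of `f` which can be joined by a path along which the slopes
are locally finite are congruent modulo `ℤⁿ`: this rests on `exists_facet_point`, by which any
splitting of finitely many slopes into two classes is seen at a facet. If there were points without
a neighbourhood with finitely many slopes, then near a suitable one of them all of them would lie in
one smooth hypersurface. But on each side of it the slopes are congruent and, `f` being locally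
Lipschitz, bounded, so they are finite in number (`exists_nhds_finite_slopes`). Each smooth piece of
the support is locally contained in finitely many hyperplanes, on which two of the tangents of `f`
agree; its normal direction is continuous, so by connectedness the piece lies in one hyperplane
(`IsSmoothSubmanifold.exists_subset_hyperplane`). As there are finitely many pieces, `f` is affine
on the cells of a finite hyperplane arrangement. So it is a maximum of finitely many affine
functions with slopes congruent modulo `ℤⁿ`, and becomes a tropical polynomial when one of its
slopes is subtracted (`IsTropicalCurrent.exists_isTropicalPolynomial_add`).

It remains to see that the normal vectors, which are known up to sign, determine a tropical
polynomial up to an affine function (`exists_affine_of_isNormalVector_iff`). Convexity fixes the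
sign: across a facet of `f + g` the jumps of the slopes of `f` and `g` agree up to sign and do not
cancel, so they are equal. Hence `f - g` has constant gradient.
-/

namespace SuperCurrent

/-! ### Slopes and tangents of convex functions -/

variable {n : ℕ}

/-- `f` is affine with linear part `a` on a neighbourhood of `x`. -/
def AffineNear (f : E n → ℝ) (x a : E n) : Prop := ∀ᶠ y in 𝓝 x, f y = f x + ⟪a, y - x⟫

/-- The linear parts of the affine functions with which `f` agrees on nonempty open subsets of the
open set `O`. -/
def slopes (f : E n → ℝ) (O : Set (E n)) : Set (E n) := {a | ∃ x ∈ O, AffineNear f x a}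

/-- `f` is affine near each point of a dense set. -/
def GenericallyAffine (f : E n → ℝ) : Prop :=
  ∀ O : Set (E n), IsOpen O → O.Nonempty → (slopes f O).Nonempty

/-- The affine function of slope `a` supporting a convex function `f` from below; its constant term
is minus the Legendre transform of `f` at `a`. It is meaningful only if `f - ⟪a, ·⟫` is bounded
below, in particular if `a` is a slope of `f`. -/
noncomputable def tangent (f : E n → ℝ) (a y : E n) : ℝ := (⨅ z, (f z - ⟪a, z⟫)) + ⟪a, y⟫

theorem continuous_tangent (f : E n → ℝ) (a : E n) : Continuous (tangent f a) := by
  unfold tangent; fun_prop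

theorem tangent_eq_add (f : E n → ℝ) (a x y : E n) :
    tangent f a y = tangent f a x + ⟪a, y - x⟫ := by
  simp only [tangent, inner_sub_right]; ring

theorem slopes_mono (f : E n → ℝ) {O O' : Set (E n)} (h : O ⊆ O') : slopes f O ⊆ slopes f O' :=
  fun _ ⟨x, hx, ha⟩ => ⟨x, h hx, ha⟩

theorem AffineNear.eventually {f : E n → ℝ} {x a : E n} (h : AffineNear f x a) :
    ∀ᶠ y in 𝓝 x, AffineNear f y a := by
  have h' : ∀ᶠ y in 𝓝 x, ∀ᶠ z in 𝓝 y, f z = f x + ⟪a, z - x⟫ := h.eventually_nhds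
  filter_upwards [h'] with y hy
  have hyy := hy.self_of_nhds
  filter_upwards [hy] with z hz
  rw [hz, hyy, add_assoc, ← inner_add_right]
  congr 2; abel

/-- A linear form which is nonpositive near a point vanishes. -/
theorem eq_zero_of_eventually_inner_nonpos {v x : E n} (h : ∀ᶠ y in 𝓝 x, ⟪v, y - x⟫ ≤ 0) :
    v = 0 := by
  have ht : Filter.Tendsto (fun t : ℝ => x + t • v) (𝓝[>] 0) (𝓝 x) := by
    have : Continuous fun t : ℝ => x + t • v := by fun_prop
    simpa using (this.tendsto 0).mono_left nhdsWithin_le_nhds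
  obtain ⟨t, ht0, ht⟩ := ((ht.eventually h).and self_mem_nhdsWithin).exists
  have hpos : (0 : ℝ) < t := ht
  simp only [add_sub_cancel_left, inner_smul_right, real_inner_self_eq_norm_sq] at ht0
  by_contra hv
  have := mul_pos hpos (pow_pos (norm_pos_iff.2 hv) 2)
  linarith

theorem AffineNear.unique {f : E n → ℝ} {x a b : E n} (ha : AffineNear f x a)
    (hb : AffineNear f x b) : a = b := by
  refine sub_eq_zero.1 (eq_zero_of_eventually_inner_nonpos (x := x) ?_)
  filter_upwards [ha, hb] with y h1 h2
  rw [inner_sub_left]; linarith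

/-- A convex function which is affine near `x` lies above the corresponding affine function. -/
theorem AffineNear.le {f : E n → ℝ} (hf : ConvexOn ℝ univ f) {x a : E n} (h : AffineNear f x a)
    (y : E n) : f x + ⟪a, y - x⟫ ≤ f y := by
  have hconv : ConvexOn ℝ univ fun z => f z - ⟪a, z⟫ :=
    hf.sub ((innerSL ℝ a).toLinearMap.concaveOn convex_univ)
  have hmin : IsMinOn (fun z => f z - ⟪a, z⟫) univ x := by
    refine IsMinOn.of_isLocalMinOn_of_convexOn (mem_univ _) ?_ hconv
    rw [IsLocalMinOn, nhdsWithin_univ]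
    filter_upwards [h] with z hz
    rw [hz, inner_sub_right]; linarith
  have := hmin (mem_univ y)
  simp only [mem_ofPred_eq] at this
  rw [inner_sub_right]; linarith

theorem AffineNear.tangent_eq {f : E n → ℝ} (hf : ConvexOn ℝ univ f) {x a : E n}
    (h : AffineNear f x a) (y : E n) : tangent f a y = f x + ⟪a, y - x⟫ := by
  have : (⨅ z, (f z - ⟪a, z⟫)) = f x - ⟪a, x⟫ := by
    refine IsLeast.csInf_eq ⟨⟨x, rfl⟩, ?_⟩
    rintro _ ⟨z, rfl⟩
    have := h.le hf z
    rw [inner_sub_right] at this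
    simp only; linarith
  rw [tangent, this, inner_sub_right]; ring

theorem AffineNear.eventually_eq_tangent {f : E n → ℝ} (hf : ConvexOn ℝ univ f) {x a : E n}
    (h : AffineNear f x a) : ∀ᶠ y in 𝓝 x, f y = tangent f a y := by
  filter_upwards [h] with y hy
  rw [hy, h.tangent_eq hf]

theorem tangent_le {f : E n → ℝ} (hf : ConvexOn ℝ univ f) {O : Set (E n)} {a : E n}
    (ha : a ∈ slopes f O) (y : E n) : tangent f a y ≤ f y := by
  obtain ⟨x, -, h⟩ := ha
  rw [h.tangent_eq hf]; exact h.le hf y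

/-- A convex function which is affine near a dense set of points and has finitely many slopes on an
open set is on that set the maximum of its tangents. -/
theorem exists_eq_tangent {f : E n → ℝ} (hf : ConvexOn ℝ univ f) (hc : Continuous f)
    (hgen : GenericallyAffine f) {O : Set (E n)} (hO : IsOpen O) (hfin : (slopes f O).Finite)
    {x : E n} (hx : x ∈ O) : ∃ a ∈ slopes f O, f x = tangent f a x := by
  have hcl : IsClosed (⋃ a ∈ slopes f O, {y | f y = tangent f a y}) :=
    hfin.isClosed_biUnion fun a _ => isClosed_eq hc (continuous_tangent f a)
  have hxcl : x ∈ closure (⋃ a ∈ slopes f O, {y | f y = tangent f a y}) := by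
    rw [mem_closure_iff]
    intro U hU hxU
    obtain ⟨a, y, hy, ha⟩ := hgen (U ∩ O) (hU.inter hO) ⟨x, hxU, hx⟩
    refine ⟨y, hy.1, mem_biUnion (show a ∈ slopes f O from ⟨y, hy.2, ha⟩) ?_⟩
    exact (ha.eventually_eq_tangent hf).self_of_nhds
  rw [hcl.closure_eq] at hxcl
  simpa using hxcl

/-- Every nonempty open set contains a point at which finitely many given nonzero affine functions
`y ↦ c + ⟪v, y⟫` do not vanish. -/
theorem exists_mem_forall_affine_ne_zero {U : Set (E n)} (hU : IsOpen U) (hne : U.Nonempty)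
    {G : Set (ℝ × E n)} (hG : G.Finite) (h0 : (0 : ℝ × E n) ∉ G) :
    ∃ p ∈ U, ∀ g ∈ G, g.1 + ⟪g.2, p⟫ ≠ 0 := by
  have hd : Dense (⋂ g ∈ G, {p : E n | g.1 + ⟪g.2, p⟫ ≠ 0}) := by
    refine dense_biInter_of_isOpen (fun g _ => isOpen_ne_fun (by fun_prop) continuous_const)
      hG.countable fun g hg => ?_
    by_cases hv : g.2 = 0
    · have hc : g.1 ≠ 0 := fun hc => h0 (by rwa [← Prod.mk_zero_zero, ← hc, ← hv])
      simp [hv, hc]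
    · intro x
      rw [mem_closure_iff]
      intro O hO hxO
      by_contra hcon
      rw [not_nonempty_iff_eq_empty, eq_empty_iff_forall_notMem] at hcon
      have hz : ∀ y ∈ O, g.1 + ⟪g.2, y⟫ = 0 := fun y hy => by
        by_contra h; exact hcon y ⟨hy, h⟩
      refine hv (eq_zero_of_eventually_inner_nonpos (x := x) ?_)
      filter_upwards [hO.mem_nhds hxO] with y hy
      have h1 := hz y hy
      have h2 := hz x hxO
      rw [inner_sub_right]; linarith
  obtain ⟨p, hpU, hp⟩ := hd.inter_open_nonempty U hU hne
  exact ⟨p, hpU, fun g hg => by simpa using mem_iInter₂.1 hp g hg⟩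

/-- Among the slopes of a convex function, a tangent is not a proper convex combination of two other
tangents: it would be the maximum only where all three agree. -/
theorem tangent_ne_combination {f : E n → ℝ} (hf : ConvexOn ℝ univ f) {O : Set (E n)} {a b c : E n}
    (ha : a ∈ slopes f O) (hb : b ∈ slopes f O) (hc : c ∈ slopes f O) (hab : a ≠ b) {t : ℝ}
    (h0 : 0 < t) (h1 : t < 1)
    (h : ∀ y, tangent f c y = (1 - t) * tangent f a y + t * tangent f b y) : False := by
  obtain ⟨x, -, hx⟩ := hc
  refine hab (sub_eq_zero.1 (eq_zero_of_eventually_inner_nonpos (x := x) ?_))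
  have key : ∀ᶠ y in 𝓝 x, tangent f a y = tangent f b y := by
    filter_upwards [hx.eventually_eq_tangent hf] with y hy
    have h2 := tangent_le hf ha y
    have h3 := tangent_le hf hb y
    rw [hy, h y] at h2 h3
    nlinarith
  filter_upwards [key] with y hy
  have := key.self_of_nhds
  rw [tangent_eq_add f a x, tangent_eq_add f b x] at hy
  rw [inner_sub_left]; linarith

/-- If the finitely many slopes of a convex function on a convex open set are split into two
nonempty classes, then somewhere in the set the function is locally the maximum of two tangents, one
with slope in each class. The point is found on a segment between generic points of two cells:
such a segment avoids the points where three tangents meet. -/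
theorem exists_facet_point {f : E n → ℝ} (hf : ConvexOn ℝ univ f) (hc : Continuous f)
    (hgen : GenericallyAffine f) {O : Set (E n)} (hO : IsOpen O) (hOc : Convex ℝ O)
    (hfin : (slopes f O).Finite) {K : Set (E n)} {a₀ b₀ : E n} (ha₀ : a₀ ∈ slopes f O)
    (ha₀K : a₀ ∈ K) (hb₀ : b₀ ∈ slopes f O) (hb₀K : b₀ ∉ K) :
    ∃ a ∈ slopes f O, a ∈ K ∧ ∃ b ∈ slopes f O, b ∉ K ∧ ∃ x ∈ O,
      f x = tangent f a x ∧ f x = tangent f b x ∧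
      (∀ c ∈ slopes f O, c ≠ a → c ≠ b → tangent f c x < f x) ∧
      ∀ᶠ y in 𝓝 x, f y = max (f x + ⟪a, y - x⟫) (f x + ⟪b, y - x⟫) := by
  classical
  set F := slopes f O with hF
  set I : E n → ℝ := fun a => ⨅ z, (f z - ⟪a, z⟫) with hI
  have hT : ∀ a y, tangent f a y = I a + ⟪a, y⟫ := fun a y => rfl
  obtain ⟨xa, hxaO, hxa⟩ := ha₀
  obtain ⟨xb, hxbO, hxb⟩ := hb₀
  have ha₀ : a₀ ∈ F := ⟨xa, hxaO, hxa⟩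
  have hb₀ : b₀ ∈ F := ⟨xb, hxbO, hxb⟩
  -- `p` lies in the cell of slope `a₀`, and no two tangents agree at `p`
  obtain ⟨U, hUsub, hU, hxaU⟩ := mem_nhds_iff.1
    (Filter.inter_mem (hxa.eventually_eq_tangent hf) (hO.mem_nhds hxaO))
  have hG1 : ((fun q : E n × E n => (I q.1 - I q.2, q.1 - q.2)) '' (F ×ˢ F) \ {0}).Finite :=
    ((hfin.prod hfin).image _).sdiff
  obtain ⟨p, hpU, hp⟩ := exists_mem_forall_affine_ne_zero hU ⟨xa, hxaU⟩ hG1 (by simp)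
  have hpne : ∀ a ∈ F, ∀ b ∈ F, a ≠ b → tangent f a p ≠ tangent f b p := by
    intro a ha b hb hab heq
    refine hp (I a - I b, a - b) ⟨⟨(a, b), ⟨ha, hb⟩, rfl⟩, ?_⟩ ?_
    · simp only [mem_singleton_iff, Prod.mk_eq_zero, not_and]
      exact fun _ h => hab (sub_eq_zero.1 h)
    · simp only [hT] at heq
      simp only [inner_sub_left]; linarith
  -- `q` lies in the cell of slope `b₀`, off the cones with vertex `p` over the sets where three
  -- tangents agree
  obtain ⟨V, hVsub, hV, hxbV⟩ := mem_nhds_iff.1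
    (Filter.inter_mem (hxb.eventually_eq_tangent hf) (hO.mem_nhds hxbO))
  set δ : E n → E n → ℝ := fun a b => tangent f a p - tangent f b p with hδ
  set cone : E n × E n × E n → ℝ × E n := fun q =>
    (δ q.1 q.2.1 * (I q.1 - I q.2.2) - δ q.1 q.2.2 * (I q.1 - I q.2.1),
      δ q.1 q.2.1 • (q.1 - q.2.2) - δ q.1 q.2.2 • (q.1 - q.2.1)) with hcone
  have hcone_eq : ∀ a b c y, (cone (a, b, c)).1 + ⟪(cone (a, b, c)).2, y⟫ =
      δ a b * (tangent f a y - tangent f c y) - δ a c * (tangent f a y - tangent f b y) := by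
    intro a b c y
    simp only [hcone, hT, inner_sub_left, inner_smul_left, conj_trivial]
    ring
  have hG2 : (cone '' (F ×ˢ F ×ˢ F) \ {0}).Finite :=
    ((hfin.prod (hfin.prod hfin)).image _).sdiff
  obtain ⟨q, hqV, hq⟩ := exists_mem_forall_affine_ne_zero hV ⟨xb, hxbV⟩ hG2 (by simp)
  have hpf : f p = tangent f a₀ p := (hUsub hpU).1
  have hqf : f q = tangent f b₀ q := (hVsub hqV).1
  have hpO : p ∈ O := (hUsub hpU).2
  have hqO : q ∈ O := (hVsub hqV).2
  -- the maxima of the tangents over the two classes agree somewhere on the segment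
  have hK1 : (hfin.toFinset.filter (· ∈ K)).Nonempty := ⟨a₀, by simp [ha₀, ha₀K]⟩
  have hK2 : (hfin.toFinset.filter (· ∉ K)).Nonempty := ⟨b₀, by simp [hb₀, hb₀K]⟩
  set g : E n → ℝ := fun y => (hfin.toFinset.filter (· ∈ K)).sup' hK1 fun a => tangent f a y
  set h : E n → ℝ := fun y => (hfin.toFinset.filter (· ∉ K)).sup' hK2 fun a => tangent f a y
  have hgc : Continuous g := Continuous.finset_sup'_apply hK1 fun a _ => continuous_tangent f a
  have hhc : Continuous h := Continuous.finset_sup'_apply hK2 fun a _ => continuous_tangent f a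
  have hgle : ∀ y, g y ≤ f y := fun y => Finset.sup'_le _ _ fun a ha =>
    tangent_le hf (O := O) (by simp at ha; exact ha.1) y
  have hhle : ∀ y, h y ≤ f y := fun y => Finset.sup'_le _ _ fun a ha =>
    tangent_le hf (O := O) (by simp at ha; exact ha.1) y
  have hgp : h p ≤ g p := (hhle p).trans (hpf.le.trans
    (Finset.le_sup' (fun a => tangent f a p) (by simp [ha₀, ha₀K])))
  have hhq : g q ≤ h q := (hgle q).trans (hqf.le.trans
    (Finset.le_sup' (fun a => tangent f a q) (by simp [hb₀, hb₀K])))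
  have hline : Continuous fun t : ℝ => p + t • (q - p) := by fun_prop
  obtain ⟨t, ht, htz⟩ : (0 : ℝ) ∈ (fun t : ℝ => h (p + t • (q - p)) - g (p + t • (q - p))) ''
      Icc 0 1 := by
    refine intermediate_value_Icc zero_le_one
      ((hhc.comp hline).sub (hgc.comp hline)).continuousOn ⟨?_, ?_⟩
    · simpa using hgp
    · simpa using hhq
  set x := p + t • (q - p) with hx
  have hgh : h x = g x := sub_eq_zero.1 htz
  have hxO : x ∈ O := by
    have := hOc.lineMap_mem hpO hqO ht
    rwa [AffineMap.lineMap_apply_module', add_comm] at this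
  have hfx : f x = g x := by
    obtain ⟨c, hcF, hcx⟩ := exists_eq_tangent hf hc hgen hO hfin hxO
    refine le_antisymm ?_ (hgle x)
    by_cases hcK : c ∈ K
    · exact hcx.le.trans (Finset.le_sup' (fun a => tangent f a x)
        (by simpa [hcK] using hcF))
    · rw [← hgh]
      exact hcx.le.trans (Finset.le_sup' (fun a => tangent f a x)
        (by simpa [hcK] using hcF))
  obtain ⟨a, haK', hax⟩ := Finset.exists_mem_eq_sup' hK1 fun a => tangent f a x
  obtain ⟨b, hbK', hbx⟩ := Finset.exists_mem_eq_sup' hK2 fun a => tangent f a x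
  obtain ⟨haF, haK⟩ : a ∈ F ∧ a ∈ K := by simpa using haK'
  obtain ⟨hbF, hbK⟩ : b ∈ F ∧ b ∉ K := by simpa using hbK'
  have hfa : f x = tangent f a x := hfx.trans hax
  have hfb : f x = tangent f b x := hfx.trans (hgh.symm.trans hbx)
  have hab : a ≠ b := fun h => hbK (h ▸ haK)
  have ht0 : t ≠ 0 := by
    rintro rfl
    have hxp : x = p := by simp [hx]
    exact hpne a haF b hbF hab (by rw [← hxp, ← hfa, ← hfb])
  have hlt : ∀ c ∈ F, c ≠ a → c ≠ b → tangent f c x < f x := by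
    intro c hcF hca hcb
    refine lt_of_le_of_ne (tangent_le hf hcF x) fun hcx => ?_
    have hlin : ∀ d, tangent f d x = (1 - t) * tangent f d p + t * tangent f d q := by
      intro d
      simp only [hT, hx, inner_add_right, inner_smul_right, inner_sub_right]; ring
    have hLq : (cone (a, b, c)).1 + ⟪(cone (a, b, c)).2, q⟫ = 0 := by
      have hLx : δ a b * (tangent f a x - tangent f c x) -
          δ a c * (tangent f a x - tangent f b x) = 0 := by
        rw [hcx, ← hfa, ← hfb]; ring
      rw [hlin a, hlin b, hlin c] at hLx
      have hLp : δ a b * (tangent f a p - tangent f c p) -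
          δ a c * (tangent f a p - tangent f b p) = 0 := by simp only [hδ]; ring
      rw [hcone_eq]
      refine (mul_eq_zero.1 (?_ : t * _ = 0)).resolve_left ht0
      linear_combination hLx - (1 - t) * hLp
    have hz : cone (a, b, c) = 0 := by
      by_contra hne
      exact hq _ ⟨⟨(a, b, c), ⟨haF, hbF, hcF⟩, rfl⟩, by simpa using hne⟩ hLq
    have hid : ∀ y, δ a b * (tangent f a y - tangent f c y) =
        δ a c * (tangent f a y - tangent f b y) := by
      intro y
      have := hcone_eq a b c y
      rw [hz] at this
      simp only [Prod.fst_zero, Prod.snd_zero, inner_zero_left] at this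
      linarith
    have hδab : δ a b ≠ 0 := sub_ne_zero.2 (hpne a haF b hbF hab)
    have hδac : δ a c ≠ 0 := sub_ne_zero.2 (hpne a haF c hcF hca.symm)
    have hδbc : δ a b ≠ δ a c := fun h => hpne b hbF c hcF hcb.symm (by
      simp only [hδ] at h; linarith)
    -- the three slopes are distinct and collinear, so one tangent lies between the other two
    set s := δ a c / δ a b with hs
    have hsc : ∀ y, tangent f c y = (1 - s) * tangent f a y + s * tangent f b y := by
      intro y
      have := hid y
      rw [hs]; field_simp; linarith
    have hs0 : s ≠ 0 := div_ne_zero hδac hδab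
    have hs1 : s ≠ 1 := fun h => hδbc ((div_eq_one_iff_eq hδab).1 h).symm
    rcases lt_or_gt_of_ne hs0 with hneg | hpos
    · refine tangent_ne_combination hf hcF hbF haF hcb (t := -s / (1 - s))
        (div_pos (by linarith) (by linarith)) ((div_lt_one (by linarith)).2 (by linarith))
        fun y => ?_
      have : (1 - s) ≠ 0 := by linarith
      rw [hsc y]; field_simp; ring
    · rcases lt_or_gt_of_ne hs1 with hlt | hgt
      · exact tangent_ne_combination hf haF hbF hcF hab hpos hlt hsc
      · refine tangent_ne_combination hf haF hcF hbF hca.symm (t := 1 / s)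
          (by positivity) ((div_lt_one hpos).2 hgt) fun y => ?_
        rw [hsc y]; field_simp; ring
  refine ⟨a, haF, haK, b, hbF, hbK, x, hxO, hfa, hfb, hlt, ?_⟩
  have hev : ∀ᶠ y in 𝓝 x, ∀ c ∈ F, c ≠ a → c ≠ b → tangent f c y < tangent f a y := by
    rw [Filter.eventually_all_finite hfin]
    intro c hcF
    by_cases hca : c = a
    · simp [hca]
    by_cases hcb : c = b
    · simp [hcb]
    have := hlt c hcF hca hcb
    rw [hfa] at this
    filter_upwards [(continuous_tangent f c).continuousAt.eventually_lt
      (continuous_tangent f a).continuousAt this] with y hy _ _ using hy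
  filter_upwards [hev, hO.mem_nhds hxO] with y hy hyO
  have e1 : f x + ⟪a, y - x⟫ = tangent f a y := by rw [tangent_eq_add f a x y, hfa]
  have e2 : f x + ⟪b, y - x⟫ = tangent f b y := by rw [tangent_eq_add f b x y, hfb]
  rw [e1, e2]
  refine le_antisymm ?_ (max_le (tangent_le hf haF y) (tangent_le hf hbF y))
  obtain ⟨c, hcF, hcy⟩ := exists_eq_tangent hf hc hgen hO hfin hyO
  rw [hcy]
  by_cases hca : c = a
  · rw [hca]; exact le_max_left _ _
  by_cases hcb : c = b
  · rw [hcb]; exact le_max_right _ _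
  exact (hy c hcF hca hcb).le.trans (le_max_left _ _)

/-! ### Local finiteness of the slopes -/

section Topological

variable {X : Type*} [TopologicalSpace X]

/-- A property which is locally constant on a preconnected set is constant on it. -/
theorem iff_of_isPreconnected {s : Set X} (hs : IsPreconnected s) {P : X → Prop}
    (h : ∀ x ∈ s, ∀ᶠ y in 𝓝[s] x, (P x ↔ P y)) {x y : X} (hx : x ∈ s) (hy : y ∈ s) :
    P x ↔ P y :=
  hs.induction₂ (fun x y => P x ↔ P y) h (fun _ _ _ _ _ _ => Iff.trans)
    (fun _ _ _ _ => Iff.symm) hx hy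

/-- If finitely many locally closed sets cover a set `B`, one of them contains a nonempty relatively
open subset of `B`. -/
theorem exists_isOpen_inter_subset {ι : Type*} [DecidableEq ι] (s : Finset ι) (P : ι → Set X)
    (hP : ∀ i ∈ s, ∀ x ∈ P i, ∃ U, IsOpen U ∧ x ∈ U ∧ U ∩ closure (P i) ⊆ P i) {B : Set X} :
    ∀ O : Set X, IsOpen O → (O ∩ B).Nonempty → O ∩ B ⊆ ⋃ i ∈ s, P i →
      ∃ i ∈ s, ∃ O' ⊆ O, IsOpen O' ∧ (O' ∩ B).Nonempty ∧ O' ∩ B ⊆ P i := by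
  induction s using Finset.strongInduction with
  | H s ih =>
    rintro O hO ⟨x, hxO, hxB⟩ hsub
    obtain ⟨i, his, hxi⟩ : ∃ i ∈ s, x ∈ P i := by simpa using hsub ⟨hxO, hxB⟩
    obtain ⟨U, hU, hxU, hUP⟩ := hP i his x hxi
    by_cases hc : O ∩ U ∩ B ⊆ P i
    · exact ⟨i, his, O ∩ U, inter_subset_left, hO.inter hU, ⟨x, ⟨hxO, hxU⟩, hxB⟩, hc⟩
    · obtain ⟨y, ⟨⟨hyO, hyU⟩, hyB⟩, hyi⟩ := not_subset.1 hc
      have hycl : y ∉ closure (P i) := fun h => hyi (hUP ⟨hyU, h⟩)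
      obtain ⟨j, hj, O', hO'sub, hO', hne, hsub'⟩ := ih (s.erase i) (Finset.erase_ssubset his)
        (fun j hj => hP j (Finset.mem_of_mem_erase hj)) (O ∩ (closure (P i))ᶜ)
        (hO.inter isClosed_closure.isOpen_compl) ⟨y, ⟨hyO, hycl⟩, hyB⟩ (by
          rintro z ⟨⟨hzO, hzcl⟩, hzB⟩
          obtain ⟨j, hjs, hzj⟩ : ∃ j ∈ s, z ∈ P j := by simpa using hsub ⟨hzO, hzB⟩
          refine mem_biUnion (Finset.mem_erase.2 ⟨?_, hjs⟩) hzj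
          rintro rfl
          exact hzcl (subset_closure hzj))
      exact ⟨j, Finset.mem_of_mem_erase hj, O', hO'sub.trans inter_subset_left, hO', hne, hsub'⟩

end Topological

variable {n : ℕ}

/-- The points near which `f` is not affine. -/
def kinks (f : E n → ℝ) : Set (E n) := {x | ∀ a, ¬ AffineNear f x a}

theorem IsSmoothSubmanifold.exists_isOpen_inter_closure_subset {d : ℕ} {M : Set (E n)}
    (hM : IsSmoothSubmanifold d M) : ∀ x ∈ M, ∃ U, IsOpen U ∧ x ∈ U ∧ U ∩ closure M ⊆ M := by
  intro x hx
  obtain ⟨φ, hxs, h1, -, h⟩ := hM.2 x hx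
  refine ⟨φ.source, φ.open_source, hxs, ?_⟩
  rintro y ⟨hys, hy⟩
  rw [h y hys]
  intro i hi
  have hcont : ContinuousAt (fun z => φ z i) y :=
    (EuclideanSpace.proj i).continuous.continuousAt.comp
      (h1.continuousOn.continuousAt (φ.open_source.mem_nhds hys))
  by_contra hne
  have hev : ∀ᶠ z in 𝓝 y, φ z i ≠ 0 ∧ z ∈ φ.source :=
    (hcont.eventually_ne hne).and (φ.open_source.mem_nhds hys)
  obtain ⟨z, ⟨hz1, hzs⟩, hzM⟩ := mem_closure_iff_nhds.1 hy _ hev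
  exact hz1 ((h z hzs).1 hzM i hi)

/-- Near every point of the source of a chart there are points at which a given coordinate does not
vanish. -/
theorem exists_mem_chart_coord_ne_zero (φ : OpenPartialHomeomorph (E n) (E n)) {x : E n}
    (hx : x ∈ φ.source) (l : Fin n) {V : Set (E n)} (hV : V ∈ 𝓝 x) :
    ∃ y ∈ V ∩ φ.source, φ y l ≠ 0 := by
  have hV' : ∀ᶠ z in 𝓝 (φ x), φ.symm z ∈ V ∧ z ∈ φ.target :=
    ((φ.tendsto_symm hx).eventually hV).and (φ.open_target.mem_nhds (φ.map_source hx))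
  obtain ⟨O, hOsub, hO, hxO⟩ := mem_nhds_iff.1 hV'
  obtain ⟨p, hpO, hp⟩ := exists_mem_forall_affine_ne_zero hO ⟨_, hxO⟩
    (G := {((0 : ℝ), (stdVec l : E n))}) (finite_singleton _)
    (by simp [Prod.ext_iff, eq_comm])
  obtain ⟨hpV, hpt⟩ := hOsub hpO
  refine ⟨φ.symm p, ⟨hpV, φ.map_target hpt⟩, ?_⟩
  rw [φ.right_inv hpt]
  simpa [EuclideanSpace.inner_single_left] using hp

/-- The pieces of a piecewise smooth hypersurface, locally closed sets each of which is locally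
contained in the zero set of a coordinate of a chart. -/
theorem IsPiecewiseSmoothHypersurface.exists_pieces {S : Set (E n)}
    (hS : IsPiecewiseSmoothHypersurface S) :
    ∃ (N : ℕ) (P : Fin N → Set (E n)), S = ⋃ i, P i ∧
      (∀ i, ∀ x ∈ P i, ∃ U, IsOpen U ∧ x ∈ U ∧ U ∩ closure (P i) ⊆ P i) ∧
      ∀ i, ∀ x ∈ P i, ∃ (φ : OpenPartialHomeomorph (E n) (E n)) (l : Fin n), x ∈ φ.source ∧
        ∀ y ∈ φ.source, y ∈ P i → φ y l = 0 := by
  obtain ⟨k, m, M, W, hM, hW, -, -, hSeq⟩ := hS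
  have key : ∀ (d : ℕ) (Q : Set (E n)), d < n → IsSmoothSubmanifold d Q → ∀ x ∈ Q,
      ∃ (φ : OpenPartialHomeomorph (E n) (E n)) (l : Fin n), x ∈ φ.source ∧
        ∀ y ∈ φ.source, y ∈ Q → φ y l = 0 := by
    intro d Q hd hQ x hx
    obtain ⟨φ, hxs, -, -, h⟩ := hQ.2 x hx
    exact ⟨φ, ⟨d, hd⟩, hxs, fun y hy hyQ => (h y hy).1 hyQ _ le_rfl⟩
  refine ⟨k + m, Fin.append M W, ?_, ?_, ?_⟩
  · rw [hSeq]
    ext x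
    simp only [mem_union, mem_iUnion]
    constructor
    · rintro (⟨i, hi⟩ | ⟨j, hj⟩)
      · exact ⟨Fin.castAdd m i, by simpa using hi⟩
      · exact ⟨Fin.natAdd k j, by simpa using hj⟩
    · rintro ⟨i, hi⟩
      induction i using Fin.addCases with
      | left i => exact Or.inl ⟨i, by simpa using hi⟩
      | right j => exact Or.inr ⟨j, by simpa using hi⟩
  · intro i
    induction i using Fin.addCases with
    | left i =>
      obtain ⟨-, d, -, hd⟩ := hM i
      simpa using hd.exists_isOpen_inter_closure_subset
    | right j =>
      obtain ⟨d, -, hd⟩ := hW j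
      simpa using hd.exists_isOpen_inter_closure_subset
  · intro i
    induction i using Fin.addCases with
    | left i =>
      obtain ⟨-, d, hdn, hd⟩ := hM i
      simpa using key d _ (by omega) hd
    | right j =>
      obtain ⟨d, hdn, hd⟩ := hW j
      simpa using key d _ (by omega) hd

/-- The complement of a piecewise smooth hypersurface is dense. -/
theorem IsPiecewiseSmoothHypersurface.exists_notMem {S : Set (E n)}
    (hS : IsPiecewiseSmoothHypersurface S) {O : Set (E n)} (hO : IsOpen O) (hne : O.Nonempty) :
    ∃ x ∈ O, x ∉ S := by
  classical
  by_contra! hcon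
  obtain ⟨N, P, hSP, hP, hchart⟩ := hS.exists_pieces
  obtain ⟨i, -, O', -, hO', hne', hsub⟩ := exists_isOpen_inter_subset Finset.univ P
    (fun i _ => hP i) (B := univ) O hO (by simpa using hne) (by
      intro x hx
      simpa [hSP] using hcon x hx.1)
  rw [inter_univ] at hne' hsub
  obtain ⟨x, hx⟩ := hne'
  obtain ⟨φ, l, hxs, h⟩ := hchart i x (hsub hx)
  obtain ⟨y, ⟨hyO, hys⟩, hy⟩ := exists_mem_chart_coord_ne_zero φ hxs l (hO'.mem_nhds hx)
  exact hy (h y hys (hsub hyO))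

theorem genericallyAffine_of_kinks {f : E n → ℝ} (hS : IsPiecewiseSmoothHypersurface (kinks f)) :
    GenericallyAffine f := by
  intro O hO hne
  obtain ⟨x, hxO, hx⟩ := hS.exists_notMem hO hne
  simp only [kinks, mem_ofPred_eq, not_forall, not_not] at hx
  obtain ⟨a, ha⟩ := hx
  exact ⟨a, x, hxO, ha⟩

theorem IsIntegral.zero : IsIntegral (0 : E n) := ⟨0, by simp⟩

theorem IsIntegral.add {v w : E n} (hv : IsIntegral v) (hw : IsIntegral w) :
    IsIntegral (v + w) := by
  obtain ⟨p, hp⟩ := hv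
  obtain ⟨q, hq⟩ := hw
  exact ⟨p + q, fun i => by simp [hp, hq]⟩

theorem IsIntegral.neg {v : E n} (hv : IsIntegral v) : IsIntegral (-v) := by
  obtain ⟨p, hp⟩ := hv
  exact ⟨-p, fun i => by simp [hp]⟩

theorem IsIntegral.sub {v w : E n} (hv : IsIntegral v) (hw : IsIntegral w) :
    IsIntegral (v - w) := by
  rw [sub_eq_add_neg]; exact hv.add hw.neg

/-- If the normal vectors of a convex function are integral and it has finitely many slopes on a
convex open set, these are congruent modulo `ℤⁿ`. -/
theorem isIntegral_sub_of_finite {f : E n → ℝ} (hf : ConvexOn ℝ univ f) (hc : Continuous f)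
    (hgen : GenericallyAffine f) (hint : ∀ x v, IsNormalVector f x v → IsIntegral v)
    {O : Set (E n)} (hO : IsOpen O) (hOc : Convex ℝ O) (hfin : (slopes f O).Finite) {a b : E n}
    (ha : a ∈ slopes f O) (hb : b ∈ slopes f O) : IsIntegral (b - a) := by
  by_contra hcon
  obtain ⟨c, -, hcK, d, -, hdK, x, -, -, -, -, hx⟩ := exists_facet_point hf hc hgen hO hOc hfin
    (K := {c | IsIntegral (c - a)}) ha (by simpa using IsIntegral.zero) hb hcon
  have hcd : c ≠ d := fun h => hdK (h ▸ hcK)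
  have := hint x (c - d) ⟨c, d, hcd, rfl, hx⟩
  refine hdK (?_ : IsIntegral (d - a))
  have e : d - a = (c - a) - (c - d) := by abel
  rw [e]
  exact IsIntegral.sub hcK this

/-- On a connected open set on which the slopes are locally finite, they are congruent modulo
`ℤⁿ`. -/
theorem isIntegral_sub_of_isPreconnected {f : E n → ℝ} (hf : ConvexOn ℝ univ f) (hc : Continuous f)
    (hgen : GenericallyAffine f) (hint : ∀ x v, IsNormalVector f x v → IsIntegral v)
    {O : Set (E n)} (hO : IsPreconnected O)
    (hfin : ∀ x ∈ O, ∃ U ∈ 𝓝 x, (slopes f U).Finite) {a b : E n}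
    (ha : a ∈ slopes f O) (hb : b ∈ slopes f O) : IsIntegral (b - a) := by
  set P : E n → Prop := fun x => ∃ U ∈ 𝓝 x, ∀ c ∈ slopes f U, IsIntegral (c - a) with hP
  have hloc : ∀ x ∈ O, ∀ᶠ y in 𝓝[O] x, (P x ↔ P y) := by
    intro x hx
    obtain ⟨U, hU, hUfin⟩ := hfin x hx
    obtain ⟨r, hr, hrU⟩ := Metric.mem_nhds_iff.1 hU
    have hcong : ∀ c ∈ slopes f (Metric.ball x r), ∀ d ∈ slopes f (Metric.ball x r),
        IsIntegral (d - c) := fun c hc' d hd =>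
      isIntegral_sub_of_finite hf hc hgen hint Metric.isOpen_ball (convex_ball x r)
        (hUfin.subset (slopes_mono f hrU)) hc' hd
    have key : ∀ y ∈ Metric.ball x r, P y → ∀ z ∈ Metric.ball x r, P z := by
      rintro y hy ⟨V, hV, hVc⟩ z hz
      refine ⟨Metric.ball x r, Metric.isOpen_ball.mem_nhds hz, fun d hd => ?_⟩
      obtain ⟨c, hcs⟩ := hgen (interior (V ∩ Metric.ball x r)) isOpen_interior
        ⟨y, mem_interior_iff_mem_nhds.2 (Filter.inter_mem hV (Metric.isOpen_ball.mem_nhds hy))⟩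
      have hcs' := slopes_mono f interior_subset hcs
      have e : d - a = (d - c) + (c - a) := by abel
      rw [e]
      exact (hcong c (slopes_mono f inter_subset_right hcs') d hd).add
        (hVc c (slopes_mono f inter_subset_left hcs'))
    filter_upwards [mem_nhdsWithin_of_mem_nhds (Metric.ball_mem_nhds x hr)] with y hy
    exact ⟨fun h => key x (Metric.mem_ball_self hr) h y hy,
      fun h => key y hy h x (Metric.mem_ball_self hr)⟩
  obtain ⟨x, hxO, hx⟩ := ha
  obtain ⟨y, hyO, hy⟩ := hb
  have hPx : P x := by
    refine ⟨{z | AffineNear f z a}, hx.eventually, ?_⟩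
    rintro c ⟨z, hz, hcz⟩
    rw [hcz.unique hz, sub_self]
    exact IsIntegral.zero
  obtain ⟨U, hU, hUc⟩ := (iff_of_isPreconnected hO hloc hxO hyO).1 hPx
  exact hUc b ⟨y, mem_of_mem_nhds hU, hy⟩

/-- The slopes of a convex function are locally bounded, since it is locally bounded. -/
theorem exists_ball_slopes_bounded {f : E n → ℝ} (hf : ConvexOn ℝ univ f) (hc : Continuous f)
    (x : E n) : ∃ r > 0, ∃ C, ∀ a ∈ slopes f (Metric.ball x r), ‖a‖ ≤ C := by
  obtain ⟨ε, hε, hball⟩ := Metric.continuousAt_iff.1 (hc.continuousAt (x := x)) 1 one_pos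
  refine ⟨ε / 2, by positivity, 4 / ε, ?_⟩
  rintro a ⟨y, hy, hay⟩
  by_contra! hcon
  have ha0 : 0 < ‖a‖ := lt_trans (by positivity) hcon
  -- move from `y` in the direction of `a` by a distance which stays in the larger ball
  set z := y + (ε / 2 / ‖a‖) • a with hz
  have hzy : z - y = (ε / 2 / ‖a‖) • a := by rw [hz]; abel
  have hzx : dist z x < ε := by
    have h1 : dist z y = ε / 2 := by
      rw [dist_eq_norm, hzy, norm_smul, Real.norm_of_nonneg (by positivity)]
      field_simp
    have := dist_triangle z y x
    have := Metric.mem_ball.1 hy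
    linarith
  have h1 := hball hzx
  have h2 := hball (show dist y x < ε by have := Metric.mem_ball.1 hy; linarith)
  have h3 := hay.le hf z
  rw [hzy, inner_smul_right, real_inner_self_eq_norm_sq] at h3
  rw [Real.dist_eq] at h1 h2
  have h4 : ε / 2 / ‖a‖ * ‖a‖ ^ 2 = ε / 2 * ‖a‖ := by field_simp
  have h5 : 2 < ε / 2 * ‖a‖ := by
    rw [div_lt_iff₀ hε] at hcon; linarith
  linarith [abs_lt.1 h1, abs_lt.1 h2]

/-- A translate of the lattice `ℤⁿ` meets every ball in finitely many points. -/
theorem finite_integral_translates (a : E n) (C : ℝ) :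
    {b : E n | IsIntegral (b - a) ∧ ‖b‖ ≤ C}.Finite := by
  obtain ⟨N, hN⟩ := exists_nat_ge (C + ‖a‖)
  refine ((Set.finite_Icc (fun _ : Fin n => -(N : ℤ)) (fun _ => (N : ℤ))).image
    fun m => a + WithLp.toLp 2 fun i => (m i : ℝ)).subset ?_
  rintro b ⟨⟨m, hm⟩, hb⟩
  have hbound : ∀ i, |(m i : ℝ)| ≤ N := fun i => by
    rw [← hm i]
    have h1 : ‖(b - a) i‖ ≤ ‖b - a‖ := PiLp.norm_apply_le (b - a) i
    rw [Real.norm_eq_abs] at h1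
    linarith [norm_sub_le b a]
  refine ⟨m, ⟨fun i => ?_, fun i => ?_⟩, ?_⟩
  · exact_mod_cast (abs_le.1 (hbound i)).1
  · exact_mod_cast (abs_le.1 (hbound i)).2
  · ext i
    have := hm i
    simp only [PiLp.sub_apply] at this
    simp only [PiLp.add_apply]
    linarith

/-- A convex function with integral normal vectors whose kinks form a piecewise smooth hypersurface
has locally finitely many slopes. Indeed, at a point of the bad set where that set is contained in
one smooth piece, hence in a hypersurface `{u = 0}`, the slopes on each of the two sides are
congruent modulo `ℤⁿ` and bounded. -/
theorem exists_nhds_finite_slopes {f : E n → ℝ} (hf : ConvexOn ℝ univ f) (hc : Continuous f)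
    (hS : IsPiecewiseSmoothHypersurface (kinks f))
    (hint : ∀ x v, IsNormalVector f x v → IsIntegral v) (x : E n) :
    ∃ U ∈ 𝓝 x, (slopes f U).Finite := by
  classical
  have hgen := genericallyAffine_of_kinks hS
  by_contra hcon
  set B : Set (E n) := {x | ¬ ∃ U ∈ 𝓝 x, (slopes f U).Finite} with hB
  obtain ⟨N, P, hSP, hP, hchart⟩ := hS.exists_pieces
  have hBS : B ⊆ ⋃ i, P i := by
    rw [← hSP]
    intro y hy a ha
    refine hy ⟨{z | AffineNear f z a}, ha.eventually, (finite_singleton a).subset ?_⟩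
    rintro c ⟨z, hz, hcz⟩
    exact hcz.unique hz
  obtain ⟨i, -, O', -, hO', ⟨x₀, hx₀, hx₀B⟩, hsub⟩ := exists_isOpen_inter_subset Finset.univ P
    (fun i _ => hP i) (B := B) univ isOpen_univ ⟨x, trivial, hcon⟩ (by
      rw [univ_inter]; simpa using hBS)
  obtain ⟨φ, l, hxs, h⟩ := hchart i x₀ (hsub ⟨hx₀, hx₀B⟩)
  obtain ⟨r, hr, C, hC⟩ := exists_ball_slopes_bounded hf hc x₀
  obtain ⟨ρ, hρ, hρsub⟩ := Metric.mem_nhds_iff.1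
    (Filter.inter_mem (φ.open_target.mem_nhds (φ.map_source hxs))
      ((φ.tendsto_symm hxs).eventually
        (Filter.inter_mem (hO'.mem_nhds hx₀) (Metric.ball_mem_nhds x₀ hr))))
  set D := Metric.ball (φ x₀) ρ with hD
  have hDt : D ⊆ φ.target := fun z hz => (hρsub hz).1
  have hDO : ∀ z ∈ D, φ.symm z ∈ O' := fun z hz => (hρsub hz).2.1
  have hDr : ∀ z ∈ D, φ.symm z ∈ Metric.ball x₀ r := fun z hz => (hρsub hz).2.2
  -- the slopes on one side of the hypersurface are congruent and bounded
  have side : ∀ H : Set (E n), Convex ℝ H → (∀ z ∈ H, z l ≠ 0) →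
      (slopes f (φ.symm '' (D ∩ H))).Finite := by
    intro H hHc hHl
    have hpre : IsPreconnected (φ.symm '' (D ∩ H)) :=
      ((convex_ball _ _).inter hHc).isPreconnected.image _
        (φ.continuousOn_symm.mono (inter_subset_left.trans hDt))
    have hfin : ∀ y ∈ φ.symm '' (D ∩ H), ∃ U ∈ 𝓝 y, (slopes f U).Finite := by
      rintro _ ⟨z, ⟨hzD, hzH⟩, rfl⟩
      by_contra hb
      have := h _ (φ.map_target (hDt hzD)) (hsub ⟨hDO z hzD, hb⟩)
      rw [φ.right_inv (hDt hzD)] at this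
      exact hHl z hzH this
    rcases (slopes f (φ.symm '' (D ∩ H))).eq_empty_or_nonempty with he | ⟨a, ha⟩
    · rw [he]; exact finite_empty
    · refine (finite_integral_translates a C).subset fun b hb => ⟨?_, ?_⟩
      · exact isIntegral_sub_of_isPreconnected hf hc hgen hint hpre hfin ha hb
      · refine hC b (slopes_mono f ?_ hb)
        rintro _ ⟨z, ⟨hzD, -⟩, rfl⟩
        exact hDr z hzD
  have hpos : Convex ℝ {z : E n | 0 < z l} :=
    convex_halfSpace_gt (EuclideanSpace.proj (𝕜 := ℝ) l).toLinearMap.isLinear 0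
  have hneg : Convex ℝ {z : E n | z l < 0} :=
    convex_halfSpace_lt (EuclideanSpace.proj (𝕜 := ℝ) l).toLinearMap.isLinear 0
  have hOopen : IsOpen (φ.symm '' D) :=
    φ.isOpen_image_symm_of_subset_target Metric.isOpen_ball hDt
  refine hx₀B ⟨φ.symm '' D, hOopen.mem_nhds ⟨φ x₀, Metric.mem_ball_self hρ, φ.left_inv hxs⟩,
    ((side _ hpos fun z hz => ne_of_gt hz).union (side _ hneg fun z hz => ne_of_lt hz)).subset ?_⟩
  rintro a ⟨y, hy, ha⟩
  obtain ⟨z, hzD, rfl⟩ := hy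
  obtain ⟨w, ⟨⟨haw, w', hw'D, rfl⟩, -⟩, hwl⟩ := exists_mem_chart_coord_ne_zero φ
    (φ.map_target (hDt hzD)) l
    (Filter.inter_mem ha.eventually (hOopen.mem_nhds (mem_image_of_mem _ hzD)))
  rw [φ.right_inv (hDt hw'D)] at hwl
  rcases lt_or_gt_of_ne hwl with hlt | hgt
  · exact Or.inr ⟨_, mem_image_of_mem _ ⟨hw'D, hlt⟩, haw⟩
  · exact Or.inl ⟨_, mem_image_of_mem _ ⟨hw'D, hgt⟩, haw⟩

/-! ### Flatness of the facets -/

theorem hasFDerivAt_inner_comp {p : E n → E n} {z : E n} (hp : DifferentiableAt ℝ p z) (v : E n) :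
    HasFDerivAt (fun y => ⟪v, p y⟫) ((innerSL ℝ v).comp (fderiv ℝ p z)) z :=
  (innerSL ℝ v).hasFDerivAt.comp z hp.hasFDerivAt

/-- A parametrized hypersurface (the normal direction at each point is unique) which is contained
in a finite union of hyperplanes is contained in one hyperplane: its normal direction is continuous
and takes only finitely many values. -/
theorem exists_inner_eq_of_subset_hyperplanes {p : E n → E n} {B : Set (E n)} (hB : IsOpen B)
    (hBc : Convex ℝ B) (hp : ContDiffOn ℝ 1 p B)
    (hpar : ∀ z ∈ B, ∀ v v' : E n, v ≠ 0 → v' ≠ 0 → (∀ w, ⟪v, fderiv ℝ p z w⟫ = 0) →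
      (∀ w, ⟪v', fderiv ℝ p z w⟫ = 0) → ∃ t : ℝ, v' = t • v)
    {G : Set (E n × ℝ)} (hG : G.Finite) (hG0 : ∀ g ∈ G, g.1 ≠ 0)
    (hcov : ∀ z ∈ B, ∃ g ∈ G, ⟪g.1, p z⟫ = g.2) {z₀ : E n} (hz₀ : z₀ ∈ B) :
    ∃ v : E n, v ≠ 0 ∧ ∀ z ∈ B, ⟪v, p z⟫ = ⟪v, p z₀⟫ := by
  classical
  have hdiff : ∀ z ∈ B, DifferentiableAt ℝ p z := fun z hz =>
    (hp.contDiffAt (hB.mem_nhds hz)).differentiableAt one_ne_zero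
  have hfc : ContinuousOn (fderiv ℝ p) B := hp.continuousOn_fderiv_of_isOpen hB le_rfl
  set K : E n → Set (E n) := fun v => {z | z ∈ B ∧ ∀ w, ⟪v, fderiv ℝ p z w⟫ = 0} with hK
  have hKcl : ∀ v, B ∩ closure (K v) ⊆ K v := by
    rintro v z ⟨hzB, hz⟩
    refine ⟨hzB, fun w => ?_⟩
    have hcont : ContinuousAt (fun y => ⟪v, fderiv ℝ p y w⟫) z := by
      have := (hfc.continuousAt (hB.mem_nhds hzB)).clm_apply (continuousAt_const (y := w))
      exact continuousAt_const.inner this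
    by_contra hne
    obtain ⟨y, hy1, hy2⟩ := mem_closure_iff_nhds.1 hz _ (hcont.eventually_ne hne)
    exact hy1 (hy2.2 w)
  have hKcov : ∀ z ∈ B, ∃ g ∈ G, z ∈ K g.1 := by
    intro z hz
    have hzcl : z ∈ closure (⋃ g ∈ G, K g.1) := by
      rw [mem_closure_iff]
      intro O hO hzO
      obtain ⟨g, hg, O', hO'sub, hO', ⟨y, hyO', -⟩, hsub⟩ := exists_isOpen_inter_subset hG.toFinset
        (fun g : E n × ℝ => {z | z ∈ B ∧ ⟪g.1, p z⟫ = g.2}) (by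
          rintro g - x ⟨hxB, -⟩
          refine ⟨B, hB, hxB, ?_⟩
          rintro y ⟨hyB, hy⟩
          refine ⟨hyB, ?_⟩
          have hcont : ContinuousAt (fun y => ⟪g.1, p y⟫) y :=
            continuousAt_const.inner (hdiff y hyB).continuousAt
          by_contra hne
          obtain ⟨y', h1, h2⟩ := mem_closure_iff_nhds.1 hy _ (hcont.eventually_ne hne)
          exact h1 h2.2) (B := univ) (O ∩ B) (hO.inter hB) ⟨z, ⟨hzO, hz⟩, trivial⟩ (by
          rintro y ⟨⟨-, hyB⟩, -⟩
          obtain ⟨g, hg, hgy⟩ := hcov y hyB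
          exact mem_biUnion (hG.mem_toFinset.2 hg) ⟨hyB, hgy⟩)
      rw [inter_univ] at hsub
      have hyB := (hO'sub hyO').2
      refine ⟨y, (hO'sub hyO').1, mem_biUnion (hG.mem_toFinset.1 hg) ⟨hyB, fun w => ?_⟩⟩
      have h1 : HasFDerivAt (fun y => ⟪g.1, p y⟫) (0 : E n →L[ℝ] ℝ) y := by
        refine (hasFDerivAt_const g.2 y).congr_of_eventuallyEq ?_
        filter_upwards [hO'.mem_nhds hyO'] with y' hy' using (hsub hy').2
      have := (hasFDerivAt_inner_comp (hdiff y hyB) g.1).unique h1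
      simpa using DFunLike.congr_fun this w
    rw [hG.closure_biUnion] at hzcl
    obtain ⟨g, hg, hzg⟩ : ∃ g ∈ G, z ∈ closure (K g.1) := by simpa using hzcl
    exact ⟨g, hg, hKcl _ ⟨hz, hzg⟩⟩
  obtain ⟨g₀, hg₀, hz₀K⟩ := hKcov z₀ hz₀
  have hall : ∀ z ∈ B, z ∈ K g₀.1 := by
    have hout : ∀ v, ∀ z ∈ B, z ∉ K v → ∀ᶠ y in 𝓝 z, y ∉ K v := by
      intro v z hz hzv
      have : z ∉ closure (K v) := fun h => hzv (hKcl v ⟨hz, h⟩)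
      filter_upwards [isClosed_closure.isOpen_compl.mem_nhds this] with y hy h
      exact hy (subset_closure h)
    intro z hz
    refine (iff_of_isPreconnected (P := fun z => z ∈ K g₀.1) hBc.isPreconnected ?_ hz₀ hz).1 hz₀K
    intro x hx
    have hev : ∀ᶠ y in 𝓝 x, ∀ g ∈ G, x ∉ K g.1 → y ∉ K g.1 := by
      rw [Filter.eventually_all_finite hG]
      intro g _
      by_cases h : x ∈ K g.1
      · simp [h]
      · simpa [h] using hout _ x hx h
    by_cases hxK : x ∈ K g₀.1
    · filter_upwards [mem_nhdsWithin_of_mem_nhds hev, self_mem_nhdsWithin] with y hy hyB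
      simp only [hxK, true_iff]
      obtain ⟨g, hg, hyg⟩ := hKcov y hyB
      have hxg : x ∈ K g.1 := by
        by_contra h; exact hy g hg h hyg
      obtain ⟨t, ht⟩ := hpar x hx _ _ (hG0 g hg) (hG0 g₀ hg₀) hxg.2 hxK.2
      refine ⟨hyB, fun w => ?_⟩
      rw [ht, inner_smul_left, hyg.2 w, mul_zero]
    · filter_upwards [mem_nhdsWithin_of_mem_nhds (hout _ x hx hxK)] with y hy
      simp [hxK, hy]
  refine ⟨g₀.1, hG0 _ hg₀, fun z hz => ?_⟩
  refine IsOpen.is_const_of_fderiv_eq_zero (𝕜 := ℝ) (f := fun y => ⟪g₀.1, p y⟫) hB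
    hBc.isPreconnected (fun y hy =>
      (hasFDerivAt_inner_comp (hdiff y hy) g₀.1).differentiableAt.differentiableWithinAt) ?_ hz hz₀
  intro y hy
  rw [(hasFDerivAt_inner_comp (hdiff y hy) g₀.1).fderiv]
  ext w
  simpa using (hall y hy).2 w

/-- The projection which replaces the coordinate of index `l` by zero. -/
noncomputable def dropCoord (l : Fin n) : E n →L[ℝ] E n :=
  ContinuousLinearMap.id ℝ (E n) - (EuclideanSpace.proj (𝕜 := ℝ) l).smulRight (stdVec l)

theorem dropCoord_apply (l : Fin n) (z : E n) : dropCoord l z = z - z l • stdVec l := by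
  simp [dropCoord]

theorem dropCoord_self (l : Fin n) (z : E n) : (dropCoord l z) l = 0 := by
  simp [dropCoord_apply]

theorem dropCoord_eq_self {l : Fin n} {z : E n} (hz : z l = 0) : dropCoord l z = z := by
  simp [dropCoord_apply, hz]

/-- A smooth hypersurface has at each point a local parametrization, defined on an open convex set
of `ℝⁿ` but depending on `n - 1` coordinates only, which determines the normal directions. -/
theorem IsSmoothSubmanifold.exists_parametrization {d : ℕ} {M : Set (E n)} (hd : d + 1 = n)
    (hM : IsSmoothSubmanifold d M) {x : E n} (hx : x ∈ M) {U : Set (E n)} (hU : U ∈ 𝓝 x) :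
    ∃ (p : E n → E n) (B : Set (E n)) (z₀ : E n), IsOpen B ∧ Convex ℝ B ∧ z₀ ∈ B ∧ p z₀ = x ∧
      ContDiffOn ℝ 1 p B ∧ (∀ z ∈ B, p z ∈ M ∩ U) ∧ (∀ᶠ y in 𝓝[M] x, y ∈ p '' B) ∧
      ∀ z ∈ B, ∀ v v' : E n, v ≠ 0 → v' ≠ 0 → (∀ w, ⟪v, fderiv ℝ p z w⟫ = 0) →
        (∀ w, ⟪v', fderiv ℝ p z w⟫ = 0) → ∃ t : ℝ, v' = t • v := by
  obtain ⟨φ, hxs, h1, h2, h⟩ := hM.2 x hx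
  set l : Fin n := ⟨d, by omega⟩ with hl
  have hMl : ∀ y ∈ φ.source, (y ∈ M ↔ φ y l = 0) := by
    intro y hy
    rw [h y hy]
    refine ⟨fun h => h l le_rfl, fun h i hi => ?_⟩
    have : i = l := Fin.ext (by simp only [hl]; omega)
    rwa [this]
  have hz₀l : φ x l = 0 := (hMl x hxs).1 hx
  have hev : ∀ᶠ z in 𝓝 (φ x), dropCoord l z ∈ φ.target ∧ φ.symm (dropCoord l z) ∈ U := by
    have ht : Filter.Tendsto (dropCoord l) (𝓝 (φ x)) (𝓝 (φ x)) := by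
      have := (dropCoord l).continuous.tendsto (φ x)
      rwa [dropCoord_eq_self hz₀l] at this
    exact ht.eventually
      ((φ.open_target.eventually_mem (φ.map_source hxs)).and ((φ.tendsto_symm hxs).eventually hU))
  obtain ⟨r, hr, hball⟩ := Metric.mem_nhds_iff.1 hev
  refine ⟨fun z => φ.symm (dropCoord l z), Metric.ball (φ x) r, φ x, Metric.isOpen_ball,
    convex_ball _ _, Metric.mem_ball_self hr, ?_, ?_, ?_, ?_, ?_⟩
  · simp only [dropCoord_eq_self hz₀l, φ.left_inv hxs]
  · exact (h2.of_le (by simp)).comp (dropCoord l).contDiff.contDiffOn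
      fun z hz => (hball hz).1
  · intro z hz
    refine ⟨?_, (hball hz).2⟩
    rw [hMl _ (φ.map_target (hball hz).1), φ.right_inv (hball hz).1]
    exact dropCoord_self l z
  · have hc : ∀ᶠ y in 𝓝 x, y ∈ φ.source ∧ φ y ∈ Metric.ball (φ x) r :=
      (φ.open_source.eventually_mem hxs).and
        ((φ.continuousAt hxs).eventually (Metric.ball_mem_nhds _ hr))
    filter_upwards [mem_nhdsWithin_of_mem_nhds hc, self_mem_nhdsWithin] with y hy hyM
    refine ⟨φ y, hy.2, ?_⟩
    simp only [dropCoord_eq_self ((hMl y hy.1).1 hyM), φ.left_inv hy.1]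
  · intro z hz v v' hv hv' hvz hv'z
    set ζ := dropCoord l z with hζ
    have hζt : ζ ∈ φ.target := (hball hz).1
    have hd2 : DifferentiableAt ℝ φ.symm ζ :=
      (h2.contDiffAt (φ.open_target.mem_nhds hζt)).differentiableAt (by simp)
    have hys := φ.map_target hζt
    have hd1 : DifferentiableAt ℝ φ (φ.symm ζ) :=
      (h1.contDiffAt (φ.open_source.mem_nhds hys)).differentiableAt (by simp)
    set A := fderiv ℝ φ.symm ζ with hA
    have hfd : ∀ w, fderiv ℝ (fun z => φ.symm (dropCoord l z)) z w = A (dropCoord l w) := by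
      intro w
      have : HasFDerivAt (fun z => φ.symm (dropCoord l z)) (A.comp (dropCoord l)) z :=
        hd2.hasFDerivAt.comp z (dropCoord l).hasFDerivAt
      rw [this.fderiv]; rfl
    have hsurj : ∀ u, ∃ w, A w = u := by
      intro u
      refine ⟨fderiv ℝ φ (φ.symm ζ) u, ?_⟩
      have hcomp : HasFDerivAt (φ.symm ∘ φ) (A.comp (fderiv ℝ φ (φ.symm ζ))) (φ.symm ζ) := by
        refine HasFDerivAt.comp _ ?_ hd1.hasFDerivAt
        rw [φ.right_inv hζt]
        exact hd2.hasFDerivAt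
      have hid : HasFDerivAt (φ.symm ∘ φ) (ContinuousLinearMap.id ℝ (E n)) (φ.symm ζ) := by
        refine (hasFDerivAt_id _).congr_of_eventuallyEq ?_
        filter_upwards [φ.open_source.mem_nhds hys] with y hy using φ.left_inv hy
      simpa using DFunLike.congr_fun (hcomp.unique hid) u
    -- a normal vector pairs with the derivative as a multiple of the last coordinate
    have hform : ∀ u : E n, (∀ w, ⟪u, fderiv ℝ (fun z => φ.symm (dropCoord l z)) z w⟫ = 0) →
        ∀ w, ⟪u, A w⟫ = w l * ⟪u, A (stdVec l)⟫ := by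
      intro u hu w
      have := hu w
      rw [hfd, dropCoord_apply, map_sub, map_smul, inner_sub_right, inner_smul_right] at this
      linarith
    have hμ : ⟪v, A (stdVec l)⟫ ≠ 0 := by
      intro h0
      obtain ⟨w, hw⟩ := hsurj v
      have := hform v hvz w
      rw [hw, h0, mul_zero, inner_self_eq_zero] at this
      exact hv this
    refine ⟨⟪v', A (stdVec l)⟫ / ⟪v, A (stdVec l)⟫, ?_⟩
    rw [← sub_eq_zero, ← inner_self_eq_zero (𝕜 := ℝ)]
    obtain ⟨w, hw⟩ := hsurj (v' - (⟪v', A (stdVec l)⟫ / ⟪v, A (stdVec l)⟫) • v)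
    nth_rewrite 2 [← hw]
    rw [inner_sub_left, inner_smul_left, hform v hvz w, hform v' hv'z w, conj_trivial]
    field_simp; ring

/-- At a kink of `f` two of its finitely many tangents agree with `f`. -/
theorem exists_two_tangents {f : E n → ℝ} (hf : ConvexOn ℝ univ f) (hc : Continuous f)
    (hgen : GenericallyAffine f) {O : Set (E n)} (hO : IsOpen O) (hfin : (slopes f O).Finite)
    {x : E n} (hx : x ∈ O) (hk : x ∈ kinks f) :
    ∃ a ∈ slopes f O, ∃ b ∈ slopes f O, a ≠ b ∧ f x = tangent f a x ∧ f x = tangent f b x := by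
  obtain ⟨a, ha, hax⟩ := exists_eq_tangent hf hc hgen hO hfin hx
  by_contra! hcon
  refine hk a ?_
  have hev : ∀ᶠ y in 𝓝 x, ∀ b ∈ slopes f O, b ≠ a → tangent f b y < f y := by
    rw [Filter.eventually_all_finite hfin]
    intro b hb
    by_cases hba : b = a
    · simp [hba]
    have hlt : tangent f b x < f x :=
      lt_of_le_of_ne (tangent_le hf hb x) (hcon a ha b hb (Ne.symm hba) hax).symm
    filter_upwards [(continuous_tangent f b).continuousAt.eventually_lt hc.continuousAt hlt]
      with y hy _ using hy
  filter_upwards [hev, hO.mem_nhds hx] with y hy hyO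
  obtain ⟨b, hb, hby⟩ := exists_eq_tangent hf hc hgen hO hfin hyO
  by_cases hba : b = a
  · rw [hby, hba, tangent_eq_add f a x, ← hax]
  · exact absurd hby (hy b hb hba).ne'

/-- `M` is near `x` contained in the hyperplane through `x` with normal vector `a`. -/
def IsFlatAt (M : Set (E n)) (x a : E n) : Prop := a ≠ 0 ∧ ∀ᶠ y in 𝓝[M] x, ⟪a, y - x⟫ = 0

/-- A smooth hypersurface of kinks is flat near a point with finitely many slopes: the kinks near
the point lie in the finitely many hyperplanes where two of the tangents agree, and a
parametrization cannot switch between these. -/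
theorem IsSmoothSubmanifold.exists_isFlatAt {d : ℕ} {M : Set (E n)} (hd : d + 1 = n)
    (hM : IsSmoothSubmanifold d M) {f : E n → ℝ} (hf : ConvexOn ℝ univ f) (hc : Continuous f)
    (hgen : GenericallyAffine f) (hMk : M ⊆ kinks f) {x : E n} (hx : x ∈ M)
    (hfin : ∃ U ∈ 𝓝 x, (slopes f U).Finite) : ∃ a, IsFlatAt M x a := by
  obtain ⟨U, hU, hUfin⟩ := hfin
  obtain ⟨O, hOU, hO, hxO⟩ := mem_nhds_iff.1 hU
  have hOfin : (slopes f O).Finite := hUfin.subset (slopes_mono f hOU)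
  obtain ⟨p, B, z₀, hB, hBc, hz₀, hpz₀, hp, hpM, himg, hpar⟩ :=
    hM.exists_parametrization hd hx (hO.mem_nhds hxO)
  set I : E n → ℝ := fun a => ⨅ z, (f z - ⟪a, z⟫) with hI
  have hGfin : ((fun q : E n × E n => (q.1 - q.2, I q.2 - I q.1)) ''
      {q | q ∈ slopes f O ×ˢ slopes f O ∧ q.1 ≠ q.2}).Finite :=
    ((hOfin.prod hOfin).subset fun q hq => hq.1).image _
  obtain ⟨v, hv, hvp⟩ := exists_inner_eq_of_subset_hyperplanes hB hBc hp hpar hGfin (by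
      rintro _ ⟨q, ⟨-, hq⟩, rfl⟩
      exact sub_ne_zero.2 hq) (by
      intro z hz
      obtain ⟨a, ha, b, hb, hab, h1, h2⟩ := exists_two_tangents hf hc hgen hO hOfin (hpM z hz).2
        (hMk (hpM z hz).1)
      refine ⟨_, ⟨(a, b), ⟨⟨ha, hb⟩, hab⟩, rfl⟩, ?_⟩
      rw [h1] at h2
      simp only [tangent] at h2
      simp only [hI, inner_sub_left]; linarith) hz₀
  refine ⟨v, hv, ?_⟩
  filter_upwards [himg] with y hy
  obtain ⟨z, hz, rfl⟩ := hy
  rw [inner_sub_right, hvp z hz, hpz₀, sub_self]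

/-- The normal direction at a flat point of a smooth hypersurface is unique up to scaling. -/
theorem IsSmoothSubmanifold.isFlatAt_parallel {d : ℕ} {M : Set (E n)} (hd : d + 1 = n)
    (hM : IsSmoothSubmanifold d M) {x a b : E n} (hx : x ∈ M) (ha : IsFlatAt M x a)
    (hb : IsFlatAt M x b) : ∃ t : ℝ, b = t • a := by
  obtain ⟨U, hU, hUM⟩ := mem_nhdsWithin_iff_exists_mem_nhds_inter.1 (ha.2.and hb.2)
  obtain ⟨p, B, z₀, hB, -, hz₀, hpz₀, hp, hpM, -, hpar⟩ := hM.exists_parametrization hd hx hU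
  have hdiff : DifferentiableAt ℝ p z₀ :=
    (hp.contDiffAt (hB.mem_nhds hz₀)).differentiableAt one_ne_zero
  have key : ∀ v : E n, (∀ z ∈ B, ⟪v, p z - x⟫ = 0) → ∀ w, ⟪v, fderiv ℝ p z₀ w⟫ = 0 := by
    intro v hv w
    have h1 : HasFDerivAt (fun y => ⟪v, p y⟫) (0 : E n →L[ℝ] ℝ) z₀ := by
      refine (hasFDerivAt_const ⟪v, x⟫ z₀).congr_of_eventuallyEq ?_
      filter_upwards [hB.mem_nhds hz₀] with y hy
      have := hv y hy
      rw [inner_sub_right] at this; linarith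
    simpa using DFunLike.congr_fun ((hasFDerivAt_inner_comp hdiff v).unique h1) w
  exact hpar z₀ hz₀ a b ha.1 hb.1
    (key a fun z hz => (hUM ⟨(hpM z hz).2, (hpM z hz).1⟩).1)
    (key b fun z hz => (hUM ⟨(hpM z hz).2, (hpM z hz).1⟩).2)

/-- A connected smooth hypersurface which consists of kinks of a convex function with locally
finitely many slopes lies in a hyperplane. -/
theorem IsSmoothSubmanifold.exists_subset_hyperplane {d : ℕ} {M : Set (E n)} (hd : d + 1 = n)
    (hM : IsSmoothSubmanifold d M) (hMc : IsConnected M) {f : E n → ℝ} (hf : ConvexOn ℝ univ f)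
    (hc : Continuous f) (hgen : GenericallyAffine f) (hMk : M ⊆ kinks f)
    (hfin : ∀ x, ∃ U ∈ 𝓝 x, (slopes f U).Finite) :
    ∃ a : E n, a ≠ 0 ∧ ∃ c : ℝ, ∀ y ∈ M, ⟪a, y⟫ = c := by
  obtain ⟨x₀, hx₀⟩ := hMc.nonempty
  obtain ⟨a, ha⟩ := hM.exists_isFlatAt hd hf hc hgen hMk hx₀ (hfin x₀)
  refine ⟨a, ha.1, ⟪a, x₀⟫, ?_⟩
  have hflat : ∀ x b, IsFlatAt M x b → ∀ᶠ y in 𝓝[M] x, IsFlatAt M y b ∧ ⟪b, y - x⟫ = 0 := by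
    intro x b hb
    obtain ⟨U, hU, hUM⟩ := mem_nhdsWithin_iff_exists_mem_nhds_inter.1 hb.2
    obtain ⟨O, hOU, hO, hxO⟩ := mem_nhds_iff.1 hU
    filter_upwards [mem_nhdsWithin_of_mem_nhds (hO.mem_nhds hxO), self_mem_nhdsWithin]
      with y hyO hyM
    refine ⟨⟨hb.1, ?_⟩, hUM ⟨hOU hyO, hyM⟩⟩
    filter_upwards [mem_nhdsWithin_of_mem_nhds (hO.mem_nhds hyO), self_mem_nhdsWithin]
      with z hzO hzM
    have h1 : ⟪b, z - x⟫ = 0 := hUM ⟨hOU hzO, hzM⟩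
    have h2 : ⟪b, y - x⟫ = 0 := hUM ⟨hOU hyO, hyM⟩
    rw [inner_sub_right] at h1 h2 ⊢; linarith
  intro y hy
  refine ((iff_of_isPreconnected (P := fun x => IsFlatAt M x a ∧ ⟪a, x⟫ = ⟪a, x₀⟫)
    hMc.isPreconnected ?_ hx₀ hy).1 ⟨ha, rfl⟩).2
  intro x hx
  obtain ⟨b, hb⟩ := hM.exists_isFlatAt hd hf hc hgen hMk hx (hfin x)
  filter_upwards [hflat x b hb, self_mem_nhdsWithin] with y hy hyM
  obtain ⟨hyb, hyx⟩ := hy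
  rw [inner_sub_right] at hyx
  have hba : ∀ t : ℝ, a = t • b → ⟪a, y⟫ = ⟪a, x⟫ ∧ t ≠ 0 := by
    rintro t rfl
    refine ⟨?_, fun h => ha.1 (by simp [h])⟩
    rw [inner_smul_left, inner_smul_left]
    congr 1; linarith
  constructor
  · rintro ⟨hxa, hxe⟩
    obtain ⟨t, ht⟩ := hM.isFlatAt_parallel hd hx hb hxa
    obtain ⟨h1, -⟩ := hba t ht
    refine ⟨⟨ha.1, ?_⟩, h1.trans hxe⟩
    filter_upwards [hyb.2] with z hz
    rw [ht, inner_smul_left, hz, mul_zero]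
  · rintro ⟨hya, hye⟩
    obtain ⟨t, ht⟩ := hM.isFlatAt_parallel hd hyM hyb hya
    obtain ⟨h1, -⟩ := hba t ht
    refine ⟨⟨ha.1, ?_⟩, h1.symm.trans hye⟩
    filter_upwards [hb.2] with z hz
    rw [ht, inner_smul_left, hz, mul_zero]

/-! ### Global finiteness of the slopes -/

/-- A function which is affine near every point off finitely many hyperplanes has finitely many
slopes: there is at most one for each cell of the arrangement. -/
theorem finite_slopes_of_subset_hyperplanes {f : E n → ℝ} {G : Set (E n × ℝ)} (hG : G.Finite)
    (hG0 : ∀ g ∈ G, g.1 ≠ 0) (hk : ∀ x ∈ kinks f, ∃ g ∈ G, ⟪g.1, x⟫ = g.2) :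
    (slopes f univ).Finite := by
  have hpt : ∀ a ∈ slopes f univ, ∃ x, AffineNear f x a ∧ ∀ g ∈ G, ⟪g.1, x⟫ ≠ g.2 := by
    rintro a ⟨x, -, hx⟩
    obtain ⟨O, hOsub, hO, hxO⟩ := mem_nhds_iff.1 hx.eventually
    obtain ⟨y, hyO, hy⟩ := exists_mem_forall_affine_ne_zero hO ⟨x, hxO⟩
      (hG.image fun g => (-g.2, g.1)) (by
        rintro ⟨g, hg, h0⟩
        exact hG0 g hg (Prod.ext_iff.1 h0).2)
    refine ⟨y, hOsub hyO, fun g hg h => hy _ (mem_image_of_mem _ hg) ?_⟩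
    simp only; linarith
  choose! pt hpt1 hpt2 using hpt
  refine Finite.of_finite_image (f := fun a => {g ∈ G | g.2 < ⟪g.1, pt a⟫})
    (hG.finite_subsets.subset ?_) ?_
  · rintro _ ⟨a, -, rfl⟩
    exact fun g hg => hg.1
  · intro a ha b hb hab
    have hseg : ∀ z ∈ segment ℝ (pt a) (pt b), ∃ c, AffineNear f z c := by
      rintro z ⟨s, t, hs, ht, hst, rfl⟩
      by_contra! hz
      obtain ⟨g, hg, hgz⟩ := hk _ hz
      have hiff : g.2 < ⟪g.1, pt a⟫ ↔ g.2 < ⟪g.1, pt b⟫ := by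
        have := Set.ext_iff.1 hab g
        simpa [hg] using this
      have ha' := hpt2 a ha g hg
      have hb' := hpt2 b hb g hg
      rw [inner_add_right, inner_smul_right, inner_smul_right] at hgz
      have hs' : s = 1 - t := by linarith
      subst hs'
      rcases lt_or_gt_of_ne ha' with h1 | h1 <;> rcases lt_or_gt_of_ne hb' with h2 | h2
      · rcases hs.eq_or_lt with h | h <;> nlinarith
      · exact absurd (hiff.2 h2) (by linarith)
      · exact absurd (hiff.1 h1) (by linarith)
      · rcases hs.eq_or_lt with h | h <;> nlinarith
    have := (iff_of_isPreconnected (P := fun z => AffineNear f z a)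
      (convex_segment (pt a) (pt b)).isPreconnected ?_ (left_mem_segment _ _ _)
      (right_mem_segment _ _ _)).1 (hpt1 a ha)
    · exact this.unique (hpt1 b hb)
    · intro x hx
      obtain ⟨c, hcx⟩ := hseg x hx
      filter_upwards [mem_nhdsWithin_of_mem_nhds hcx.eventually] with y hy
      constructor
      · intro h; rwa [h.unique hcx]
      · intro h; rwa [h.unique hy]

/-- A convex function with integral normal vectors whose kinks form a piecewise smooth hypersurface
has finitely many slopes, and these are congruent modulo `ℤⁿ`. -/
theorem finite_slopes_and_isIntegral_sub {f : E n → ℝ} (hf : ConvexOn ℝ univ f) (hc : Continuous f)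
    (hS : IsPiecewiseSmoothHypersurface (kinks f))
    (hint : ∀ x v, IsNormalVector f x v → IsIntegral v) :
    (slopes f univ).Finite ∧
      ∀ a ∈ slopes f univ, ∀ b ∈ slopes f univ, IsIntegral (b - a) := by
  have hgen := genericallyAffine_of_kinks hS
  have hloc := exists_nhds_finite_slopes hf hc hS hint
  have hfin : (slopes f univ).Finite := by
    obtain ⟨k, m, M, W, hM, -, -, hWcl, hSeq⟩ := hS
    have hMH : ∀ i, ∃ g : E n × ℝ, g.1 ≠ 0 ∧ ∀ y ∈ M i, ⟪g.1, y⟫ = g.2 := by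
      intro i
      obtain ⟨hMc, d, hd, hMi⟩ := hM i
      obtain ⟨a, ha, c, hac⟩ := hMi.exists_subset_hyperplane hd hMc hf hc hgen
        (hSeq ▸ (subset_iUnion M i).trans subset_union_left) hloc
      exact ⟨(a, c), ha, hac⟩
    choose g hg0 hg using hMH
    have hcl : IsClosed (⋃ i, {y : E n | ⟪(g i).1, y⟫ = (g i).2}) :=
      isClosed_iUnion_of_finite fun i => isClosed_eq (by fun_prop) continuous_const
    have hsub : closure (⋃ i, M i) ⊆ ⋃ i, {y : E n | ⟪(g i).1, y⟫ = (g i).2} :=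
      closure_minimal (iUnion_mono fun i y hy => hg i y hy) hcl
    refine finite_slopes_of_subset_hyperplanes (G := range g) (finite_range g)
      (by rintro _ ⟨i, rfl⟩; exact hg0 i) fun x hx => ?_
    have hx' : x ∈ closure (⋃ i, M i) := by
      rw [hSeq] at hx
      rcases hx with hx | hx
      · exact subset_closure hx
      · obtain ⟨j, hj⟩ := mem_iUnion.1 hx
        exact hWcl j hj
    obtain ⟨i, hi⟩ := mem_iUnion.1 (hsub hx')
    exact ⟨g i, mem_range_self i, hi⟩
  exact ⟨hfin, fun a ha b hb =>
    isIntegral_sub_of_finite hf hc hgen hint isOpen_univ convex_univ hfin ha hb⟩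

/-! ### Tropical polynomials -/

/-- The vector in `ℝⁿ` of a vector in `ℤⁿ`. -/
noncomputable def intVec (m : Fin n → ℤ) : E n := WithLp.toLp 2 fun i => (m i : ℝ)

theorem inner_intVec (m : Fin n → ℤ) (x : E n) : ⟪intVec m, x⟫ = ∑ i, (m i : ℝ) * x i := by
  simp [intVec, PiLp.inner_apply, mul_comm]

theorem isIntegral_iff {v : E n} : IsIntegral v ↔ ∃ m, v = intVec m := by
  constructor
  · rintro ⟨m, hm⟩
    exact ⟨m, by ext i; simp [intVec, hm]⟩
  · rintro ⟨m, rfl⟩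
    exact ⟨m, fun i => rfl⟩

/-- A maximum of finitely many affine functions with integral slopes, in coordinate-free form. -/
theorem isTropicalPolynomial_iff {f : E n → ℝ} :
    IsTropicalPolynomial f ↔ ∃ (A : Finset (Fin n → ℤ)) (hA : A.Nonempty) (ν : (Fin n → ℤ) → ℝ),
      ∀ x, f x = A.sup' hA fun α => -ν α + ⟪intVec α, x⟫ := by
  simp only [IsTropicalPolynomial, inner_intVec]

theorem IsTropicalPolynomial.convexOn {f : E n → ℝ} (hf : IsTropicalPolynomial f) :
    ConvexOn ℝ univ f := by
  obtain ⟨A, hA, ν, h⟩ := isTropicalPolynomial_iff.1 hf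
  refine ⟨convex_univ, fun x _ y _ s t hs ht hst => ?_⟩
  rw [h (s • x + t • y)]
  refine Finset.sup'_le _ _ fun α hα => ?_
  have h1 : -ν α + ⟪intVec α, x⟫ ≤ f x := by
    rw [h]; exact Finset.le_sup' (fun α => -ν α + ⟪intVec α, x⟫) hα
  have h2 : -ν α + ⟪intVec α, y⟫ ≤ f y := by
    rw [h]; exact Finset.le_sup' (fun α => -ν α + ⟪intVec α, y⟫) hα
  have e : -ν α + ⟪intVec α, s • x + t • y⟫ =
      s * (-ν α + ⟪intVec α, x⟫) + t * (-ν α + ⟪intVec α, y⟫) := by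
    rw [inner_add_right, inner_smul_right, inner_smul_right]
    linear_combination ν α * hst
  rw [e, smul_eq_mul, smul_eq_mul]
  gcongr

theorem IsTropicalPolynomial.continuous {f : E n → ℝ} (hf : IsTropicalPolynomial f) :
    Continuous f := by
  obtain ⟨A, hA, ν, h⟩ := isTropicalPolynomial_iff.1 hf
  rw [funext h]
  exact Continuous.finset_sup'_apply hA fun α _ => by fun_prop

theorem IsTropicalPolynomial.slopes_subset {f : E n → ℝ} (hf : IsTropicalPolynomial f) :
    ∃ A : Finset (Fin n → ℤ), slopes f univ ⊆ intVec '' (A : Set (Fin n → ℤ)) := by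
  obtain ⟨A, hA, ν, h⟩ := isTropicalPolynomial_iff.1 hf
  refine ⟨A, ?_⟩
  rintro a ⟨x, -, hx⟩
  obtain ⟨α, hα, hαx⟩ := Finset.exists_mem_eq_sup' hA fun α => -ν α + ⟪intVec α, x⟫
  refine ⟨α, hα, sub_eq_zero.1 (eq_zero_of_eventually_inner_nonpos (x := x) ?_)⟩
  filter_upwards [hx] with y hy
  have h1 : -ν α + ⟪intVec α, y⟫ ≤ f y := by
    rw [h]; exact Finset.le_sup' (fun α => -ν α + ⟪intVec α, y⟫) hα
  rw [hy, h x, hαx] at h1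
  simp only [inner_sub_left, inner_sub_right] at h1 ⊢; linarith

theorem IsTropicalPolynomial.finite_slopes {f : E n → ℝ} (hf : IsTropicalPolynomial f) :
    (slopes f univ).Finite := by
  obtain ⟨A, hA⟩ := hf.slopes_subset
  exact (A.finite_toSet.image _).subset hA

theorem IsTropicalPolynomial.isIntegral_of_mem_slopes {f : E n → ℝ} (hf : IsTropicalPolynomial f)
    {a : E n} (ha : a ∈ slopes f univ) : IsIntegral a := by
  obtain ⟨A, hA⟩ := hf.slopes_subset
  obtain ⟨m, -, rfl⟩ := hA ha
  exact isIntegral_iff.2 ⟨m, rfl⟩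

theorem intVec_injective : Function.Injective (intVec : (Fin n → ℤ) → E n) := by
  intro m m' h
  ext i
  have := congrArg (fun v : E n => v i) h
  simpa [intVec] using this

theorem IsTropicalPolynomial.genericallyAffine {f : E n → ℝ} (hf : IsTropicalPolynomial f) :
    GenericallyAffine f := by
  obtain ⟨A, hA, ν, h⟩ := isTropicalPolynomial_iff.1 hf
  intro O hO hne
  -- at a point where the terms take distinct values, only one of them is maximal
  obtain ⟨p, hpO, hp⟩ := exists_mem_forall_affine_ne_zero hO hne
    (G := (fun q : (Fin n → ℤ) × (Fin n → ℤ) => (ν q.2 - ν q.1, intVec q.1 - intVec q.2)) ''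
      {q | q ∈ (A : Set (Fin n → ℤ)) ×ˢ (A : Set (Fin n → ℤ)) ∧ q.1 ≠ q.2})
    (((A.finite_toSet.prod A.finite_toSet).subset fun q hq => hq.1).image _) (by
      rintro ⟨q, ⟨-, hq⟩, h0⟩
      exact hq (intVec_injective (sub_eq_zero.1 (Prod.ext_iff.1 h0).2)))
  obtain ⟨α, hα, hαp⟩ := Finset.exists_mem_eq_sup' hA fun α => -ν α + ⟪intVec α, p⟫
  have hlt : ∀ β ∈ A, β ≠ α → -ν β + ⟪intVec β, p⟫ < -ν α + ⟪intVec α, p⟫ := by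
    intro β hβ hβα
    refine lt_of_le_of_ne ?_ fun heq => hp _ ⟨(β, α), ⟨⟨hβ, hα⟩, hβα⟩, rfl⟩ ?_
    · exact (Finset.le_sup' (fun α => -ν α + ⟪intVec α, p⟫) hβ).trans hαp.le
    · simp only [inner_sub_left]; linarith
  have hev : ∀ᶠ y in 𝓝 p, ∀ β ∈ A, -ν β + ⟪intVec β, y⟫ ≤ -ν α + ⟪intVec α, y⟫ := by
    rw [Filter.eventually_all_finset]
    intro β hβ
    by_cases hβα : β = α
    · simp [hβα]
    have hc : ∀ γ : Fin n → ℤ, ContinuousAt (fun y : E n => -ν γ + ⟪intVec γ, y⟫) p := fun γ =>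
      Continuous.continuousAt (by fun_prop)
    filter_upwards [(hc β).eventually_lt (hc α) (hlt β hβ hβα)] with y hy using hy.le
  refine ⟨intVec α, p, hpO, ?_⟩
  filter_upwards [hev] with y hy
  rw [h y, h p, hαp, le_antisymm (Finset.sup'_le hA _ hy)
    (Finset.le_sup' (fun α => -ν α + ⟪intVec α, y⟫) hα), inner_sub_right]
  ring

/-- A convex function with finitely many slopes, congruent modulo `ℤⁿ`, becomes a tropical
polynomial after subtraction of one of its slopes. -/
theorem exists_isTropicalPolynomial_add {f : E n → ℝ} (hf : ConvexOn ℝ univ f) (hc : Continuous f)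
    (hgen : GenericallyAffine f) (hfin : (slopes f univ).Finite)
    (hint : ∀ a ∈ slopes f univ, ∀ b ∈ slopes f univ, IsIntegral (b - a)) :
    ∃ a : E n, IsTropicalPolynomial fun x => f x + ⟪a, x⟫ := by
  classical
  obtain ⟨a, ha⟩ := hgen univ isOpen_univ univ_nonempty
  have hex : ∀ b ∈ slopes f univ, ∃ m, b - a = intVec m := fun b hb =>
    isIntegral_iff.1 (hint a ha b hb)
  choose! m hm using hex
  refine ⟨-a, isTropicalPolynomial_iff.2 ⟨hfin.toFinset.image m, ⟨m a, ?_⟩,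
    fun α => -⨅ z, (f z - ⟪a + intVec α, z⟫), fun x => ?_⟩⟩
  · exact Finset.mem_image_of_mem _ (hfin.mem_toFinset.2 ha)
  have key : ∀ b ∈ slopes f univ, - -(⨅ z, (f z - ⟪a + intVec (m b), z⟫)) + ⟪intVec (m b), x⟫ =
      tangent f b x - ⟪a, x⟫ := by
    intro b hb
    rw [← hm b hb, add_sub_cancel, inner_sub_left, tangent]; ring
  refine le_antisymm ?_ (Finset.sup'_le _ _ fun α hα => ?_)
  · obtain ⟨b, hb, hbx⟩ := exists_eq_tangent hf hc hgen isOpen_univ hfin (mem_univ x)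
    rw [inner_neg_left, ← sub_eq_add_neg, hbx, ← key b hb]
    exact Finset.le_sup' (fun α => - -(⨅ z, (f z - ⟪a + intVec α, z⟫)) + ⟪intVec α, x⟫)
      (Finset.mem_image_of_mem _ (hfin.mem_toFinset.2 hb))
  · obtain ⟨b, hb, rfl⟩ := Finset.mem_image.1 hα
    have hb' := hfin.mem_toFinset.1 hb
    rw [key b hb', inner_neg_left, ← sub_eq_add_neg]
    exact sub_le_sub_right (tangent_le hf hb' x) _

/-- A normal vector is a difference of two slopes. -/
theorem IsNormalVector.exists_slopes {f : E n → ℝ} {x v : E n} (h : IsNormalVector f x v) :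
    ∃ a ∈ slopes f univ, ∃ b ∈ slopes f univ, v = a - b := by
  have key : ∀ a b : E n, a ≠ b →
      (∀ᶠ y in 𝓝 x, f y = max (f x + ⟪a, y - x⟫) (f x + ⟪b, y - x⟫)) → a ∈ slopes f univ := by
    intro a b hab hev
    have hfreq : ∃ᶠ y in 𝓝 x, 0 < ⟪a - b, y - x⟫ := by
      intro hcon
      refine hab (sub_eq_zero.1 (eq_zero_of_eventually_inner_nonpos (x := x) ?_))
      filter_upwards [hcon] with y hy using not_lt.1 hy
    obtain ⟨y, hy, hypos⟩ := (hev.eventually_nhds.and_frequently hfreq).exists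
    refine ⟨y, trivial, ?_⟩
    have hpos : ∀ᶠ z in 𝓝 y, 0 < ⟪a - b, z - x⟫ :=
      (show Continuous fun z : E n => ⟪a - b, z - x⟫ by fun_prop).continuousAt.eventually
        (lt_mem_nhds hypos)
    have hval : ∀ᶠ z in 𝓝 y, f z = f x + ⟪a, z - x⟫ := by
      filter_upwards [hy, hpos] with z hz hzpos
      rw [hz, max_eq_left]
      rw [inner_sub_left] at hzpos; linarith
    filter_upwards [hval] with z hz
    rw [hz, hval.self_of_nhds, add_assoc, ← inner_add_right]
    congr 2; abel
  obtain ⟨a, b, hab, rfl, hev⟩ := h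
  exact ⟨a, key a b hab hev, b, key b a hab.symm (by simpa only [max_comm] using hev), rfl⟩

theorem IsNormalVector.add_affine {f g : E n → ℝ} {x v : E n} (h : IsNormalVector f x v) {c : ℝ}
    {w : E n} (hg : ∀ y, g y = f y + (c + ⟪w, y⟫)) : IsNormalVector g x v := by
  obtain ⟨a, b, hab, hv, hev⟩ := h
  refine ⟨a + w, b + w, by simpa using hab, by rw [hv]; abel, ?_⟩
  filter_upwards [hev] with y hy
  rw [hg, hg, hy, ← max_add_add_right]
  congr 1 <;> simp only [inner_add_left, inner_sub_right] <;> ring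

/-! ### The strata of the kinks -/

/-- Where a convex function has finitely many slopes, its kinks are the points at which it is not
smooth. -/
theorem kinks_eq_singularSet {f : E n → ℝ} (hf : ConvexOn ℝ univ f) (hc : Continuous f)
    (hgen : GenericallyAffine f) (hfin : (slopes f univ).Finite) : kinks f = singularSet f := by
  ext x
  constructor
  · intro hx hsm
    obtain ⟨a, ha, b, hb, hab, hax, hbx⟩ := exists_two_tangents hf hc hgen isOpen_univ hfin
      (mem_univ x) hx
    have hd : DifferentiableAt ℝ f x := hsm.differentiableAt (by simp)
    have key : ∀ c ∈ slopes f univ, f x = tangent f c x → fderiv ℝ f x = innerSL ℝ c := by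
      intro c hc' hcx
      have hT : HasFDerivAt (tangent f c) (innerSL ℝ c) x := by
        unfold tangent
        exact (innerSL ℝ c).hasFDerivAt.const_add _
      have hmin : IsLocalMin (fun y => f y - tangent f c y) x := by
        refine Filter.Eventually.of_forall fun y => ?_
        simp only [← hcx, sub_self, sub_nonneg]
        exact tangent_le hf hc' y
      have := hmin.hasFDerivAt_eq_zero (hd.hasFDerivAt.sub hT)
      exact sub_eq_zero.1 this
    have h := (key a ha hax).symm.trans (key b hb hbx)
    refine hab (ext_inner_right ℝ fun w => ?_)
    simpa using DFunLike.congr_fun h w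
  · intro hx a ha
    refine hx ?_
    have : ContDiffAt ℝ ∞ (fun y => f x + ⟪a, y - x⟫) x := contDiffAt_const.add
      ((innerSL ℝ a).contDiff.contDiffAt.comp x (contDiffAt_id.sub contDiffAt_const))
    exact this.congr_of_eventuallyEq ha

/-- The slopes whose tangents agree with `f` at `x`. -/
def active (f : E n → ℝ) (x : E n) : Set (E n) := {a ∈ slopes f univ | f x = tangent f a x}

/-- The points with a given set of active slopes: the relative interior of a cell of the polyhedral
subdivision defined by `f`. -/
def stratum (f : E n → ℝ) (A : Set (E n)) : Set (E n) := {x | active f x = A}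

/-- Active slopes occur arbitrarily near the point, since cells are star-shaped. -/
theorem mem_slopes_of_active {f : E n → ℝ} (hf : ConvexOn ℝ univ f) {x a : E n}
    (ha : a ∈ active f x) {O : Set (E n)} (hO : O ∈ 𝓝 x) : a ∈ slopes f O := by
  obtain ⟨⟨w, -, hw⟩, hx⟩ := ha
  have hcont : Continuous fun t : ℝ => x + t • (w - x) := by fun_prop
  have hev : ∀ᶠ t in 𝓝[>] (0 : ℝ), x + t • (w - x) ∈ O ∧ t < 1 := by
    refine ((hcont.tendsto' 0 x (by simp)).eventually hO).filter_mono nhdsWithin_le_nhds |>.and ?_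
    exact mem_nhdsWithin_of_mem_nhds (Iio_mem_nhds one_pos)
  obtain ⟨t, ⟨htO, ht1⟩, ht0⟩ := (hev.and self_mem_nhdsWithin).exists
  have ht0 : (0 : ℝ) < t := ht0
  refine ⟨_, htO, ?_⟩
  have hval : ∀ᶠ y in 𝓝 (x + t • (w - x)), f y = tangent f a y := by
    have hback : Continuous fun y : E n => x + t⁻¹ • (y - x) := by fun_prop
    have htend := hback.tendsto' (x + t • (w - x)) w (by
      simp only [add_sub_cancel_left, smul_smul, inv_mul_cancel₀ ht0.ne', one_smul,
        add_sub_cancel])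
    filter_upwards [htend.eventually (hw.eventually_eq_tangent hf)] with y hy
    refine le_antisymm ?_ (tangent_le hf (O := univ) ⟨w, trivial, hw⟩ y)
    have e : y = (1 - t) • x + t • (x + t⁻¹ • (y - x)) := by
      rw [smul_add, smul_smul, mul_inv_cancel₀ ht0.ne', one_smul, sub_smul, one_smul]; abel
    have h1 := hf.2 (mem_univ x) (mem_univ (x + t⁻¹ • (y - x))) (by linarith : 0 ≤ 1 - t) ht0.le
      (by ring)
    rw [← e, hy, hx, smul_eq_mul, smul_eq_mul] at h1
    refine h1.trans_eq ?_
    have e' : tangent f a y = tangent f a ((1 - t) • x + t • (x + t⁻¹ • (y - x))) := by rw [← e]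
    rw [e']
    simp only [tangent, inner_add_right, inner_smul_right]; ring
  filter_upwards [hval] with y hy
  rw [hy, hval.self_of_nhds]
  exact tangent_eq_add f a _ _

theorem mem_kinks_iff {f : E n → ℝ} (hf : ConvexOn ℝ univ f) (hc : Continuous f)
    (hgen : GenericallyAffine f) (hfin : (slopes f univ).Finite) {x : E n} :
    x ∈ kinks f ↔ (active f x).Nontrivial := by
  constructor
  · intro hx
    obtain ⟨a, ha, b, hb, hab, hax, hbx⟩ := exists_two_tangents hf hc hgen isOpen_univ hfin
      (mem_univ x) hx
    exact ⟨a, ⟨ha, hax⟩, b, ⟨hb, hbx⟩, hab⟩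
  · rintro ⟨a, ha, b, hb, hab⟩ c hcx
    have key : ∀ d ∈ active f x, d = c := by
      intro d hd
      obtain ⟨y, hy, hyd⟩ := mem_slopes_of_active hf hd hcx.eventually
      exact hyd.unique hy
    exact hab ((key a ha).trans (key b hb).symm)

/-- Strata are convex, hence connected, as the pieces of a piecewise smooth set have to be. -/
theorem convex_stratum {f : E n → ℝ} (hf : ConvexOn ℝ univ f) {A : Set (E n)} (hA : A.Nonempty) :
    Convex ℝ (stratum f A) := by
  intro x hx y hy s t hs ht hst
  have hlin : ∀ c, tangent f c (s • x + t • y) = s * tangent f c x + t * tangent f c y := by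
    intro c
    simp only [tangent, inner_add_right, inner_smul_right]
    linear_combination (-(⨅ z, (f z - ⟪c, z⟫))) * hst
  have hle := hf.2 (mem_univ x) (mem_univ y) hs ht hst
  rw [smul_eq_mul, smul_eq_mul] at hle
  simp only [stratum, mem_ofPred_eq] at hx hy ⊢
  have hin : ∀ a ∈ A, a ∈ slopes f univ ∧ f (s • x + t • y) = tangent f a (s • x + t • y) := by
    intro a ha
    have h1 : a ∈ active f x := hx ▸ ha
    have h2 : a ∈ active f y := hy ▸ ha
    refine ⟨h1.1, le_antisymm ?_ (tangent_le hf h1.1 _)⟩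
    rw [hlin, ← h1.2, ← h2.2]; exact hle
  obtain ⟨a, ha⟩ := hA
  refine Subset.antisymm (fun b hb => ?_) hin
  by_contra hbA
  have hbx : tangent f b x < f x := lt_of_le_of_ne (tangent_le hf hb.1 x)
    fun h => hbA (hx ▸ (⟨hb.1, h.symm⟩ : b ∈ active f x))
  have hby : tangent f b y < f y := lt_of_le_of_ne (tangent_le hf hb.1 y)
    fun h => hbA (hy ▸ (⟨hb.1, h.symm⟩ : b ∈ active f y))
  have h1 : a ∈ active f x := hx ▸ ha
  have h2 : a ∈ active f y := hy ▸ ha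
  have h3 := hb.2.symm.trans (hin a ha).2
  rw [hlin, hlin, ← h1.2, ← h2.2] at h3
  rcases hs.eq_or_lt with h | h <;> nlinarith

/-- Every subspace of dimension `d` is a coordinate subspace after a linear change of
coordinates. -/
theorem exists_continuousLinearEquiv_mem_iff (D : Submodule ℝ (E n)) :
    ∃ e : E n ≃L[ℝ] E n, ∀ v, v ∈ D ↔ ∀ i : Fin n, Module.finrank ℝ D ≤ (i : ℕ) → e v i = 0 := by
  set d := Module.finrank ℝ D with hd
  have hsum : d + Module.finrank ℝ Dᗮ = n := by
    rw [hd, D.finrank_add_finrank_orthogonal, finrank_euclideanSpace_fin]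
  set b : Module.Basis (Fin d ⊕ Fin (Module.finrank ℝ Dᗮ)) ℝ (E n) :=
    ((Module.finBasis ℝ D).prod (Module.finBasis ℝ Dᗮ)).map
      (Submodule.prodEquivOfIsCompl D Dᗮ D.isCompl_orthogonal) with hb
  set r : Fin d ⊕ Fin (Module.finrank ℝ Dᗮ) ≃ Fin n := finSumFinEquiv.trans (finCongr hsum) with hr
  set e : E n ≃L[ℝ] E n := ((b.reindex r).equivFun.trans
    (WithLp.linearEquiv 2 ℝ (Fin n → ℝ)).symm).toContinuousLinearEquiv with he
  refine ⟨e, fun v => ?_⟩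
  have hcoord : ∀ j, e v (r j) = b.repr v j := by
    intro j
    simp [he]
  have hmem : v ∈ D ↔ ∀ j, b.repr v (Sum.inr j) = 0 := by
    have hrepr : ∀ j, b.repr v (Sum.inr j) = (Module.finBasis ℝ Dᗮ).repr
        ((Submodule.prodEquivOfIsCompl D Dᗮ D.isCompl_orthogonal).symm v).2 j := by
      intro j
      simp [hb]
    simp only [hrepr]
    rw [← Submodule.prodEquivOfIsCompl_symm_apply_snd_eq_zero D Dᗮ D.isCompl_orthogonal]
    constructor
    · intro h j
      rw [h, map_zero, Finsupp.zero_apply]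
    · intro h
      exact (Module.finBasis ℝ Dᗮ).ext_elem fun j => by simpa using h j
  rw [hmem]
  constructor
  · intro h i hi
    obtain ⟨j, rfl⟩ := r.surjective i
    rw [hcoord]
    rcases j with j | j
    · simp [hr] at hi; omega
    · exact h j
  · intro h j
    rw [← hcoord]
    exact h _ (by simp [hr])

/-- A set which is near each of its points a translate of a subspace of dimension `d` is a smooth
submanifold of dimension `d`. -/
theorem isSmoothSubmanifold_of_subspace {M : Set (E n)} (D : Submodule ℝ (E n))
    (h : ∀ x ∈ M, ∀ᶠ y in 𝓝 x, (y ∈ M ↔ y - x ∈ D)) :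
    IsSmoothSubmanifold (Module.finrank ℝ D) M := by
  refine ⟨(Submodule.finrank_le D).trans_eq finrank_euclideanSpace_fin, fun x hx => ?_⟩
  obtain ⟨e, he⟩ := exists_continuousLinearEquiv_mem_iff D
  obtain ⟨O, hOsub, hO, hxO⟩ := mem_nhds_iff.1 (h x hx)
  set φ : OpenPartialHomeomorph (E n) (E n) :=
    ((Homeomorph.subRight x).trans e.toHomeomorph).toOpenPartialHomeomorph.restrOpen O hO with hφ
  have hsrc : φ.source = O := by simp [hφ]
  have hval : ∀ y, φ y = e (y - x) := fun y => rfl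
  have hinv : ∀ y, φ.symm y = e.symm y + x := fun y => rfl
  refine ⟨φ, hsrc ▸ hxO, ?_, ?_, fun y hy => ?_⟩
  · refine ContDiff.contDiffOn ?_
    rw [show (φ : E n → E n) = fun y => e (y - x) from funext hval]
    fun_prop
  · refine ContDiff.contDiffOn ?_
    rw [show (φ.symm : E n → E n) = fun y => e.symm y + x from funext hinv]
    fun_prop
  · rw [show (y ∈ M ↔ y - x ∈ D) from hOsub (hsrc ▸ hy), he, hval]

theorem mem_orthogonal_vectorSpan {A : Set (E n)} {v : E n} :
    v ∈ (vectorSpan ℝ A)ᗮ ↔ ∀ a ∈ A, ∀ b ∈ A, ⟪a - b, v⟫ = 0 := by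
  rw [Submodule.mem_orthogonal]
  constructor
  · exact fun h a ha b hb => h _ (vsub_mem_vectorSpan ℝ ha hb)
  · intro h u hu
    rw [vectorSpan] at hu
    induction hu using Submodule.span_induction with
    | mem x hx =>
      obtain ⟨a, ha, b, hb, rfl⟩ := hx
      exact h a ha b hb
    | zero => simp
    | add x y _ _ hx hy => rw [inner_add_left, hx, hy, add_zero]
    | smul c x _ hx => rw [inner_smul_left, hx, mul_zero]

/-- A stratum is open in an affine subspace: near one of its points it is where the active tangents
agree. -/
theorem isSmoothSubmanifold_stratum {f : E n → ℝ} (hf : ConvexOn ℝ univ f) (hc : Continuous f)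
    (hgen : GenericallyAffine f) (hfin : (slopes f univ).Finite) {A : Set (E n)}
    (hA : A.Nonempty) :
    IsSmoothSubmanifold (Module.finrank ℝ ((vectorSpan ℝ A)ᗮ : Submodule ℝ (E n)))
      (stratum f A) := by
  refine isSmoothSubmanifold_of_subspace _ fun x hx => ?_
  have hx : active f x = A := hx
  obtain ⟨a, ha⟩ := hA
  have haA : a ∈ active f x := hx ▸ ha
  have hev : ∀ᶠ y in 𝓝 x, ∀ b ∈ slopes f univ, b ∉ A → tangent f b y < tangent f a y := by
    rw [Filter.eventually_all_finite hfin]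
    intro b hb
    by_cases hbA : b ∈ A
    · simp [hbA]
    have hlt : tangent f b x < tangent f a x := by
      rw [← haA.2]
      exact lt_of_le_of_ne (tangent_le hf hb x)
        fun h => hbA (hx ▸ (⟨hb, h.symm⟩ : b ∈ active f x))
    filter_upwards [(continuous_tangent f b).continuousAt.eventually_lt
      (continuous_tangent f a).continuousAt hlt] with y hy _ using hy
  filter_upwards [hev] with y hy
  rw [mem_orthogonal_vectorSpan]
  have hdiff : ∀ b ∈ A, ∀ c ∈ A, ⟪b - c, y - x⟫ = tangent f b y - tangent f c y := by
    intro b hb c hc'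
    have h1 : b ∈ active f x := hx ▸ hb
    have h2 : c ∈ active f x := hx ▸ hc'
    rw [tangent_eq_add f b x y, tangent_eq_add f c x y, ← h1.2, ← h2.2, inner_sub_left]
    ring
  constructor
  · intro hyA b hb c hc'
    have hyA : active f y = A := hyA
    have h1 : b ∈ active f y := hyA ▸ hb
    have h2 : c ∈ active f y := hyA ▸ hc'
    rw [hdiff b hb c hc', ← h1.2, ← h2.2, sub_self]
  · intro h
    have heq : ∀ b ∈ A, tangent f b y = tangent f a y := fun b hb =>
      sub_eq_zero.1 ((hdiff b hb a ha).symm.trans (h b hb a ha))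
    have hfy : f y = tangent f a y := by
      obtain ⟨b, hb, hby⟩ := exists_eq_tangent hf hc hgen isOpen_univ hfin (mem_univ y)
      by_cases hbA : b ∈ A
      · rw [hby, heq b hbA]
      · exact absurd hby (((hy b hb hbA).trans_le (tangent_le hf haA.1 y)).ne')
    refine Subset.antisymm (fun b hb => ?_) fun b hb => ?_
    · by_contra hbA
      exact absurd (hb.2.symm.trans hfy) (hy b hb.1 hbA).ne
    · have h1 : b ∈ active f x := hx ▸ hb
      exact ⟨h1.1, by rw [hfy, heq b hb]⟩

/-- No three slopes of a convex function whose tangents meet at a point are collinear. -/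
theorem not_collinear_active {f : E n → ℝ} (hf : ConvexOn ℝ univ f) {x a b c : E n}
    (ha : a ∈ active f x) (hb : b ∈ active f x) (hc : c ∈ active f x) (hab : a ≠ b) (hac : a ≠ c)
    (hbc : b ≠ c) : ¬ Collinear ℝ {a, b, c} := by
  have key : ∀ a ∈ active f x, ∀ b ∈ active f x, ∀ c ∈ active f x, a ≠ b → a ≠ c → b ≠ c →
      ¬ Wbtw ℝ a b c := by
    rintro a ha b hb c hc hab hac hbc ⟨t, ⟨ht0, ht1⟩, ht⟩
    have h0 : t ≠ 0 := by
      rintro rfl; exact hab (by simpa using ht)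
    have h1 : t ≠ 1 := by
      rintro rfl; exact hbc (by simpa using ht.symm)
    refine tangent_ne_combination hf ha.1 hc.1 hb.1 hac (lt_of_le_of_ne ht0 h0.symm)
      (lt_of_le_of_ne ht1 h1) fun y => ?_
    rw [tangent_eq_add f b x y, tangent_eq_add f a x y, tangent_eq_add f c x y, ← ha.2, ← hb.2,
      ← hc.2, ← ht, AffineMap.lineMap_apply_module, inner_add_left, inner_smul_left,
      inner_smul_left, conj_trivial, conj_trivial]
    ring
  intro h
  rcases h.wbtw_or_wbtw_or_wbtw with h | h | h
  · exact key a ha b hb c hc hab hac hbc h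
  · exact key b hb c hc a ha hbc hab.symm hac.symm h
  · exact key c hc a ha b hb hac.symm hbc.symm hab h

/-- The kinks of a convex function with finitely many slopes form a piecewise smooth hypersurface.
The facets are the strata with two active slopes, the lower dimensional pieces the strata with more
than two. -/
theorem isPiecewiseSmoothHypersurface_kinks {f : E n → ℝ} (hf : ConvexOn ℝ univ f)
    (hc : Continuous f) (hgen : GenericallyAffine f) (hfin : (slopes f univ).Finite) :
    IsPiecewiseSmoothHypersurface (kinks f) := by
  classical
  set 𝓕 : Finset (Finset (E n)) :=
    hfin.toFinset.powerset.filter fun A => A.card = 2 ∧ (stratum f A).Nonempty with h𝓕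
  set 𝓦 : Finset (Finset (E n)) :=
    hfin.toFinset.powerset.filter fun A => 3 ≤ A.card ∧ (stratum f A).Nonempty with h𝓦
  have hact : ∀ x, ∃ A ∈ hfin.toFinset.powerset, active f x = ↑A := by
    intro x
    refine ⟨(hfin.subset fun a (ha : a ∈ active f x) => ha.1).toFinset, ?_, by simp⟩
    rw [Finset.mem_powerset]
    intro a ha
    simp only [Finite.mem_toFinset] at ha ⊢
    exact ha.1
  have hrank : ∀ A : Set (E n), Module.finrank ℝ (vectorSpan ℝ A) +
      Module.finrank ℝ ((vectorSpan ℝ A)ᗮ : Submodule ℝ (E n)) = n := fun A => by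
    rw [Submodule.finrank_add_finrank_orthogonal, finrank_euclideanSpace_fin]
  have hne : ∀ A : Finset (E n), 2 ≤ A.card → (A : Set (E n)).Nonempty := fun A hA =>
    Finset.coe_nonempty.2 (Finset.card_pos.1 (by omega))
  have hFmem : ∀ i : Fin 𝓕.card, (𝓕.equivFin.symm i : Finset (E n)).card = 2 ∧
      (stratum f ((𝓕.equivFin.symm i : Finset (E n)) : Set (E n))).Nonempty := fun i =>
    (Finset.mem_filter.1 (𝓕.equivFin.symm i).2).2
  have hWmem : ∀ i : Fin 𝓦.card, 3 ≤ (𝓦.equivFin.symm i : Finset (E n)).card ∧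
      (stratum f ((𝓦.equivFin.symm i : Finset (E n)) : Set (E n))).Nonempty := fun i =>
    (Finset.mem_filter.1 (𝓦.equivFin.symm i).2).2
  have hMof : ∀ x, ∀ A : Finset (E n), active f x = ↑A → A.card = 2 →
      x ∈ ⋃ i : Fin 𝓕.card, stratum f ((𝓕.equivFin.symm i : Finset (E n)) : Set (E n)) := by
    intro x A hxA hA2
    obtain ⟨A', hA', hxA'⟩ := hact x
    have hAA' : A' = A := Finset.coe_injective (hxA'.symm.trans hxA)
    subst hAA'
    refine mem_iUnion.2 ⟨𝓕.equivFin ⟨A', Finset.mem_filter.2 ⟨hA', hA2, x, hxA⟩⟩, ?_⟩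
    simpa [stratum] using hxA
  refine ⟨𝓕.card, 𝓦.card, fun i => stratum f ((𝓕.equivFin.symm i : Finset (E n)) : Set (E n)),
    fun i => stratum f ((𝓦.equivFin.symm i : Finset (E n)) : Set (E n)), ?_, ?_, ?_, ?_, ?_⟩
  · intro i
    obtain ⟨h2, hs⟩ := hFmem i
    refine ⟨⟨hs, (convex_stratum hf (hne _ h2.ge)).isPreconnected⟩, _, ?_,
      isSmoothSubmanifold_stratum hf hc hgen hfin (hne _ h2.ge)⟩
    set A := (𝓕.equivFin.symm i : Finset (E n))
    obtain ⟨a, b, hab, hAab⟩ := Finset.card_eq_two.1 h2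
    have h1 : Module.finrank ℝ (vectorSpan ℝ (A : Set (E n))) = 1 := by
      have hle : Module.finrank ℝ (vectorSpan ℝ (A : Set (E n))) ≤ 1 := by
        rw [← collinear_iff_finrank_le_one, hAab, Finset.coe_pair]
        exact collinear_pair ℝ a b
      have hpos : 0 < Module.finrank ℝ (vectorSpan ℝ (A : Set (E n))) := by
        have hmem : a -ᵥ b ∈ vectorSpan ℝ (A : Set (E n)) :=
          vsub_mem_vectorSpan ℝ (by simp [hAab]) (by simp [hAab])
        have : Nontrivial (vectorSpan ℝ (A : Set (E n))) :=
          nontrivial_of_ne ⟨a -ᵥ b, hmem⟩ 0 fun h => hab (vsub_eq_zero_iff_eq.1 (by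
            simpa using congrArg Subtype.val h))
        exact Module.finrank_pos
      omega
    have := hrank (A : Set (E n))
    omega
  · intro j
    obtain ⟨h3, x, hx⟩ := hWmem j
    refine ⟨_, ?_, isSmoothSubmanifold_stratum hf hc hgen hfin (hne _ (by omega))⟩
    set A := (𝓦.equivFin.symm j : Finset (E n))
    obtain ⟨a, b, c, ha, hb, hc', hab, hac, hbc⟩ := Finset.two_lt_card_iff.1 h3
    have hx : active f x = ↑A := hx
    have h1 : ¬ Module.finrank ℝ (vectorSpan ℝ (A : Set (E n))) ≤ 1 := by
      rw [← collinear_iff_finrank_le_one]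
      intro hcol
      refine not_collinear_active hf (x := x) (hx ▸ ha) (hx ▸ hb) (hx ▸ hc') hab hac hbc
        (hcol.subset ?_)
      intro z hz
      simp only [mem_insert_iff, mem_singleton_iff] at hz
      rcases hz with rfl | rfl | rfl <;> assumption
    have := hrank (A : Set (E n))
    omega
  · rintro i i' hii' x ⟨hx, hx'⟩
    refine absurd (𝓕.equivFin.symm.injective (Subtype.ext (Finset.coe_injective ?_))) hii'
    exact Eq.trans (Eq.symm hx) hx'
  · rintro j x hx
    have hx : active f x = ((𝓦.equivFin.symm j : Finset (E n)) : Set (E n)) := hx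
    obtain ⟨h3, -⟩ := hWmem j
    obtain ⟨a, b, c, ha, hb, -, hab, -, -⟩ := Finset.two_lt_card_iff.1 h3
    rw [Metric.mem_closure_iff]
    intro ε hε
    have hsl : ∀ c ∈ active f x, c ∈ slopes f (Metric.ball x ε) := fun c hc' =>
      mem_slopes_of_active hf hc' (Metric.ball_mem_nhds x hε)
    -- there is a facet in every neighbourhood of a point of a lower dimensional stratum
    obtain ⟨a', ha', ha'K, b', hb', hb'K, y, hyball, hya, hyb, hlt, -⟩ :=
      exists_facet_point hf hc hgen Metric.isOpen_ball (convex_ball x ε)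
      (hfin.subset (slopes_mono f (subset_univ _)))
      (K := {a}) (hsl a (hx ▸ ha)) rfl (hsl b (hx ▸ hb)) (fun h => hab (Eq.symm h))
    refine ⟨y, hMof y {a', b'} ?_ ?_, by rw [dist_comm]; exact hyball⟩
    · rw [Finset.coe_pair]
      refine Subset.antisymm (fun c hcy => ?_) ?_
      · by_contra hcon
        simp only [mem_insert_iff, mem_singleton_iff, not_or] at hcon
        have hcs := mem_slopes_of_active hf hcy (Metric.isOpen_ball.mem_nhds hyball)
        exact (hlt c hcs hcon.1 hcon.2).ne hcy.2.symm
      · rintro c (rfl | rfl)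
        · exact ⟨slopes_mono f (subset_univ _) ha', hya⟩
        · exact ⟨slopes_mono f (subset_univ _) hb', hyb⟩
    · refine Finset.card_pair ?_
      rintro rfl
      exact hb'K ha'K
  · ext x
    rw [mem_kinks_iff hf hc hgen hfin]
    obtain ⟨A, hA, hxA⟩ := hact x
    rw [hxA]
    constructor
    · intro h
      have hcard : 1 < A.card := Finset.one_lt_card_iff_nontrivial.2 (by simpa using h)
      rcases (show 2 ≤ A.card from hcard).eq_or_lt with h2 | h3
      · exact Or.inl (hMof x A hxA h2.symm)
      · refine Or.inr (mem_iUnion.2 ⟨𝓦.equivFin ⟨A, Finset.mem_filter.2 ⟨hA, h3, x, hxA⟩⟩, ?_⟩)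
        simpa [stratum] using hxA
    · intro h
      have : ∃ A' : Finset (E n), 2 ≤ A'.card ∧ active f x = ↑A' := by
        rcases h with h | h
        · obtain ⟨i, hi⟩ := mem_iUnion.1 h
          exact ⟨_, (hFmem i).1.ge, hi⟩
        · obtain ⟨i, hi⟩ := mem_iUnion.1 h
          exact ⟨_, (by have := (hWmem i).1; omega), hi⟩
      obtain ⟨A', hA'2, hxA'⟩ := this
      have hAA' : A' = A := Finset.coe_injective (hxA'.symm.trans hxA)
      subst hAA'
      simpa using Finset.one_lt_card_iff_nontrivial.1 (show 1 < A'.card by omega)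

/-! ### Distributions and smearing -/

theorem lineDerivOp_test_apply (φ : Test n) (v x : E n) : (∂_{v} φ) x = fderiv ℝ φ x v := by
  change TestFunction.lineDerivCLM ℝ v φ x = _
  rw [TestFunction.lineDerivCLM_eq_fderivCLM, TestFunction.fderivCLM_apply_of_le _ (by simp)]

theorem differentiable_test (φ : Test n) : Differentiable ℝ φ :=
  φ.contDiff.differentiable (by simp)

theorem lineDerivOp_test_comm (φ : Test n) (v w : E n) : ∂_{v} (∂_{w} φ) = ∂_{w} (∂_{v} φ) := by
  ext x
  have key : ∀ v w : E n, (∂_{v} (∂_{w} φ)) x = fderiv ℝ (fderiv ℝ φ) x v w := by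
    intro v w
    rw [lineDerivOp_test_apply]
    have h1 : (⇑(∂_{w} φ : Test n) : E n → ℝ) = fun y => fderiv ℝ φ y w :=
      funext fun y => lineDerivOp_test_apply φ w y
    have h2 : DifferentiableAt ℝ (fderiv ℝ φ) x :=
      (φ.contDiff.fderiv_right (m := 1) (WithTop.coe_le_coe.2 le_top)).differentiable
        one_ne_zero x
    rw [h1, fderiv_clm_apply h2 (differentiableAt_const w)]
    simp
  rw [key, key]
  exact (φ.contDiff.contDiffAt.isSymmSndFDerivAt
    (by simpa using WithTop.coe_le_coe.2 (le_top : (2 : ℕ∞) ≤ ⊤))).eq v w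

/-- The test function `t ↦ ρ (x - t)`. -/
noncomputable def reflect (ρ : Test n) (x : E n) : Test n where
  toFun t := ρ (x - t)
  contDiff' := ρ.contDiff.comp (contDiff_const.sub contDiff_id)
  hasCompactSupport' := ρ.hasCompactSupport.comp_homeomorph (Homeomorph.subLeft x)
  tsupport_subset' := fun _ _ => Set.mem_univ _

@[simp] theorem reflect_apply (ρ : Test n) (x t : E n) : reflect ρ x t = ρ (x - t) := rfl

theorem lineDerivOp_reflect (ρ : Test n) (x v : E n) :
    ∂_{v} (reflect ρ x) = - reflect (∂_{v} ρ) x := by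
  ext t
  change _ = -((∂_{v} ρ) (x - t))
  rw [lineDerivOp_test_apply, lineDerivOp_test_apply]
  have h : HasFDerivAt (reflect ρ x) ((fderiv ℝ ρ (x - t)).comp (-ContinuousLinearMap.id ℝ (E n)))
      t := by
    have h1 : HasFDerivAt (fun t => x - t) (-ContinuousLinearMap.id ℝ (E n)) t :=
      (hasFDerivAt_id t).const_sub x
    exact (differentiable_test ρ (x - t)).hasFDerivAt.comp t h1
  rw [h.fderiv]
  simp

theorem lineDerivOp_distr_reflect (U : Distr n) (ρ : Test n) (x v : E n) :
    (∂_{v} U) (reflect ρ x) = U (reflect (∂_{v} ρ) x) := by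
  rw [Distribution.lineDerivOp_apply_apply, lineDerivOp_reflect, neg_neg]

/-- The convolutions of `U` with test functions can be differentiated under the pairing. (This holds
for every distribution; below it is proved for locally finite measures.) -/
def SmearsSmoothly (U : Distr n) : Prop :=
  ∀ ρ : Test n, Differentiable ℝ (fun x => U (reflect ρ x)) ∧
    ∀ x v, fderiv ℝ (fun x => U (reflect ρ x)) x v = U (reflect (∂_{v} ρ) x)

theorem SmearsSmoothly.hasLineDerivAt {U : Distr n} (hU : SmearsSmoothly U) (ρ : Test n)
    (x v : E n) :
    HasLineDerivAt ℝ (fun x => U (reflect ρ x)) (U (reflect (∂_{v} ρ) x)) x v := by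
  rw [← (hU ρ).2 x v]
  exact ((hU ρ).1 x).hasFDerivAt.hasLineDerivAt v

theorem SmearsSmoothly.lineDerivOp {U : Distr n} (hU : SmearsSmoothly U) (w : E n) :
    SmearsSmoothly (∂_{w} U) := by
  intro ρ
  simp only [lineDerivOp_distr_reflect]
  refine ⟨(hU _).1, fun x v => ?_⟩
  rw [(hU _).2, lineDerivOp_test_comm]

theorem hasFDerivAt_integral_reflect {μ : Measure (E n)} {f : E n → ℝ}
    (hf : LocallyIntegrable f μ) (ρ : Test n) (x₀ : E n) :
    HasFDerivAt (fun x => ∫ t, ρ (x - t) * f t ∂μ) (∫ t, f t • fderiv ℝ ρ (x₀ - t) ∂μ) x₀ := by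
  obtain ⟨R, hR⟩ := ρ.hasCompactSupport.isCompact.isBounded.subset_closedBall (0 : E n)
  obtain ⟨C, hC⟩ := (ρ.hasCompactSupport.fderiv (𝕜 := ℝ)).exists_bound_of_continuous
    (ρ.contDiff.continuous_fderiv (by simp))
  set K : Set (E n) := Metric.closedBall x₀ (1 + R) with hK
  have hKc : IsCompact K := isCompact_closedBall _ _
  have hz : ∀ x ∈ Metric.ball x₀ 1, ∀ t, t ∉ K → x - t ∉ tsupport ρ := by
    intro x hx t ht h
    refine ht ?_
    have h1 := hR h
    rw [mem_closedBall_zero_iff] at h1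
    rw [hK, Metric.mem_closedBall, dist_comm, dist_eq_norm]
    have h2 : ‖x₀ - x‖ < 1 := by rw [← dist_eq_norm, dist_comm]; exact hx
    calc ‖x₀ - t‖ = ‖(x₀ - x) + (x - t)‖ := by congr 1; abel
      _ ≤ ‖x₀ - x‖ + ‖x - t‖ := norm_add_le _ _
      _ ≤ 1 + R := by linarith
  have hmeas : ∀ x, AEStronglyMeasurable (fun t => ρ (x - t) * f t) μ := fun x =>
    ((ρ.continuous.comp (continuous_const.sub continuous_id)).aestronglyMeasurable).mul
      hf.aestronglyMeasurable
  refine hasFDerivAt_integral_of_dominated_of_fderiv_le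
    (F := fun x t => ρ (x - t) * f t) (F' := fun x t => f t • fderiv ℝ ρ (x - t))
    (bound := K.indicator fun t => ‖f t‖ * C) (Metric.ball_mem_nhds x₀ one_pos)
    (Filter.Eventually.of_forall hmeas) ?_ ?_ ?_ ?_ ?_
  · obtain ⟨D, hD⟩ := ρ.hasCompactSupport.exists_bound_of_continuous ρ.continuous
    have hint : Integrable (K.indicator fun t => D * ‖f t‖) μ :=
      IntegrableOn.integrable_indicator (((hf.integrableOn_isCompact hKc).norm).const_mul D)
        hKc.measurableSet
    refine hint.mono' (hmeas x₀) (Filter.Eventually.of_forall fun t => ?_)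
    by_cases ht : t ∈ K
    · rw [indicator_of_mem ht, norm_mul]
      exact mul_le_mul_of_nonneg_right (hD _) (norm_nonneg _)
    · rw [indicator_of_notMem ht,
        image_eq_zero_of_notMem_tsupport (hz x₀ (Metric.mem_ball_self one_pos) t ht)]
      simp
  · exact hf.aestronglyMeasurable.smul (((ρ.contDiff.continuous_fderiv (by simp)).comp
      (continuous_const.sub continuous_id)).aestronglyMeasurable)
  · refine Filter.Eventually.of_forall fun t x hx => ?_
    by_cases ht : t ∈ K
    · rw [indicator_of_mem ht, norm_smul]
      exact mul_le_mul_of_nonneg_left (hC _) (norm_nonneg _)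
    · have : fderiv ℝ ρ (x - t) = 0 := image_eq_zero_of_notMem_tsupport
        fun h => hz x hx t ht (tsupport_fderiv_subset ℝ h)
      rw [indicator_of_notMem ht, this]
      simp
  · exact IntegrableOn.integrable_indicator (((hf.integrableOn_isCompact hKc).norm).mul_const C)
      hKc.measurableSet
  · refine Filter.Eventually.of_forall fun t x _ => ?_
    have h1 : HasFDerivAt (fun x => ρ (x - t)) (fderiv ℝ ρ (x - t)) x := by
      simpa using! (differentiable_test ρ (x - t)).hasFDerivAt.comp x
        ((hasFDerivAt_id x).sub_const t)
    exact h1.mul_const (f t)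

theorem integrable_test_mul {μ : Measure (E n)} {f : E n → ℝ} (hf : LocallyIntegrable f μ)
    (φ : Test n) : Integrable (fun t => φ t * f t) μ := by
  simpa [smul_eq_mul] using hf.integrable_smul_left_of_hasCompactSupport φ.continuous
    φ.hasCompactSupport

/-- Functions and measures smear smoothly. -/
theorem SmearsSmoothly.of_integral {U : Distr n} {μ : Measure (E n)} {f : E n → ℝ}
    (hf : LocallyIntegrable f μ) (hU : ∀ φ, U φ = ∫ t, φ t * f t ∂μ) : SmearsSmoothly U := by
  intro ρ
  simp only [hU, reflect_apply]
  refine ⟨fun x => (hasFDerivAt_integral_reflect hf ρ x).differentiableAt, fun x v => ?_⟩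
  rw [(hasFDerivAt_integral_reflect hf ρ x).fderiv, ContinuousLinearMap.integral_apply]
  · refine integral_congr_ae (Filter.Eventually.of_forall fun t => ?_)
    simp only [lineDerivOp_test_apply, smul_apply, smul_eq_mul]
    ring
  · have h : Continuous fun t => fderiv ℝ ρ (x - t) :=
      (ρ.contDiff.continuous_fderiv (by simp)).comp (continuous_const.sub continuous_id)
    exact hf.integrable_smul_right_of_hasCompactSupport h
      ((ρ.hasCompactSupport.fderiv (𝕜 := ℝ)).comp_homeomorph (Homeomorph.subLeft x))

theorem SmearsSmoothly.sub {U V : Distr n} (hU : SmearsSmoothly U) (hV : SmearsSmoothly V) :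
    SmearsSmoothly (U - V) := by
  intro ρ
  refine ⟨(hU ρ).1.sub (hV ρ).1, fun x v => ?_⟩
  have := ((hU ρ).1 x).hasFDerivAt.sub ((hV ρ).1 x).hasFDerivAt
  rw [show (fun x => (U - V) (reflect ρ x)) =
    (fun x => U (reflect ρ x)) - fun x => V (reflect ρ x) from rfl, this.fderiv,
    sub_apply, (hU ρ).2, (hV ρ).2]
  rfl

theorem SmearsSmoothly.smul {U : Distr n} (hU : SmearsSmoothly U) (c : ℝ) :
    SmearsSmoothly (c • U) := by
  intro ρ
  refine ⟨(hU ρ).1.const_smul c, fun x v => ?_⟩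
  have := ((hU ρ).1 x).hasFDerivAt.const_smul c
  rw [show (fun x => (c • U) (reflect ρ x)) = c • fun x => U (reflect ρ x) from rfl, this.fderiv,
    smul_apply, (hU ρ).2]
  rfl

theorem ofFun_apply {f : E n → ℝ} (hf : Continuous f) (φ : Test n) :
    ofFun f φ = ∫ x, φ x * f x := by
  exact TestFunction.integralAgainstBilinCLM_eq_integral (B := ContinuousLinearMap.mul ℝ ℝ)
    (hf.locallyIntegrable.locallyIntegrableOn _)

theorem smearsSmoothly_ofFun {f : E n → ℝ} (hf : Continuous f) : SmearsSmoothly (ofFun f) :=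
  SmearsSmoothly.of_integral hf.locallyIntegrable (ofFun_apply hf)

theorem ddSharp_apply (f : E n → ℝ) (i j : Fin n) (φ : Test n) :
    ddSharp f i j φ = ofFun f (∂_{stdVec j} (∂_{stdVec i} φ)) := by
  change (∂_{stdVec i} (∂_{stdVec j} (ofFun f))) φ = _
  rw [Distribution.lineDerivOp_apply_apply, Distribution.lineDerivOp_apply_apply]
  congr 1
  change -(TestFunction.lineDerivCLM ℝ (stdVec j) (-(TestFunction.lineDerivCLM ℝ (stdVec i) φ))) = _
  rw [map_neg, neg_neg]
  rfl

theorem ddSharp_symm (f : E n → ℝ) (i j : Fin n) : ddSharp f i j = ddSharp f j i := by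
  ext φ
  rw [ddSharp_apply, ddSharp_apply, lineDerivOp_test_comm]

theorem isDClosed_ddSharp (f : E n → ℝ) : IsDClosed (ddSharp f) := by
  intro k i j _
  have hcomm : ∀ U : Distr n, ∀ v w : E n, ∂_{v} (∂_{w} U) = ∂_{w} (∂_{v} U) := by
    intro U v w
    ext φ
    simp only [Distribution.lineDerivOp_apply_apply]
    congr 1
    change -(TestFunction.lineDerivCLM ℝ w (-(TestFunction.lineDerivCLM ℝ v φ))) =
      -(TestFunction.lineDerivCLM ℝ v (-(TestFunction.lineDerivCLM ℝ w φ)))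
    rw [map_neg, map_neg, neg_neg, neg_neg]
    exact lineDerivOp_test_comm φ w v
  exact sub_eq_zero.2 (hcomm _ _ _)

theorem ofFun_sub {f g : E n → ℝ} (hf : Continuous f) (hg : Continuous g) :
    ofFun (fun x => f x - g x) = ofFun f - ofFun g := by
  ext φ
  change ofFun (fun x => f x - g x) φ = ofFun f φ - ofFun g φ
  rw [ofFun_apply (show Continuous fun x => f x - g x from hf.sub hg), ofFun_apply hf,
    ofFun_apply hg, ← integral_sub (integrable_test_mul hf.locallyIntegrable φ)
      (integrable_test_mul hg.locallyIntegrable φ)]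
  simp only [mul_sub]

/-- Integration by parts against a test function. -/
theorem ofFun_lineDerivOp {g g' : E n → ℝ} (hg : Continuous g) (hg' : Continuous g') (v : E n)
    (h : ∀ x, HasLineDerivAt ℝ g (g' x) x v) (φ : Test n) :
    ofFun g (∂_{v} φ) = -ofFun g' φ := by
  rw [ofFun_apply hg, ofFun_apply hg']
  have h1 := integrable_test_mul (μ := volume) hg.locallyIntegrable (∂_{v} φ)
  have h2 := integrable_test_mul (μ := volume) hg'.locallyIntegrable φ
  have h3 := integrable_test_mul (μ := volume) hg.locallyIntegrable φ
  have := integral_bilinear_hasLineDerivAt_right_eq_neg_left_of_integrable (μ := volume)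
    (B := ContinuousLinearMap.mul ℝ ℝ) (v := v) (f := φ)
    (f' := fun x => (∂_{v} φ : Test n) x) (g := g) (g' := g')
    h1 h2 h3 (fun x _ => by
      rw [lineDerivOp_test_apply]
      exact (differentiable_test φ x).hasFDerivAt.hasLineDerivAt v) fun x _ => h x
  simp only [ContinuousLinearMap.mul_apply'] at this
  linarith

/-- The coefficients of `dd^# g` for a twice continuously differentiable function `g` are the second
partial derivatives. -/
theorem ddSharp_eq_ofFun {g : E n → ℝ} {w : Fin n → E n → ℝ} {H : Fin n → Fin n → E n → ℝ}
    (hg : Continuous g) (hw : ∀ j, Continuous (w j)) (hH : ∀ i j, Continuous (H i j))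
    (hgw : ∀ j x, HasLineDerivAt ℝ g (w j x) x (stdVec j))
    (hwH : ∀ i j x, HasLineDerivAt ℝ (w j) (H i j x) x (stdVec i)) (i j : Fin n) :
    ddSharp g i j = ofFun (H i j) := by
  ext φ
  rw [ddSharp_apply, ofFun_lineDerivOp hg (hw j) _ (hgw j),
    ofFun_lineDerivOp (hw j) (hH i j) _ (hwH i j), neg_neg]

/-! ### Mollification of functions -/

/-- A nonnegative test function of integral one supported in the ball of radius `1 / (k + 1)`. -/
noncomputable def mollifier (n k : ℕ) : Test n :=
  let b : ContDiffBump (0 : E n) :=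
    ⟨1 / ((k : ℝ) + 2), 1 / ((k : ℝ) + 1), by positivity,
      one_div_lt_one_div_of_lt (by positivity) (by linarith)⟩
  { toFun := b.normed volume
    contDiff' := b.contDiff_normed
    hasCompactSupport' := b.hasCompactSupport_normed
    tsupport_subset' := fun _ _ => Set.mem_univ _ }

theorem mollifier_nonneg (k : ℕ) (x : E n) : 0 ≤ mollifier n k x := ContDiffBump.nonneg_normed _ x

theorem integral_mollifier (k : ℕ) : ∫ x, mollifier n k x = 1 := ContDiffBump.integral_normed _

theorem tsupport_mollifier (k : ℕ) :
    tsupport (mollifier n k) = Metric.closedBall 0 (1 / ((k : ℝ) + 1)) :=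
  ContDiffBump.tsupport_normed_eq _

theorem mollifier_eq_zero {k : ℕ} {x : E n} (hx : 1 / ((k : ℝ) + 1) < ‖x‖) :
    mollifier n k x = 0 := by
  refine image_eq_zero_of_notMem_tsupport fun h => ?_
  rw [tsupport_mollifier, mem_closedBall_zero_iff] at h
  linarith

/-- An average with respect to a mollifier is close to the values of the function. -/
theorem abs_integral_mollifier_sub_le {g : E n → ℝ} (hg : Continuous g) {k : ℕ} {c ε : ℝ}
    (h : ∀ s, ‖s‖ ≤ 1 / ((k : ℝ) + 1) → |g s - c| ≤ ε) :
    |(∫ s, mollifier n k s * g s) - c| ≤ ε := by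
  have hi := integrable_test_mul (μ := volume) hg.locallyIntegrable (mollifier n k)
  have hi1 := integrable_test_mul (μ := volume)
    (continuous_const (y := (1 : ℝ))).locallyIntegrable (mollifier n k)
  simp only [mul_one] at hi1
  have e : (∫ s, mollifier n k s * g s) - c = ∫ s, mollifier n k s * (g s - c) := by
    simp only [mul_sub]
    rw [integral_sub hi (hi1.mul_const c), integral_mul_const, integral_mollifier, one_mul]
  rw [e]
  have hb : ∀ s, ‖mollifier n k s * (g s - c)‖ ≤ mollifier n k s * ε := by
    intro s
    rw [norm_mul, Real.norm_of_nonneg (mollifier_nonneg k s), Real.norm_eq_abs]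
    by_cases hs : ‖s‖ ≤ 1 / ((k : ℝ) + 1)
    · exact mul_le_mul_of_nonneg_left (h s hs) (mollifier_nonneg k s)
    · rw [mollifier_eq_zero (not_le.1 hs), zero_mul, zero_mul]
  have := norm_integral_le_of_norm_le (hi1.mul_const ε) (Filter.Eventually.of_forall hb)
  rwa [integral_mul_const, integral_mollifier, one_mul, Real.norm_eq_abs] at this

/-- The convolution of `f` with a mollifier. -/
noncomputable def mollify (f : E n → ℝ) (k : ℕ) (x : E n) : ℝ :=
  ofFun f (reflect (mollifier n k) x)

theorem mollify_eq {f : E n → ℝ} (hf : Continuous f) (k : ℕ) (x : E n) :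
    mollify f k x = ∫ s, mollifier n k s * f (x - s) := by
  rw [mollify, ofFun_apply hf, ← integral_sub_left_eq_self _ volume x]
  simp

theorem SmearsSmoothly.continuous {U : Distr n} (hU : SmearsSmoothly U) (ρ : Test n) :
    Continuous fun x => U (reflect ρ x) := (hU ρ).1.continuous

theorem continuous_mollify {f : E n → ℝ} (hf : Continuous f) (k : ℕ) : Continuous (mollify f k) :=
  (smearsSmoothly_ofFun hf).continuous _

theorem tendsto_one_div_nat : Filter.Tendsto (fun k : ℕ => 1 / ((k : ℝ) + 1)) Filter.atTop (𝓝 0) :=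
  tendsto_one_div_add_atTop_nhds_zero_nat

theorem tendstoUniformlyOn_mollify {f : E n → ℝ} (hf : Continuous f) {K : Set (E n)}
    (hK : IsCompact K) : TendstoUniformlyOn (mollify f) f Filter.atTop K := by
  rw [Metric.tendstoUniformlyOn_iff]
  intro ε hε
  have hK' : IsCompact (Metric.cthickening 1 K) := hK.cthickening
  obtain ⟨δ, hδ, hδf⟩ := Metric.uniformContinuousOn_iff.1
    (hK'.uniformContinuousOn_of_continuous hf.continuousOn) (ε / 2) (by positivity)
  filter_upwards [tendsto_one_div_nat.eventually (gt_mem_nhds hδ)] with k hk x hx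
  rw [dist_comm, Real.dist_eq, mollify_eq hf]
  refine lt_of_le_of_lt (abs_integral_mollifier_sub_le (g := fun s => f (x - s)) (by fun_prop)
    (ε := ε / 2) fun s hs => ?_) (by linarith)
  have h1 : dist (x - s) x = ‖s‖ := by rw [dist_eq_norm]; simp
  have hk1 : 1 / ((k : ℝ) + 1) ≤ 1 := by
    rw [div_le_one (by positivity)]; linarith [(Nat.cast_nonneg k : (0 : ℝ) ≤ k)]
  have := hδf (x - s) (Metric.mem_cthickening_of_dist_le _ x _ _ hx (by rw [h1]; linarith)) x
    (Metric.self_subset_cthickening _ hx) (by rw [h1]; linarith)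
  rw [Real.dist_eq] at this
  exact this.le

theorem tendsto_ofFun {ι : Type*} {l : Filter ι} {F : ι → E n → ℝ} {f : E n → ℝ}
    (hF : ∀ i, Continuous (F i)) (hf : Continuous f)
    (h : ∀ K, IsCompact K → TendstoUniformlyOn F f l K) (φ : Test n) :
    Filter.Tendsto (fun i => ofFun (F i) φ) l (𝓝 (ofFun f φ)) := by
  rw [Metric.tendsto_nhds]
  intro ε hε
  have hφi : Integrable (fun x => |φ x|) := by
    have := integrable_test_mul (μ := volume) (continuous_const (y := (1 : ℝ))).locallyIntegrable φ
    simpa using this.norm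
  set C := ∫ x, |φ x| with hC
  have hC0 : 0 ≤ C := integral_nonneg fun x => abs_nonneg _
  filter_upwards [Metric.tendstoUniformlyOn_iff.1 (h _ φ.hasCompactSupport) (ε / (C + 1))
    (by positivity)] with i hi
  rw [Real.dist_eq, ofFun_apply (hF i), ofFun_apply hf,
    ← integral_sub (integrable_test_mul (hF i).locallyIntegrable φ)
      (integrable_test_mul hf.locallyIntegrable φ)]
  have hb : ∀ x, ‖φ x * F i x - φ x * f x‖ ≤ |φ x| * (ε / (C + 1)) := by
    intro x
    rw [← mul_sub, norm_mul, Real.norm_eq_abs, Real.norm_eq_abs]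
    by_cases hx : x ∈ tsupport φ
    · have := hi x hx
      rw [dist_comm, Real.dist_eq] at this
      exact mul_le_mul_of_nonneg_left this.le (abs_nonneg _)
    · rw [image_eq_zero_of_notMem_tsupport hx]; simp
  have := norm_integral_le_of_norm_le (hφi.mul_const (ε / (C + 1))) (Filter.Eventually.of_forall hb)
  rw [integral_mul_const, Real.norm_eq_abs] at this
  refine this.trans_lt ?_
  rw [mul_div_assoc', div_lt_iff₀ (by positivity)]
  nlinarith

theorem convexOn_mollify {f : E n → ℝ} (hf : ConvexOn ℝ univ f) (hc : Continuous f) (k : ℕ) :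
    ConvexOn ℝ univ (mollify f k) := by
  refine ⟨convex_univ, fun x _ y _ a b ha hb hab => ?_⟩
  have hi : ∀ x, Integrable fun s => mollifier n k s * f (x - s) := fun x =>
    integrable_test_mul (hc.comp (continuous_const.sub continuous_id)).locallyIntegrable _
  rw [mollify_eq hc, mollify_eq hc, mollify_eq hc, smul_eq_mul, smul_eq_mul,
    ← integral_const_mul, ← integral_const_mul,
    ← integral_add ((hi x).const_mul a) ((hi y).const_mul b)]
  refine integral_mono (hi _) (((hi x).const_mul a).add ((hi y).const_mul b)) fun s => ?_
  have e : a • x + b • y - s = a • (x - s) + b • (y - s) := by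
    rw [smul_sub, smul_sub, sub_add_sub_comm, ← add_smul, hab, one_smul]
  have := hf.2 (mem_univ (x - s)) (mem_univ (y - s)) ha hb hab
  rw [smul_eq_mul, smul_eq_mul] at this
  simp only
  rw [e]
  have := mul_le_mul_of_nonneg_left this (mollifier_nonneg k s)
  linarith

/-- The first two derivatives of a mollified function. -/
theorem ddSharp_mollify {f : E n → ℝ} (hf : Continuous f) (k : ℕ) (i j : Fin n) :
    ddSharp (mollify f k) i j = ofFun fun x => ddSharp f i j (reflect (mollifier n k) x) := by
  have hU := smearsSmoothly_ofFun hf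
  have e : ∀ i j x, ddSharp f i j (reflect (mollifier n k) x) =
      ofFun f (reflect (∂_{stdVec i} (∂_{stdVec j} (mollifier n k))) x) := by
    intro i j x
    change (∂_{stdVec i} (∂_{stdVec j} (ofFun f))) _ = _
    rw [lineDerivOp_distr_reflect, lineDerivOp_distr_reflect, lineDerivOp_test_comm]
  simp only [e]
  exact ddSharp_eq_ofFun (w := fun j x => ofFun f (reflect (∂_{stdVec j} (mollifier n k)) x))
    (H := fun i j x => ofFun f (reflect (∂_{stdVec i} (∂_{stdVec j} (mollifier n k))) x))
    (continuous_mollify hf k) (fun j => hU.continuous _) (fun i j => hU.continuous _)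
    (fun j x => hU.hasLineDerivAt _ x _) (fun i j x => hU.hasLineDerivAt _ x _) i j

/-! ### Positivity of `dd^# f` for convex `f` -/

theorem nonneg_of_convexOn_of_hasDerivAt {h h' : ℝ → ℝ} (hh : ConvexOn ℝ univ h)
    (h1 : ∀ t, HasDerivAt h (h' t) t) {c t : ℝ} (h2 : HasDerivAt h' c t) : 0 ≤ c := by
  have hmono : Monotone h' := by
    have := hh.monotoneOn_deriv fun t _ => (h1 t).differentiableAt
    rw [show deriv h = h' from funext fun t => (h1 t).deriv] at this
    exact monotoneOn_univ.1 this
  rw [← h2.deriv]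
  exact hmono.deriv_nonneg

theorem eq_sum_smul_stdVec (v : E n) : v = ∑ i, v i • (stdVec i : E n) := by
  ext j
  simp [Finset.sum_apply, Pi.single_apply]

/-- A distribution which smears smoothly has, along any vector, the derivative given by its partial
derivatives. -/
theorem SmearsSmoothly.fderiv_eq_sum {U : Distr n} (hU : SmearsSmoothly U) (ρ : Test n)
    (x v : E n) : fderiv ℝ (fun x => U (reflect ρ x)) x v =
      ∑ i, v i * U (reflect (∂_{stdVec i} ρ) x) := by
  nth_rewrite 1 [eq_sum_smul_stdVec v]
  rw [map_sum]
  refine Finset.sum_congr rfl fun i _ => ?_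
  rw [map_smul, smul_eq_mul, (hU ρ).2]

theorem hessian_mollify_nonneg {f : E n → ℝ} (hf : ConvexOn ℝ univ f) (hc : Continuous f) (k : ℕ)
    (x v : E n) :
    0 ≤ ∑ i, ∑ j, v i * v j * ddSharp f i j (reflect (mollifier n k) x) := by
  have hU := smearsSmoothly_ofFun hc
  set ρ := mollifier n k with hρ
  have hline : ∀ t : ℝ, HasDerivAt (fun t : ℝ => x + t • v) v t := by
    intro t
    simpa using ((hasDerivAt_id t).smul_const v).const_add x
  refine nonneg_of_convexOn_of_hasDerivAt (h := fun t => mollify f k (x + t • v))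
    (h' := fun t => ∑ j, v j * ofFun f (reflect (∂_{stdVec j} ρ) (x + t • v))) (t := 0) ?_ ?_ ?_
  · have := (convexOn_mollify hf hc k).comp_affineMap (AffineMap.lineMap x (x + v))
    simpa [Function.comp_def, AffineMap.lineMap_apply_module', add_comm] using this
  · intro t
    rw [← hU.fderiv_eq_sum]
    exact ((hU ρ).1 _).hasFDerivAt.comp_hasDerivAt t (hline t)
  · have key : ∀ j, HasDerivAt (fun t : ℝ => v j * ofFun f (reflect (∂_{stdVec j} ρ) (x + t • v)))
        (v j * ∑ i, v i * ddSharp f i j (reflect ρ x)) 0 := by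
      intro j
      refine HasDerivAt.const_mul (v j) ?_
      have h1 := ((hU (∂_{stdVec j} ρ)).1 (x + (0 : ℝ) • v)).hasFDerivAt.comp_hasDerivAt 0 (hline 0)
      have e : ∑ i, v i * ddSharp f i j (reflect ρ x) =
          fderiv ℝ (fun x => ofFun f (reflect (∂_{stdVec j} ρ) x)) (x + (0 : ℝ) • v) v := by
        rw [hU.fderiv_eq_sum, zero_smul, add_zero]
        refine Finset.sum_congr rfl fun i _ => ?_
        congr 1
        change (∂_{stdVec i} (∂_{stdVec j} (ofFun f))) _ = _
        rw [lineDerivOp_distr_reflect, lineDerivOp_distr_reflect, lineDerivOp_test_comm]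
      rw [e]
      exact h1
    have hs := HasDerivAt.fun_sum (u := Finset.univ) fun j _ => key j
    refine hs.congr_deriv ?_
    rw [Finset.sum_comm]
    refine Finset.sum_congr rfl fun j _ => ?_
    rw [Finset.mul_sum]
    refine Finset.sum_congr rfl fun i _ => ?_
    ring

/-- The `dd^#` of a convex function is positive, as a weak limit of the `dd^#` of mollifications,
which have positive semidefinite Hessians. -/
theorem isPositive_ddSharp {f : E n → ℝ} (hf : ConvexOn ℝ univ f) (hc : Continuous f) :
    IsPositive (ddSharp f) := by
  refine ⟨ddSharp_symm f, fun b => ?_⟩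
  have hlim : Filter.Tendsto (fun k => pairing (ddSharp (mollify f k)) (squareForm b))
      Filter.atTop (𝓝 (pairing (ddSharp f) (squareForm b))) := by
    refine tendsto_finsetSum _ fun i _ => tendsto_finsetSum _ fun j _ => ?_
    refine Filter.Tendsto.const_mul _ ?_
    simp only [ddSharp_apply]
    exact tendsto_ofFun (continuous_mollify hc) hc (fun K hK => tendstoUniformlyOn_mollify hc hK) _
  refine ge_of_tendsto' hlim fun k => ?_
  have hcont : ∀ i j, Continuous fun x => ddSharp f i j (reflect (mollifier n k) x) := fun i j =>
    (((smearsSmoothly_ofFun hc).lineDerivOp _).lineDerivOp _).continuous _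
  have e : pairing (ddSharp (mollify f k)) (squareForm b) = ∫ x, ∑ i : Fin n, ∑ j : Fin n,
      (-1 : ℝ) ^ ((i : ℕ) + (j : ℕ)) *
        (mulTest (b i) (b j) x * ddSharp f i j (reflect (mollifier n k) x)) := by
    have hi : ∀ i j : Fin n, Integrable fun x => (-1 : ℝ) ^ ((i : ℕ) + (j : ℕ)) *
        (mulTest (b i) (b j) x * ddSharp f i j (reflect (mollifier n k) x)) := fun i j =>
      (integrable_test_mul (hcont i j).locallyIntegrable _).const_mul _
    rw [integral_finsetSum _ fun i _ => integrable_finsetSum _ fun j _ => hi i j]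
    refine Finset.sum_congr rfl fun i _ => ?_
    rw [integral_finsetSum _ fun j _ => hi i j]
    refine Finset.sum_congr rfl fun j _ => ?_
    rw [integral_const_mul, ddSharp_mollify hc, ofFun_apply (hcont i j)]
    rfl
  rw [e]
  refine integral_nonneg fun x => ?_
  have := hessian_mollify_nonneg hf hc k x (WithLp.toLp 2 fun i => (-1 : ℝ) ^ (i : ℕ) * b i x)
  refine this.trans_eq (Finset.sum_congr rfl fun i _ => Finset.sum_congr rfl fun j _ => ?_)
  change _ = (-1 : ℝ) ^ ((i : ℕ) + (j : ℕ)) * (b i x * b j x * _)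
  rw [pow_add]
  ring

/-! ### Functions with vanishing `dd^#` are affine -/

/-- Weyl's lemma for `dd^#`: a continuous function whose `dd^#` vanishes on a ball is affine on the
concentric ball of half the radius, since the mollified functions have vanishing second derivatives
there. -/
theorem exists_affine_of_ddSharp_eq_zero {h : E n → ℝ} (hh : Continuous h) {x₀ : E n} {r : ℝ}
    (hr : 0 < r) (hz : ∀ i j (φ : Test n), tsupport φ ⊆ Metric.ball x₀ r → ddSharp h i j φ = 0) :
    ∃ a : E n, ∀ y ∈ Metric.ball x₀ (r / 2), h y = h x₀ + ⟪a, y - x₀⟫ := by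
  have hU := smearsSmoothly_ofFun hh
  set B := Metric.ball x₀ (r / 2) with hB
  have hx₀ : x₀ ∈ B := Metric.mem_ball_self (by positivity)
  have hopen : IsOpen B := Metric.isOpen_ball
  have hpre : IsPreconnected B := (convex_ball x₀ (r / 2)).isPreconnected
  -- the mollified functions are affine on the smaller ball
  have hk : ∀ᶠ k : ℕ in Filter.atTop, ∃ a : E n, ∀ y ∈ B,
      mollify h k y = mollify h k x₀ + ⟪a, y - x₀⟫ := by
    filter_upwards [tendsto_one_div_nat.eventually (gt_mem_nhds (half_pos hr))] with k hk
    set ρ := mollifier n k with hρ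
    have hd2 : ∀ j : Fin n, ∀ x ∈ B,
        fderiv ℝ (fun x => ofFun h (reflect (∂_{stdVec j} ρ) x)) x = 0 := by
      intro j x hx
      ext v
      rw [hU.fderiv_eq_sum, zero_apply]
      refine Finset.sum_eq_zero fun i _ => ?_
      have : ddSharp h i j (reflect ρ x) = ofFun h (reflect (∂_{stdVec i} (∂_{stdVec j} ρ)) x) := by
        change (∂_{stdVec i} (∂_{stdVec j} (ofFun h))) _ = _
        rw [lineDerivOp_distr_reflect, lineDerivOp_distr_reflect, lineDerivOp_test_comm]
      rw [← this, hz i j, mul_zero]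
      have hsub : tsupport (reflect ρ x) ⊆ Metric.closedBall x (1 / ((k : ℝ) + 1)) := by
        refine closure_minimal (fun t ht => ?_) Metric.isClosed_closedBall
        by_contra hcon
        rw [Metric.mem_closedBall, not_le, dist_comm, dist_eq_norm] at hcon
        exact ht (mollifier_eq_zero hcon)
      refine hsub.trans fun t ht => ?_
      have h1 := Metric.mem_closedBall.1 ht
      have h2 := Metric.mem_ball.1 hx
      exact Metric.mem_ball.2 (by linarith [dist_triangle t x x₀])
    have hconst : ∀ j : Fin n, ∀ x ∈ B, ofFun h (reflect (∂_{stdVec j} ρ) x) =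
        ofFun h (reflect (∂_{stdVec j} ρ) x₀) := fun j x hx =>
      hopen.is_const_of_fderiv_eq_zero hpre ((hU _).1.differentiableOn) (hd2 j) hx hx₀
    refine ⟨WithLp.toLp 2 fun j => ofFun h (reflect (∂_{stdVec j} ρ) x₀), fun y hy => ?_⟩
    set a : E n := WithLp.toLp 2 fun j => ofFun h (reflect (∂_{stdVec j} ρ) x₀) with ha
    have hder : ∀ x, HasFDerivAt (fun x => mollify h k x - ⟪a, x⟫)
        (fderiv ℝ (fun x => ofFun h (reflect ρ x)) x - innerSL ℝ a) x := fun x =>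
      ((hU ρ).1 x).hasFDerivAt.sub (innerSL ℝ a).hasFDerivAt
    have hzero : ∀ x ∈ B, fderiv ℝ (fun x => mollify h k x - ⟪a, x⟫) x = 0 := by
      intro x hx
      rw [(hder x).fderiv]
      ext v
      rw [sub_apply, hU.fderiv_eq_sum]
      simp only [hconst _ x hx, innerSL_apply_apply, ha, PiLp.inner_apply]
      simp
    have := hopen.is_const_of_fderiv_eq_zero hpre
      (fun x _ => (hder x).differentiableAt.differentiableWithinAt) hzero hy hx₀
    rw [inner_sub_right]
    linarith
  have hlim : ∀ x, Filter.Tendsto (fun k => mollify h k x) Filter.atTop (𝓝 (h x)) := fun x =>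
    (tendstoUniformlyOn_mollify hh (isCompact_singleton (x := x))).tendsto_at rfl
  -- so `h` is affine as a pointwise limit: its slope is read off at the points `x₀ + s • e_j`
  set s := r / 4 with hs
  have hs0 : s ≠ 0 := by positivity
  have hpt : ∀ j : Fin n, x₀ + s • (stdVec j : E n) ∈ B := by
    intro j
    rw [hB, Metric.mem_ball, dist_eq_norm, add_sub_cancel_left, norm_smul,
      Real.norm_of_nonneg (by positivity), PiLp.norm_single]
    simp only [norm_one, mul_one, hs]; linarith
  refine ⟨WithLp.toLp 2 fun j => (h (x₀ + s • stdVec j) - h x₀) / s, fun y hy => ?_⟩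
  have hform : ∀ a : E n, ⟪a, y - x₀⟫ = ∑ j, (y - x₀) j * a j := fun a => by
    simp [PiLp.inner_apply]
  have hleft : Filter.Tendsto (fun k => mollify h k x₀ + ∑ j : Fin n, (y - x₀) j *
      ((mollify h k (x₀ + s • stdVec j) - mollify h k x₀) / s)) Filter.atTop
      (𝓝 (h x₀ + ∑ j : Fin n, (y - x₀) j * ((h (x₀ + s • stdVec j) - h x₀) / s))) :=
    (hlim x₀).add (tendsto_finsetSum _ fun j _ =>
      (((hlim _).sub (hlim x₀)).div_const s).const_mul _)
  rw [hform]
  refine tendsto_nhds_unique (hlim y) (hleft.congr' ?_)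
  filter_upwards [hk] with k hk
  obtain ⟨a, ha⟩ := hk
  rw [ha y hy, hform]
  congr 1
  refine Finset.sum_congr rfl fun j _ => ?_
  rw [ha _ (hpt j), add_sub_cancel_left, add_sub_cancel_left, inner_smul_right,
    EuclideanSpace.inner_single_right]
  simp only [conj_trivial, one_mul]
  rw [mul_div_cancel_left₀ _ hs0]

theorem exists_affine_of_ddSharp_eq {f g : E n → ℝ} (hf : Continuous f) (hg : Continuous g)
    (h : ddSharp f = ddSharp g) : ∃ (c : ℝ) (a : E n), ∀ y, f y = g y + (c + ⟪a, y⟫) := by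
  have hz : ∀ r, ∀ i j (φ : Test n), tsupport φ ⊆ Metric.ball (0 : E n) r →
      ddSharp (fun x => f x - g x) i j φ = 0 := by
    intro r i j φ _
    rw [ddSharp_apply, ofFun_sub hf hg]
    change ofFun f _ - ofFun g _ = 0
    rw [← ddSharp_apply, ← ddSharp_apply, h, sub_self]
  have hball : ∀ r : ℝ, 0 < r → ∃ a : E n, ∀ y ∈ Metric.ball (0 : E n) r,
      f y - g y = f 0 - g 0 + ⟪a, y⟫ := by
    intro r hr
    obtain ⟨a, ha⟩ := exists_affine_of_ddSharp_eq_zero (hf.sub hg) (x₀ := 0) (r := 2 * r)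
      (by positivity) (hz _)
    refine ⟨a, fun y hy => ?_⟩
    have := ha y (by rwa [mul_div_cancel_left₀ r two_ne_zero])
    simpa using this
  choose! a ha using hball
  refine ⟨f 0 - g 0, a 1, fun y => ?_⟩
  have hnear : ∀ r, 0 < r → AffineNear (fun x => f x - g x) 0 (a r) := by
    intro r hr
    filter_upwards [Metric.ball_mem_nhds (0 : E n) hr] with z hz'
    rw [ha r hr z hz', sub_zero]
  have hr : 0 < ‖y‖ + 1 := by positivity
  have h1 := ha _ hr y (by rw [mem_ball_zero_iff]; linarith)
  rw [(hnear _ hr).unique (hnear 1 one_pos)] at h1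
  linarith

/-! ### The support of `dd^# f` -/

/-- Off its support, `dd^# f` vanishes on balls, on which `f` is then affine. -/
theorem support_ddSharp {f : E n → ℝ} (hf : Continuous f) : support (ddSharp f) = kinks f := by
  ext x
  rw [← not_iff_not]
  have hsup : x ∉ support (ddSharp f) ↔ ∀ i j, x ∉ Distribution.dsupport (ddSharp f i j) := by
    simp [support]
  rw [hsup]
  simp only [Distribution.notMem_dsupport_iff, kinks, mem_ofPred_eq, not_forall, not_not]
  constructor
  · intro h
    choose O hO1 hO2 hO3 using h
    have hO : IsOpen (⋂ i, ⋂ j, O i j) :=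
      isOpen_iInter_of_finite fun i => isOpen_iInter_of_finite fun j => hO2 i j
    obtain ⟨r, hr, hball⟩ := Metric.isOpen_iff.1 hO x (by simpa using hO3)
    obtain ⟨a, ha⟩ := exists_affine_of_ddSharp_eq_zero hf hr fun i j φ hφ =>
      hO1 i j φ (hφ.trans (hball.trans fun y hy => mem_iInter.1 (mem_iInter.1 hy i) j))
    exact ⟨a, Filter.mem_of_superset (Metric.ball_mem_nhds x (half_pos hr)) ha⟩
  · rintro ⟨a, ha⟩ i j
    obtain ⟨O, hOsub, hO, hxO⟩ := mem_nhds_iff.1 ha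
    refine ⟨O, fun φ hφ => ?_, hO, hxO⟩
    -- replace `f` by the affine function with which it agrees on the support of `φ`
    set ℓ : E n → ℝ := fun y => f x + ⟪a, y - x⟫ with hℓ
    have hℓc : Continuous ℓ := by fun_prop
    have hts : tsupport (∂_{stdVec j} (∂_{stdVec i} φ) : Test n) ⊆ tsupport φ := by
      have key : ∀ (ψ : Test n) (v : E n), tsupport (∂_{v} ψ : Test n) ⊆ tsupport ψ := by
        intro ψ v
        refine closure_minimal (fun y hy => ?_) isClosed_closure
        by_contra hcon
        refine hy ?_
        rw [lineDerivOp_test_apply,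
          image_eq_zero_of_notMem_tsupport fun h => hcon (tsupport_fderiv_subset ℝ h)]
        rfl
      exact (key _ _).trans (key _ _)
    have e : ddSharp f i j φ = ddSharp ℓ i j φ := by
      rw [ddSharp_apply, ddSharp_apply, ofFun_apply hf, ofFun_apply hℓc]
      refine integral_congr_ae (Filter.Eventually.of_forall fun y => ?_)
      simp only
      by_cases hy : y ∈ tsupport φ
      · rw [show f y = ℓ y from hOsub (hφ hy)]
      · rw [image_eq_zero_of_notMem_tsupport fun h => hy (hts h), zero_mul, zero_mul]
    rw [e, ddSharp_eq_ofFun (w := fun j _ => a j) (H := fun _ _ _ => 0) hℓc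
      (fun j => continuous_const) (fun _ _ => continuous_const) ?_ ?_, ofFun_apply continuous_const]
    · simp
    · intro j y
      have h1 : HasFDerivAt ℓ (innerSL ℝ a) y :=
        ((innerSL ℝ a).hasFDerivAt.comp y ((hasFDerivAt_id y).sub_const x)).const_add (f x)
      have h2 := h1.hasLineDerivAt (stdVec j)
      simpa [EuclideanSpace.inner_single_right] using h2
    · intro i j y
      simpa using (hasFDerivAt_const (a j) y).hasLineDerivAt (stdVec i)

/-! ### Nonnegative functionals on test functions are measures -/

theorem exists_test_eq_one (K : Set (E n)) (hK : IsCompact K) :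
    ∃ χ : Test n, (∀ x, 0 ≤ χ x) ∧ ∀ x ∈ K, χ x = 1 := by
  obtain ⟨R, hR⟩ := hK.isBounded.subset_closedBall (0 : E n)
  let b : ContDiffBump (0 : E n) := ⟨|R| + 1, |R| + 2, by positivity, by linarith⟩
  refine ⟨⟨b, b.contDiff, b.hasCompactSupport, fun _ _ => mem_univ _⟩, fun x => b.nonneg, ?_⟩
  intro x hx
  refine b.one_of_mem_closedBall (Metric.closedBall_subset_closedBall ?_ (hR hx))
  exact (le_abs_self R).trans (by simp [b])

/-- Test functions as compactly supported continuous functions. -/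
noncomputable def testToCc : Test n →ₗ[ℝ] CompactlySupportedContinuousMap (E n) ℝ where
  toFun φ := ⟨⟨φ, φ.continuous⟩, φ.hasCompactSupport⟩
  map_add' _ _ := rfl
  map_smul' _ _ := rfl

@[simp] theorem testToCc_apply (φ : Test n) (x : E n) : testToCc φ x = φ x := rfl

theorem testToCc_injective : Function.Injective (testToCc (n := n)) := by
  intro φ ψ h
  ext x
  exact DFunLike.congr_fun h x

/-- A functional which is nonnegative on nonnegative test functions extends to a positive functional
on compactly supported continuous functions, by M. Riesz's extension theorem, and is therefore given
by a measure. -/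
theorem exists_measure_of_nonneg (U : Test n →ₗ[ℝ] ℝ)
    (hU : ∀ φ : Test n, (∀ x, 0 ≤ φ x) → 0 ≤ U φ) :
    ∃ μ : Measure (E n), IsLocallyFiniteMeasure μ ∧ ∀ φ, U φ = ∫ t, φ t ∂μ := by
  let e := LinearEquiv.ofInjective (testToCc (n := n)) testToCc_injective
  obtain ⟨g, hg, hpos⟩ := riesz_extension
    { carrier := {y : CompactlySupportedContinuousMap (E n) ℝ | ∀ x, 0 ≤ y x}
      add_mem' := fun hy hz x => add_nonneg (hy x) (hz x)
      zero_mem' := fun _ => le_rfl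
      smul_mem' := fun c _ hy x => mul_nonneg c.2 (hy x) }
    ⟨LinearMap.range (testToCc (n := n)), U ∘ₗ e.symm.toLinearMap⟩ (by
      rintro ⟨y, φ, rfl⟩ hy
      have : e.symm ⟨testToCc φ, φ, rfl⟩ = φ := e.symm_apply_eq.2 rfl
      change 0 ≤ U (e.symm _)
      rw [this]
      exact hU φ fun x => hy x) (by
      intro y
      obtain ⟨χ, hχ, hχ1⟩ := exists_test_eq_one _ y.hasCompactSupport.isCompact
      obtain ⟨C, hC⟩ := y.hasCompactSupport.exists_bound_of_continuous y.continuous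
      refine ⟨⟨testToCc (C • χ), _, rfl⟩, ?_⟩
      intro x
      change 0 ≤ C * χ x + y x
      have h1 := hC x
      rw [Real.norm_eq_abs] at h1
      by_cases hx : x ∈ tsupport y
      · rw [hχ1 x hx]
        linarith [neg_abs_le (y x)]
      · rw [image_eq_zero_of_notMem_tsupport hx, add_zero]
        exact mul_nonneg ((abs_nonneg _).trans h1) (hχ x))
  let Λ := PositiveLinearMap.mk₀ g fun x hx => hpos x hx
  refine ⟨RealRMK.rieszMeasure Λ, inferInstance, fun φ => ?_⟩
  have h1 := RealRMK.integral_rieszMeasure Λ (testToCc φ)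
  have h2 := hg ⟨testToCc φ, φ, rfl⟩
  have h3 : e.symm ⟨testToCc φ, φ, rfl⟩ = φ := e.symm_apply_eq.2 rfl
  simp only [testToCc_apply] at h1
  rw [h1]
  change U φ = g (testToCc φ)
  rw [h2]
  change U φ = U (e.symm _)
  rw [h3]

/-- A functional which is nonnegative on squares is nonnegative on nonnegative test functions, since
`φ + ε χ ^ 2` is the square of `√(φ + ε) χ` if `χ = 1` on the support of `φ`. -/
theorem nonneg_of_nonneg_mulTest (U : Test n →ₗ[ℝ] ℝ) (hU : ∀ φ, 0 ≤ U (mulTest φ φ)) (φ : Test n)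
    (hφ : ∀ x, 0 ≤ φ x) : 0 ≤ U φ := by
  obtain ⟨χ, -, hχ1⟩ := exists_test_eq_one _ φ.hasCompactSupport.isCompact
  have key : ∀ ε > 0, 0 ≤ U φ + ε * U (mulTest χ χ) := by
    intro ε hε
    let ψ : Test n :=
      { toFun := fun x => Real.sqrt (φ x + ε) * χ x
        contDiff' := ((φ.contDiff.add contDiff_const).sqrt fun x => by
          have := hφ x; positivity).mul χ.contDiff
        hasCompactSupport' := χ.hasCompactSupport.mul_left
        tsupport_subset' := fun _ _ => mem_univ _ }
    have e : mulTest ψ ψ = φ + ε • mulTest χ χ := by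
      ext x
      change Real.sqrt (φ x + ε) * χ x * (Real.sqrt (φ x + ε) * χ x) = φ x + ε * (χ x * χ x)
      have hs := Real.mul_self_sqrt (show 0 ≤ φ x + ε by have := hφ x; positivity)
      by_cases hx : x ∈ tsupport φ
      · rw [hχ1 x hx]; linear_combination hs
      · have h0 := image_eq_zero_of_notMem_tsupport hx
        rw [h0] at hs ⊢
        linear_combination (χ x) ^ 2 * hs
    have := hU ψ
    rwa [e, map_add, map_smul, smul_eq_mul] at this
  by_contra hneg
  push Not at hneg
  set B := U (mulTest χ χ)
  have := key (-U φ / (2 * (|B| + 1))) (by apply div_pos <;> [linarith; positivity])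
  have h2 : -U φ / (2 * (|B| + 1)) * B ≤ -U φ / 2 := by
    rw [div_mul_eq_mul_div, div_le_div_iff₀ (by positivity) two_pos]
    nlinarith [le_abs_self B]
  linarith

/-- The contraction of a positive current with a vector is a measure. -/
theorem IsPositive.exists_measure {T : Current11 n} (hT : IsPositive T) (v : E n) :
    ∃ μ : Measure (E n), IsLocallyFiniteMeasure μ ∧
      ∀ φ, ∑ i, ∑ j, v i * v j * T i j φ = ∫ t, φ t ∂μ := by
  let U : Test n →ₗ[ℝ] ℝ := ∑ i, ∑ j, (v i * v j) • (T i j : Test n →L[ℝ] ℝ).toLinearMap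
  have hU : ∀ φ, U φ = ∑ i, ∑ j, v i * v j * T i j φ := by
    intro φ
    simp only [U, LinearMap.sum_apply, LinearMap.smul_apply, smul_eq_mul]
    rfl
  simp only [← hU]
  refine exists_measure_of_nonneg U (nonneg_of_nonneg_mulTest U fun φ => ?_)
  have := hT.2 fun i => ((-1 : ℝ) ^ (i : ℕ) * v i) • φ
  rw [hU]
  refine this.trans_eq (Finset.sum_congr rfl fun i _ => Finset.sum_congr rfl fun j _ => ?_)
  have e : squareForm (fun i : Fin n => ((-1 : ℝ) ^ (i : ℕ) * v i) • φ) i j =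
      ((-1 : ℝ) ^ ((i : ℕ) + (j : ℕ)) * (v i * v j)) • mulTest φ φ := by
    ext x
    change ((-1 : ℝ) ^ (i : ℕ) * v i) * φ x * (((-1 : ℝ) ^ (j : ℕ) * v j) * φ x) =
      ((-1 : ℝ) ^ ((i : ℕ) + (j : ℕ)) * (v i * v j)) * (φ x * φ x)
    rw [pow_add]; ring
  rw [e, map_smul, smul_eq_mul, ← mul_assoc, ← mul_assoc, ← pow_add, ← two_mul, pow_mul]
  simp

/-! ### Mollification of measures -/

/-- Smearing with mollifiers approximates `U`. (This holds for every distribution; below it is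
proved for locally finite measures.) -/
def IsMollifierLimit (U : Distr n) : Prop :=
  ∀ φ, Filter.Tendsto (fun k => ofFun (fun x => U (reflect (mollifier n k) x)) φ)
    Filter.atTop (𝓝 (U φ))

theorem IsMollifierLimit.sub {U V : Distr n} (hU : IsMollifierLimit U) (hV : IsMollifierLimit V)
    (hU' : SmearsSmoothly U) (hV' : SmearsSmoothly V) : IsMollifierLimit (U - V) := by
  intro φ
  have := (hU φ).sub (hV φ)
  refine this.congr fun k => ?_
  exact (DFunLike.congr_fun (ofFun_sub (hU'.continuous (mollifier n k))
    (hV'.continuous (mollifier n k))) φ).symm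

theorem IsMollifierLimit.smul {U : Distr n} (hU : IsMollifierLimit U) (hU' : SmearsSmoothly U)
    (c : ℝ) : IsMollifierLimit (c • U) := by
  intro φ
  refine ((hU φ).const_mul c).congr fun k => ?_
  have hc := hU'.continuous (mollifier n k)
  rw [ofFun_apply hc, ofFun_apply (show Continuous fun x => (c • U) (reflect (mollifier n k) x) from
    hc.const_smul c), ← integral_const_mul]
  refine integral_congr_ae (Filter.Eventually.of_forall fun x => ?_)
  change c * (φ x * U _) = φ x * (c * U _)
  ring

theorem IsMollifierLimit.of_integral {U : Distr n} {μ : Measure (E n)} [IsLocallyFiniteMeasure μ]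
    (hU : ∀ φ, U φ = ∫ t, φ t ∂μ) : IsMollifierLimit U := by
  intro φ
  have hUs : SmearsSmoothly U := SmearsSmoothly.of_integral (f := fun _ => 1) (μ := μ)
    (continuous_const.locallyIntegrable) (by simpa using hU)
  set K := Metric.cthickening 1 (tsupport φ) with hK
  have hKc : IsCompact K := φ.hasCompactSupport.isCompact.cthickening
  have hk1 : ∀ k : ℕ, 1 / ((k : ℝ) + 1) ≤ 1 := fun k => by
    rw [div_le_one (by positivity)]; linarith [(Nat.cast_nonneg k : (0 : ℝ) ≤ k)]
  -- the pairing is the integral of the averages of `φ`, by Fubini's theorem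
  have hfub : ∀ k, ofFun (fun x => U (reflect (mollifier n k) x)) φ =
      ∫ t, (∫ s, mollifier n k s * φ (t + s)) ∂μ := by
    intro k
    have h1 : ∀ x, φ x * U (reflect (mollifier n k) x) =
        ∫ t, φ x * mollifier n k (x - t) ∂μ := by
      intro x
      rw [hU, ← integral_const_mul]
      rfl
    rw [ofFun_apply (hUs.continuous _)]
    simp only [h1]
    rw [integral_integral_swap_of_hasCompactSupport
      (f := fun x t => φ x * mollifier n k (x - t))]
    · refine integral_congr_ae (Filter.Eventually.of_forall fun t => ?_)
      simp only
      rw [← integral_add_left_eq_self _ t]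
      simp [mul_comm]
    · exact (φ.continuous.comp continuous_fst).mul
        ((mollifier n k).continuous.comp (continuous_fst.sub continuous_snd))
    · refine HasCompactSupport.intro (φ.hasCompactSupport.isCompact.prod hKc) fun p hp => ?_
      simp only [Function.uncurry]
      by_cases h2 : p.1 ∈ tsupport φ
      · have h3 : p.2 ∉ K := fun h => hp ⟨h2, h⟩
        rw [mollifier_eq_zero, mul_zero]
        by_contra hcon
        refine h3 (Metric.mem_cthickening_of_dist_le _ _ _ _ h2 ?_)
        rw [dist_comm, dist_eq_norm]
        exact (not_lt.1 hcon).trans (hk1 k)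
      · rw [image_eq_zero_of_notMem_tsupport h2, zero_mul]
  simp only [hfub]
  rw [hU]
  obtain ⟨C, hC⟩ := φ.hasCompactSupport.exists_bound_of_continuous φ.continuous
  have hcont : ∀ t : E n, Continuous fun s => φ (t + s) := fun t =>
    φ.continuous.comp (continuous_const.add continuous_id)
  refine tendsto_integral_of_dominated_convergence (K.indicator fun _ => C) (fun k => ?_)
    (IntegrableOn.integrable_indicator (integrableOn_const hKc.measure_lt_top.ne)
      hKc.measurableSet) (fun k => Filter.Eventually.of_forall fun t => ?_)
    (Filter.Eventually.of_forall fun t => ?_)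
  · exact (StronglyMeasurable.integral_prod_right' (f := fun p : E n × E n =>
      mollifier n k p.2 * φ (p.1 + p.2)) (((mollifier n k).continuous.comp continuous_snd).mul
        (φ.continuous.comp
          (continuous_fst.add continuous_snd))).stronglyMeasurable).aestronglyMeasurable
  · have := abs_integral_mollifier_sub_le (hcont t) (k := k) (c := 0)
      (ε := K.indicator (fun _ => C) t) fun s hs => ?_
    · rwa [sub_zero, ← Real.norm_eq_abs] at this
    · rw [sub_zero, ← Real.norm_eq_abs]
      by_cases ht : t ∈ K
      · rw [indicator_of_mem ht]; exact hC _
      · rw [indicator_of_notMem ht, image_eq_zero_of_notMem_tsupport (f := φ), norm_zero]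
        refine fun h => ht (Metric.mem_cthickening_of_dist_le _ _ _ _ h ?_)
        rw [dist_eq_norm, sub_add_cancel_left, norm_neg]
        exact hs.trans (hk1 k)
  · rw [Metric.tendsto_nhds]
    intro ε hε
    obtain ⟨δ, hδ, h⟩ := Metric.continuousAt_iff.1 (φ.continuous.continuousAt (x := t))
      (ε / 2) (half_pos hε)
    filter_upwards [tendsto_one_div_nat.eventually (gt_mem_nhds hδ)] with k hk
    refine lt_of_le_of_lt (abs_integral_mollifier_sub_le (hcont t) fun s hs => ?_) (half_lt_self hε)
    exact (h (x := t + s) (by simpa [dist_eq_norm] using hs.trans_lt hk)).le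

/-- The coefficients of a positive current are differences of measures, by polarization. -/
theorem IsPositive.smearsSmoothly {T : Current11 n} (hT : IsPositive T) (i j : Fin n) :
    SmearsSmoothly (T i j) ∧ IsMollifierLimit (T i j) := by
  have hmeas : ∀ U : Distr n, (∃ μ : Measure (E n), IsLocallyFiniteMeasure μ ∧
      ∀ φ, U φ = ∫ t, φ t ∂μ) → SmearsSmoothly U ∧ IsMollifierLimit U := by
    rintro U ⟨μ, _, h⟩
    exact ⟨SmearsSmoothly.of_integral (f := fun _ => 1) (μ := μ)
      (continuous_const.locallyIntegrable) (by simpa using h), IsMollifierLimit.of_integral h⟩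
  have hdiag : ∀ i, SmearsSmoothly (T i i) ∧ IsMollifierLimit (T i i) := by
    intro i
    obtain ⟨μ, hμ, h⟩ := hT.exists_measure (stdVec i)
    refine hmeas _ ⟨μ, hμ, fun φ => ?_⟩
    rw [← h]
    simp
  have hsum : SmearsSmoothly (T i i + T j j + (2 : ℝ) • T i j) ∧
      IsMollifierLimit (T i i + T j j + (2 : ℝ) • T i j) := by
    obtain ⟨μ, hμ, h⟩ := hT.exists_measure (stdVec i + stdVec j)
    refine hmeas _ ⟨μ, hμ, fun φ => ?_⟩
    rw [← h]
    change T i i φ + T j j φ + 2 * T i j φ = _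
    have := DFunLike.congr_fun (hT.1 i j) φ
    simp [add_mul, mul_add, Finset.sum_add_distrib]
    linarith
  have e : T i j = (1 / 2 : ℝ) • ((T i i + T j j + (2 : ℝ) • T i j) - T i i - T j j) := by
    ext φ
    change T i j φ = 1 / 2 * (T i i φ + T j j φ + 2 * T i j φ - T i i φ - T j j φ)
    ring
  rw [e]
  have h1 := hsum.1.sub (hdiag i).1
  have h2 := hsum.2.sub (hdiag i).2 hsum.1 (hdiag i).1
  have h3 := h1.sub (hdiag j).1
  exact ⟨h3.smul _, (h2.sub (hdiag j).2 h1 (hdiag j).1).smul h3 _⟩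

/-! ### Potentials of smooth closed currents -/

/-- Poincaré's lemma in coordinates. -/
theorem exists_primitive {h : Fin n → E n → ℝ} (hd : ∀ i, Differentiable ℝ (h i))
    (hsymm : ∀ i k x, fderiv ℝ (h i) x (stdVec k) = fderiv ℝ (h k) x (stdVec i)) :
    ∃ f : E n → ℝ, f 0 = 0 ∧
      ∀ x, HasFDerivAt f (∑ i, h i x • (EuclideanSpace.proj i : E n →L[ℝ] ℝ)) x := by
  set η : E n → E n →L[ℝ] ℝ := fun x => ∑ i, h i x • (EuclideanSpace.proj i : E n →L[ℝ] ℝ) with hη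
  have hη' : ∀ x, HasFDerivAt η (∑ i, (fderiv ℝ (h i) x).smulRight
      (EuclideanSpace.proj i : E n →L[ℝ] ℝ)) x := fun x =>
    HasFDerivAt.fun_sum fun i _ =>
      (hd i x).hasFDerivAt.smul_const (EuclideanSpace.proj i : E n →L[ℝ] ℝ)
  have hform : ∀ x y z, fderiv ℝ η x y z =
      ∑ i, ∑ k, y k * z i * fderiv ℝ (h i) x (stdVec k) := by
    intro x y z
    rw [(hη' x).fderiv]
    simp only [sum_apply, ContinuousLinearMap.smulRight_apply, smul_apply,
      PiLp.proj_apply, smul_eq_mul]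
    refine Finset.sum_congr rfl fun i _ => ?_
    conv_lhs => rw [eq_sum_smul_stdVec y, map_sum, Finset.sum_mul]
    refine Finset.sum_congr rfl fun k _ => ?_
    rw [map_smul, smul_eq_mul]
    ring
  obtain ⟨f, hf⟩ := convex_univ.exists_forall_hasFDerivAt_of_fderiv_symmetric isOpen_univ
    (show DifferentiableOn ℝ η univ from fun x _ =>
      (hη' x).differentiableAt.differentiableWithinAt) fun x _ y z => by
      rw [hform, hform, Finset.sum_comm]
      refine Finset.sum_congr rfl fun i _ => Finset.sum_congr rfl fun k _ => ?_
      rw [hsymm]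
      ring
  exact ⟨fun x => f x - f 0, sub_self _, fun x => (hf x (mem_univ x)).sub_const _⟩

/-- `g` is a twice differentiable function with first derivatives `w` and second derivatives `H`,
which vanishes to first order at `0`. -/
structure HasHessian (g : E n → ℝ) (w : Fin n → E n → ℝ) (H : Fin n → Fin n → E n → ℝ) : Prop where
  zero : g 0 = 0
  fst_zero : ∀ j, w j 0 = 0
  fst : ∀ x, HasFDerivAt g (∑ j, w j x • (EuclideanSpace.proj j : E n →L[ℝ] ℝ)) x
  snd : ∀ j x, HasFDerivAt (w j) (∑ i, H i j x • (EuclideanSpace.proj i : E n →L[ℝ] ℝ)) x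

theorem sum_smul_proj_stdVec (c : Fin n → ℝ) (k : Fin n) :
    (∑ i, c i • (EuclideanSpace.proj i : E n →L[ℝ] ℝ)) (stdVec k) = c k := by
  simp

/-- A symmetric matrix of functions which is closed as a current, `∂_k H_{ij} = ∂_i H_{kj}`, is a
Hessian, by Poincaré's lemma applied to its columns and then to their primitives. -/
theorem exists_hasHessian {H : Fin n → Fin n → E n → ℝ} (hd : ∀ i j, Differentiable ℝ (H i j))
    (hclosed : ∀ k i j x, fderiv ℝ (H i j) x (stdVec k) = fderiv ℝ (H k j) x (stdVec i))
    (hsymm : ∀ i j x, H i j x = H j i x) : ∃ g w, HasHessian g w H := by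
  choose w hw0 hw using fun j => exists_primitive (h := fun i => H i j) (fun i => hd i j)
    fun i k x => hclosed k i j x
  obtain ⟨g, hg0, hg⟩ := exists_primitive (h := w) (fun i x => (hw i x).differentiableAt)
    fun i k x => by
      rw [(hw i x).fderiv, (hw k x).fderiv, sum_smul_proj_stdVec, sum_smul_proj_stdVec, hsymm]
  exact ⟨g, w, hg0, hw0, hg, hw⟩

section HasHessian

variable {g : E n → ℝ} {w : Fin n → E n → ℝ} {H : Fin n → Fin n → E n → ℝ}

theorem HasHessian.continuous (h : HasHessian g w H) : Continuous g :=
  continuous_iff_continuousAt.2 fun x => (h.fst x).continuousAt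

theorem HasHessian.continuous_fst (h : HasHessian g w H) (j : Fin n) : Continuous (w j) :=
  continuous_iff_continuousAt.2 fun x => (h.snd j x).continuousAt

theorem HasHessian.hasLineDerivAt_fst (h : HasHessian g w H) (j : Fin n) (x : E n) :
    HasLineDerivAt ℝ g (w j x) x (stdVec j) := by
  have := (h.fst x).hasLineDerivAt (stdVec j)
  rwa [sum_smul_proj_stdVec] at this

theorem HasHessian.hasLineDerivAt_snd (h : HasHessian g w H) (i j : Fin n) (x : E n) :
    HasLineDerivAt ℝ (w j) (H i j x) x (stdVec i) := by
  have := (h.snd j x).hasLineDerivAt (stdVec i)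
  rwa [sum_smul_proj_stdVec] at this

theorem HasHessian.hasDerivAt_line (h : HasHessian g w H) (x v : E n) (t : ℝ) :
    HasDerivAt (fun t : ℝ => g (x + t • v)) (∑ j, v j * w j (x + t • v)) t := by
  have h1 : HasDerivAt (fun t : ℝ => x + t • v) v t := by
    simpa using ((hasDerivAt_id t).smul_const v).const_add x
  refine ((h.fst _).comp_hasDerivAt t h1).congr_deriv ?_
  simp [mul_comm]

theorem HasHessian.hasDerivAt_line_fst (h : HasHessian g w H) (x v : E n) (t : ℝ) :
    HasDerivAt (fun t : ℝ => ∑ j, v j * w j (x + t • v))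
      (∑ i, ∑ j, v i * v j * H i j (x + t • v)) t := by
  have h1 : HasDerivAt (fun t : ℝ => x + t • v) v t := by
    simpa using ((hasDerivAt_id t).smul_const v).const_add x
  have h2 := HasDerivAt.fun_sum (u := Finset.univ) fun (j : Fin n) _ =>
    ((h.snd j _).comp_hasDerivAt t h1).const_mul (v j)
  refine h2.congr_deriv ?_
  rw [Finset.sum_comm]
  refine Finset.sum_congr rfl fun j _ => ?_
  simp only [sum_apply, smul_apply, PiLp.proj_apply, smul_eq_mul,
    Finset.mul_sum]
  exact Finset.sum_congr rfl fun i _ => by ring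

theorem HasHessian.convexOn_line (h : HasHessian g w H)
    (hpos : ∀ x v : E n, 0 ≤ ∑ i, ∑ j, v i * v j * H i j x) (x v : E n) :
    ConvexOn ℝ univ fun t : ℝ => g (x + t • v) := by
  refine Monotone.convexOn_univ_of_deriv (fun t => (h.hasDerivAt_line x v t).differentiableAt) ?_
  rw [show deriv (fun t : ℝ => g (x + t • v)) = fun t : ℝ => ∑ j, v j * w j (x + t • v) from
    funext fun t => (h.hasDerivAt_line x v t).deriv]
  refine monotone_of_deriv_nonneg (fun t => (h.hasDerivAt_line_fst x v t).differentiableAt)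
    fun t => ?_
  rw [(h.hasDerivAt_line_fst x v t).deriv]
  exact hpos _ v

theorem HasHessian.convexOn (h : HasHessian g w H)
    (hpos : ∀ x v : E n, 0 ≤ ∑ i, ∑ j, v i * v j * H i j x) : ConvexOn ℝ univ g := by
  refine ⟨convex_univ, fun x _ y _ a b ha hb hab => ?_⟩
  have := (h.convexOn_line hpos x (y - x)).2 (mem_univ 0) (mem_univ 1) ha hb hab
  simp only [smul_eq_mul, mul_zero, mul_one, zero_add, zero_smul, add_zero, one_smul,
    add_sub_cancel] at this
  rw [smul_eq_mul, smul_eq_mul]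
  refine le_of_eq_of_le ?_ this
  congr 1
  rw [← eq_sub_iff_add_eq] at hab
  rw [hab]
  module

theorem HasHessian.nonneg (h : HasHessian g w H)
    (hpos : ∀ x v : E n, 0 ≤ ∑ i, ∑ j, v i * v j * H i j x) (x : E n) : 0 ≤ g x := by
  have := (h.convexOn_line hpos 0 x).le_slope_of_hasDerivAt (mem_univ 0) (mem_univ 1) one_pos
    (h.hasDerivAt_line 0 x 0)
  simpa [slope_def_field, h.zero, h.fst_zero] using this

theorem HasHessian.le_sum (h : HasHessian g w H)
    (hpos : ∀ x v : E n, 0 ≤ ∑ i, ∑ j, v i * v j * H i j x) (x : E n) :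
    g x ≤ ∑ j, x j * w j x := by
  have := (h.convexOn_line hpos 0 x).slope_le_of_hasDerivAt (mem_univ 0) (mem_univ 1) one_pos
    (h.hasDerivAt_line 0 x 1)
  simpa [slope_def_field, h.zero] using this

end HasHessian

/-! ### A local bound for convex functions in terms of their Laplacian -/

/-- The test function `x ↦ exp (-1 / (K - ‖x‖ ^ 2))`, cut off at `‖x‖ ^ 2 = K`. -/
noncomputable def radialTest (n : ℕ) (K : ℝ) : Test n where
  toFun x := expNegInvGlue (K - ‖x‖ ^ 2)
  contDiff' := expNegInvGlue.contDiff.comp (contDiff_const.sub (contDiff_norm_sq ℝ))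
  hasCompactSupport' := by
    refine HasCompactSupport.intro (isCompact_closedBall (0 : E n) (|K| + 1)) fun x hx => ?_
    rw [mem_closedBall_zero_iff, not_le] at hx
    refine expNegInvGlue.zero_of_nonpos ?_
    nlinarith [le_abs_self K, abs_nonneg K, norm_nonneg x]
  tsupport_subset' := fun _ _ => mem_univ _

/-- The function `W` with `∇ (radialTest n K) = - W x • x`. -/
noncomputable def radialWeight (K : ℝ) (x : E n) : ℝ := 2 * deriv expNegInvGlue (K - ‖x‖ ^ 2)

theorem deriv_expNegInvGlue (s : ℝ) : deriv expNegInvGlue s = (s⁻¹) ^ 2 * expNegInvGlue s := by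
  have := (expNegInvGlue.hasDerivAt_polynomial_eval_inv_mul 1 s).deriv
  simpa using this

theorem radialWeight_nonneg (K : ℝ) (x : E n) : 0 ≤ radialWeight K x := by
  rw [radialWeight, deriv_expNegInvGlue]
  have := expNegInvGlue.nonneg (K - ‖x‖ ^ 2)
  positivity

theorem radialWeight_pos {K : ℝ} {x : E n} (hx : ‖x‖ ^ 2 < K) : 0 < radialWeight K x := by
  rw [radialWeight, deriv_expNegInvGlue]
  have := expNegInvGlue.pos_of_pos (sub_pos.2 hx)
  have := sub_pos.2 hx
  positivity

theorem continuous_radialWeight (K : ℝ) : Continuous (radialWeight (n := n) K) := by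
  have h : Continuous (deriv expNegInvGlue) :=
    (expNegInvGlue.contDiff (n := 1)).continuous_deriv (by simp)
  exact continuous_const.mul (h.comp (by fun_prop))

theorem lineDerivOp_radialTest (K : ℝ) (j : Fin n) (x : E n) :
    (∂_{stdVec j} (radialTest n K)) x = -(radialWeight K x * x j) := by
  rw [lineDerivOp_test_apply]
  have h1 : HasDerivAt expNegInvGlue (deriv expNegInvGlue (K - ‖x‖ ^ 2)) (K - ‖x‖ ^ 2) :=
    ((expNegInvGlue.contDiff (n := 1)).differentiable (by simp) _).hasDerivAt
  have h2 : HasFDerivAt (fun x : E n => K - ‖x‖ ^ 2) (-(2 • innerSL ℝ x)) x :=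
    ((hasStrictFDerivAt_norm_sq x).hasFDerivAt).const_sub K
  rw [show ⇑(radialTest n K) = expNegInvGlue ∘ fun x : E n => K - ‖x‖ ^ 2 from rfl,
    (h1.comp_hasFDerivAt x h2).fderiv, radialWeight]
  simp [EuclideanSpace.inner_single_right]
  ring

theorem radialWeight_eq_zero {K : ℝ} {x : E n} (hx : K ≤ ‖x‖ ^ 2) : radialWeight K x = 0 := by
  rw [radialWeight, deriv_expNegInvGlue, expNegInvGlue.zero_of_nonpos (by linarith)]
  simp

theorem integrable_radialWeight_mul (K : ℝ) {g : E n → ℝ} (hg : Continuous g) :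
    Integrable fun x => radialWeight K x * g x := by
  refine ((continuous_radialWeight K).mul hg).integrable_of_hasCompactSupport ?_
  refine HasCompactSupport.intro (isCompact_closedBall (0 : E n) (|K| + 1)) fun x hx => ?_
  rw [mem_closedBall_zero_iff, not_le] at hx
  rw [Pi.mul_apply, radialWeight_eq_zero, zero_mul]
  nlinarith [le_abs_self K, abs_nonneg K, norm_nonneg x]

/-- A weighted integral of a convex function which vanishes to first order at `0` is bounded by an
integral of its Laplacian: integrate `g x ≤ ∇ g x · x` and use `W x • x = - ∇ ψ` with `W` the radial
weight and `ψ` the radial test function. -/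
theorem HasHessian.integral_radialWeight_le {g : E n → ℝ} {w : Fin n → E n → ℝ}
    {H : Fin n → Fin n → E n → ℝ} (h : HasHessian g w H) (hH : ∀ i j, Continuous (H i j))
    (hpos : ∀ x v : E n, 0 ≤ ∑ i, ∑ j, v i * v j * H i j x) (K : ℝ) :
    ∫ x, radialWeight K x * g x ≤ ∑ j, ofFun (H j j) (radialTest n K) := by
  have hw := h.continuous_fst
  have hint : ∀ j, Integrable fun x : E n => radialWeight K x * (x j * w j x) := fun j =>
    integrable_radialWeight_mul K ((by fun_prop : Continuous fun x : E n => x j).mul (hw j))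
  have e : ∀ j, ofFun (H j j) (radialTest n K) = ∫ x, radialWeight K x * (x j * w j x) := by
    intro j
    rw [← neg_eq_iff_eq_neg.2 (ofFun_lineDerivOp (hw j) (hH j j) (stdVec j)
      (h.hasLineDerivAt_snd j j) (radialTest n K)), ofFun_apply (hw j), ← integral_neg]
    refine integral_congr_ae (Filter.Eventually.of_forall fun x => ?_)
    simp only [lineDerivOp_radialTest]
    ring
  simp only [e]
  rw [← integral_finsetSum _ fun j _ => hint j]
  refine integral_mono (integrable_radialWeight_mul K h.continuous)
    (integrable_finsetSum _ fun j _ => hint j) fun x => ?_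
  simp only
  rw [← Finset.mul_sum]
  exact mul_le_mul_of_nonneg_left (h.le_sum hpos x) (radialWeight_nonneg K x)

theorem mollifier_neg (k : ℕ) (x : E n) : mollifier n k (-x) = mollifier n k x :=
  ContDiffBump.normed_neg _ x

/-- Convex functions increase under mollification, since the mollifiers are even. -/
theorem le_mollify {g : E n → ℝ} (hg : ConvexOn ℝ univ g) (hc : Continuous g) (k : ℕ) (x : E n) :
    g x ≤ mollify g k x := by
  have hi : ∀ x, Integrable fun s => mollifier n k s * g (x - s) := fun x =>
    integrable_test_mul (hc.comp (continuous_const.sub continuous_id)).locallyIntegrable _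
  have hi' : Integrable fun s => mollifier n k s * g (x + s) :=
    integrable_test_mul (hc.comp (continuous_const.add continuous_id)).locallyIntegrable _
  have h1 : ∫ s, mollifier n k s * g (x + s) = mollify g k x := by
    rw [mollify_eq hc, ← integral_neg_eq_self]
    simp [mollifier_neg, sub_eq_add_neg]
  have hm : Integrable (mollifier n k) := by
    simpa using integrable_test_mul (μ := volume)
      (continuous_const (y := (1 : ℝ))).locallyIntegrable (mollifier n k)
  have h2 : 2 * g x = ∫ s, mollifier n k s * (2 * g x) := by
    rw [integral_mul_const, integral_mollifier, one_mul]
  have h3 : 2 * g x ≤ mollify g k x + mollify g k x := by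
    nth_rewrite 1 [← h1]
    rw [mollify_eq hc, ← integral_add hi' (hi x), h2]
    refine integral_mono (hm.mul_const _) (hi'.add (hi x)) fun s => ?_
    have := hg.2 (mem_univ (x + s)) (mem_univ (x - s)) (show (0 : ℝ) ≤ 1 / 2 by norm_num)
      (show (0 : ℝ) ≤ 1 / 2 by norm_num) (by norm_num)
    rw [show (1 / 2 : ℝ) • (x + s) + (1 / 2 : ℝ) • (x - s) = x by module, smul_eq_mul,
      smul_eq_mul] at this
    simp only
    rw [← mul_add]
    exact mul_le_mul_of_nonneg_left (by linarith) (mollifier_nonneg k s)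
  linarith

/-- A nonnegative convex function is bounded on a ball by a multiple of a weighted integral. -/
theorem exists_forall_le_integral_radialWeight (n : ℕ) (R : ℝ) : ∃ K A : ℝ, 0 ≤ A ∧
    ∀ g : E n → ℝ, ConvexOn ℝ univ g → Continuous g → (∀ x, 0 ≤ g x) →
      ∀ x, ‖x‖ ≤ R → g x ≤ A * ∫ y, radialWeight K y * g y := by
  -- the weight is positive on the ball of radius `|R| + 1`, which contains the points that enter
  -- the average of `g` over the unit ball around a point of norm at most `R`
  set K := (|R| + 2) ^ 2 with hK
  have hlow : ∃ c > 0, ∀ y : E n, ‖y‖ ≤ |R| + 1 → c ≤ radialWeight K y := by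
    obtain ⟨y₀, hy₀, hmin⟩ := (isCompact_closedBall (0 : E n) (|R| + 1)).exists_isMinOn
      ⟨0, by simp; positivity⟩ (continuous_radialWeight K).continuousOn
    rw [mem_closedBall_zero_iff] at hy₀
    refine ⟨_, radialWeight_pos (x := y₀) (K := K) ?_, fun y hy =>
      hmin (mem_closedBall_zero_iff.2 hy)⟩
    rw [hK]
    exact pow_lt_pow_left₀ (by linarith) (norm_nonneg _) two_ne_zero
  obtain ⟨c, hc, hlow⟩ := hlow
  obtain ⟨M, hM⟩ := (mollifier n 0).hasCompactSupport.exists_bound_of_continuous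
    (mollifier n 0).continuous
  have hM0 : 0 ≤ M := (norm_nonneg _).trans (hM 0)
  refine ⟨K, M / c, by positivity, fun g hg hcont hpos x hx => ?_⟩
  refine (le_mollify hg hcont 0 x).trans ?_
  rw [mollify, ofFun_apply hcont, ← integral_const_mul]
  refine integral_mono (integrable_test_mul hcont.locallyIntegrable _)
    ((integrable_radialWeight_mul K hcont).const_mul _) fun y => ?_
  simp only [reflect_apply]
  rw [← mul_assoc]
  refine mul_le_mul_of_nonneg_right ?_ (hpos y)
  by_cases hy : ‖y‖ ≤ |R| + 1
  · rw [div_mul_eq_mul_div, le_div_iff₀ hc]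
    refine mul_le_mul ?_ (hlow y hy) hc.le hM0
    exact (le_abs_self _).trans (hM _)
  · rw [mollifier_eq_zero]
    · exact mul_nonneg (by positivity) (radialWeight_nonneg K y)
    · have := norm_sub_norm_le y x
      rw [norm_sub_rev] at this
      simp only [CharP.cast_eq_zero, zero_add, div_one]
      linarith [le_abs_self R]

/-! ### Limits of convex functions -/

theorem _root_.ConvexOn.continuous_of_univ {f : E n → ℝ} (hf : ConvexOn ℝ univ f) : Continuous f :=
  continuousOn_univ.1 (hf.continuousOn isOpen_univ)

/-- A locally bounded sequence of convex functions converges, locally uniformly, along every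
ultrafilter. -/
theorem exists_convexOn_tendstoUniformlyOn {g : ℕ → E n → ℝ} (hg : ∀ k, ConvexOn ℝ univ (g k))
    (hb : ∀ R, ∃ C, ∀ k x, ‖x‖ ≤ R → |g k x| ≤ C) (l : Ultrafilter ℕ) :
    ∃ f, ConvexOn ℝ univ f ∧ ∀ K, IsCompact K → TendstoUniformlyOn g f l K := by
  have hlim : ∀ x, ∃ c, Filter.Tendsto (fun k => g k x) l (𝓝 c) := by
    intro x
    obtain ⟨C, hC⟩ := hb ‖x‖
    obtain ⟨c, -, hc⟩ := (isCompact_Icc (a := -C) (b := C)).ultrafilter_le_nhds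
      (l.map fun k => g k x) (Filter.le_principal_iff.2 (Filter.mem_map.2
        (Filter.univ_mem' fun k => abs_le.1 (hC k x le_rfl))))
    exact ⟨c, hc⟩
  choose f hf using hlim
  refine ⟨f, ⟨convex_univ, fun x _ y _ a b ha hb hab => ?_⟩, ?_⟩
  · exact le_of_tendsto_of_tendsto' (hf _) (((hf x).const_mul a).add ((hf y).const_mul b))
      fun k => (hg k).2 (mem_univ x) (mem_univ y) ha hb hab
  · have heq : ∀ R : ℝ, UniformEquicontinuousOn g (Metric.ball 0 R) := by
      intro R
      obtain ⟨C, hC⟩ := hb (R + 1)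
      refine LipschitzOnWith.uniformEquicontinuousOn g (2 * C / 1).toNNReal fun k => ?_
      have hk := (hg k).subset (subset_univ _) (convex_ball (0 : E n) (R + 1))
      have := hk.lipschitzOnWith_of_abs_le one_pos (M := C) fun a ha =>
        hC k a (by simpa using ha.le)
      simpa using this
    have := (EquicontinuousOn.tendsto_uniformOnFun_iff_pi (𝔖 := {K : Set (E n) | IsCompact K})
      (fun K hK => hK) (eq_univ_of_forall fun x => ⟨{x}, isCompact_singleton, rfl⟩)
      (F := g) (fun K hK => by
        obtain ⟨R, hR⟩ := hK.isBounded.subset_ball (0 : E n)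
        exact ((heq R).mono hR).equicontinuousOn) l f).2 (tendsto_pi_nhds.2 hf)
    rw [UniformOnFun.tendsto_iff_tendstoUniformlyOn] at this
    exact fun K hK => this K hK

/-! ### Closed positive currents have convex potentials -/

/-- The smearings of `T` with mollifiers are Hessians of convex functions; normalized to vanish to
first order at `0`, these are locally bounded because the smeared Laplacians converge weakly, and a
limit of them is a potential of `T`. -/
theorem exists_convexOn_eq_ddSharp {T : Current11 n} (hcl : IsDClosed T) (hT : IsPositive T) :
    ∃ f : E n → ℝ, ConvexOn ℝ univ f ∧ T = ddSharp f := by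
  have hs := fun i j => (hT.smearsSmoothly i j).1
  have hl := fun i j => (hT.smearsSmoothly i j).2
  have hclosed : ∀ k i j, ∂_{stdVec k} (T i j) = ∂_{stdVec i} (T k j) := by
    intro k i j
    rcases lt_trichotomy k i with h | rfl | h
    · exact sub_eq_zero.1 (hcl k i j h)
    · rfl
    · exact (sub_eq_zero.1 (hcl i k j h)).symm
  set H : ℕ → Fin n → Fin n → E n → ℝ := fun k i j x => T i j (reflect (mollifier n k) x) with hH
  have hcont : ∀ k i j, Continuous (H k i j) := fun k i j => (hs i j).continuous _
  choose g w hg using fun k => exists_hasHessian (H := H k) (fun i j => ((hs i j) _).1)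
    (fun l i j x => by
      rw [hH]
      simp only
      rw [((hs i j) _).2, ((hs l j) _).2, ← lineDerivOp_distr_reflect, ← lineDerivOp_distr_reflect,
        hclosed]) (fun i j x => by rw [hH]; simp only; rw [hT.1])
  have hpos : ∀ k, ∀ x v : E n, 0 ≤ ∑ i, ∑ j, v i * v j * H k i j x := by
    intro k x v
    obtain ⟨μ, -, hμ⟩ := hT.exists_measure v
    rw [hH]
    simp only [hμ]
    exact integral_nonneg fun t => mollifier_nonneg _ _
  have hconv : ∀ k, ConvexOn ℝ univ (g k) := fun k => (hg k).convexOn (hpos k)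
  -- a convergent sequence is bounded
  have hbound : ∀ R, ∃ C, ∀ k x, ‖x‖ ≤ R → |g k x| ≤ C := by
    intro R
    obtain ⟨K, A, hA, h⟩ := exists_forall_le_integral_radialWeight n R
    obtain ⟨C, hC⟩ := (tendsto_finsetSum Finset.univ fun j _ =>
      hl j j (radialTest n K)).bddAbove_range
    refine ⟨A * C, fun k x hx => ?_⟩
    rw [abs_of_nonneg ((hg k).nonneg (hpos k) x)]
    refine (h (g k) (hconv k) (hg k).continuous ((hg k).nonneg (hpos k)) x hx).trans ?_
    exact mul_le_mul_of_nonneg_left (((hg k).integral_radialWeight_le (hcont k) (hpos k) K).trans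
      (hC ⟨k, rfl⟩)) hA
  obtain ⟨f, hf, hlim⟩ := exists_convexOn_tendstoUniformlyOn hconv hbound (Filter.hyperfilter ℕ)
  refine ⟨f, hf, ?_⟩
  ext i j φ
  have h1 := tendsto_ofFun (fun k => (hg k).continuous) hf.continuous_of_univ hlim
    (∂_{stdVec j} (∂_{stdVec i} φ))
  rw [← ddSharp_apply] at h1
  refine tendsto_nhds_unique ((hl i j φ).mono_left Nat.hyperfilter_le_atTop)
    (h1.congr fun k => ?_)
  rw [← ddSharp_apply, ddSharp_eq_ofFun (hg k).continuous (hg k).continuous_fst (hcont k)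
    (hg k).hasLineDerivAt_fst (hg k).hasLineDerivAt_snd]

/-! ### The normal vectors determine a tropical polynomial up to an affine function -/

theorem AffineNear.add {f g : E n → ℝ} {p a b : E n} (hf : AffineNear f p a)
    (hg : AffineNear g p b) : AffineNear (fun y => f y + g y) p (a + b) := by
  filter_upwards [hf, hg] with y h1 h2
  rw [h1, h2, inner_add_left]; ring

/-- Where `f + g` agrees with its tangent of slope `a + b`, the functions `f` and `g` agree with
their tangents of slopes `a` and `b`. -/
theorem eq_tangent_of_add {f g : E n → ℝ} (hf : ConvexOn ℝ univ f) (hg : ConvexOn ℝ univ g)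
    {p a b y : E n} (ha : AffineNear f p a) (hb : AffineNear g p b)
    (h : f y + g y = tangent (fun y => f y + g y) (a + b) y) :
    f y = tangent f a y ∧ g y = tangent g b y := by
  have ht : tangent (fun y => f y + g y) (a + b) y = f p + g p + ⟪a + b, y - p⟫ :=
    (ha.add hb).tangent_eq (hf.add hg) y
  rw [ht, inner_add_left] at h
  have h1 := ha.le hf y
  have h2 := hb.le hg y
  rw [ha.tangent_eq hf, hb.tangent_eq hg]
  constructor <;> linarith

/-- A slope of `f + g` is a sum of slopes of `f` and `g` at a common point. -/
theorem exists_eq_add_of_mem_slopes {f g : E n → ℝ} (hf : GenericallyAffine f)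
    (hg : GenericallyAffine g) {O : Set (E n)} {c : E n} (hO : IsOpen O)
    (hc : c ∈ slopes (fun y => f y + g y) O) :
    ∃ p ∈ O, ∃ a b, AffineNear f p a ∧ AffineNear g p b ∧ c = a + b := by
  obtain ⟨x, hxO, hx⟩ := hc
  obtain ⟨U, hU, hUo, hxU⟩ := mem_nhds_iff.1 hx.eventually
  obtain ⟨a, x', hx', ha⟩ := hf (U ∩ O) (hUo.inter hO) ⟨x, hxU, hxO⟩
  obtain ⟨V, hV, hVo, hxV⟩ := mem_nhds_iff.1 ha.eventually
  obtain ⟨b, p, hp, hb⟩ := hg (V ∩ (U ∩ O)) (hVo.inter (hUo.inter hO)) ⟨x', hxV, hx'⟩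
  exact ⟨p, hp.2.2, a, b, hV hp.1, hb, (hU hp.2.1).unique ((hV hp.1).add hb)⟩

/-- If the maximum of two linear forms of slopes `a`, `a'` is near a point the maximum of those of
slopes `b`, `b'`, then `a - a' = ± (b - b')`: the sum of the values of the maximum at `z` and `-z`
is `|⟪a - a', z⟫|`. -/
theorem sub_eq_or_eq_neg_of_max_eq {x a a' b b' : E n} (h : ∀ᶠ y in 𝓝 x,
    max ⟪a, y - x⟫ ⟪a', y - x⟫ = max ⟪b, y - x⟫ ⟪b', y - x⟫) :
    a - a' = b - b' ∨ a - a' = -(b - b') := by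
  set u := a - a' with hu
  set v := b - b' with hv
  have habs : ∀ z : E n, |⟪u, z⟫| = |⟪v, z⟫| := by
    intro z
    have ht : ∀ s : ℝ, Filter.Tendsto (fun t : ℝ => x + (s * t) • z) (𝓝[>] 0) (𝓝 x) := by
      intro s
      have : Continuous fun t : ℝ => x + (s * t) • z := by fun_prop
      simpa using (this.tendsto 0).mono_left nhdsWithin_le_nhds
    obtain ⟨t, ⟨h1, h2⟩, ht0⟩ := ((((ht 1).eventually h).and ((ht (-1)).eventually h)).and
      self_mem_nhdsWithin).exists
    have ht0 : (0 : ℝ) < t := ht0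
    have key : ∀ p q : E n, max (t * ⟪p, z⟫) (t * ⟪q, z⟫) + max (-t * ⟪p, z⟫) (-t * ⟪q, z⟫) =
        t * |⟪p - q, z⟫| := by
      intro p q
      rw [neg_mul, neg_mul, max_neg_neg, ← sub_eq_add_neg, max_sub_min_eq_abs', ← mul_sub,
        ← inner_sub_left, abs_mul, abs_of_pos ht0]
    simp only [add_sub_cancel_left, inner_smul_right, one_mul, neg_one_mul] at h1 h2
    have := key a a'
    rw [h1, h2, key b b'] at this
    exact (mul_left_cancel₀ ht0.ne' this).symm
  have h1 := habs u
  have h2 := habs v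
  rw [real_inner_self_eq_norm_sq, abs_of_nonneg (sq_nonneg _), real_inner_comm] at h1
  rw [real_inner_self_eq_norm_sq, abs_of_nonneg (sq_nonneg ‖v‖)] at h2
  rcases abs_choice ⟪u, v⟫ with hs | hs
  · left
    rw [← sub_eq_zero, ← norm_eq_zero, ← sq_eq_zero_iff, norm_sub_sq_real]
    linarith
  · right
    rw [← sub_eq_zero, sub_neg_eq_add, ← norm_eq_zero, ← sq_eq_zero_iff, norm_add_sq_real]
    linarith

/-- If `f + g` is near `x` the maximum of two affine functions of slopes `a + b` and `a' + b'`, then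
`f` and `g` are near `x` maxima of affine functions of slopes `a`, `a'` and `b`, `b'`. -/
theorem eventually_eq_max_of_add {f g : E n → ℝ} (hf : ConvexOn ℝ univ f) (hg : ConvexOn ℝ univ g)
    {x p q a b a' b' : E n} (ha : AffineNear f p a) (hb : AffineNear g p b)
    (ha' : AffineNear f q a') (hb' : AffineNear g q b')
    (hx : f x + g x = tangent (fun y => f y + g y) (a + b) x)
    (hx' : f x + g x = tangent (fun y => f y + g y) (a' + b') x)
    (h : ∀ᶠ y in 𝓝 x, f y + g y =
      max (f x + g x + ⟪a + b, y - x⟫) (f x + g x + ⟪a' + b', y - x⟫)) :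
    (∀ᶠ y in 𝓝 x, f y = max (f x + ⟪a, y - x⟫) (f x + ⟪a', y - x⟫)) ∧
      ∀ᶠ y in 𝓝 x, g y = max (g x + ⟪b, y - x⟫) (g x + ⟪b', y - x⟫) := by
  have h1 := eq_tangent_of_add hf hg ha hb hx
  have h2 := eq_tangent_of_add hf hg ha' hb' hx'
  have hboth : ∀ᶠ y in 𝓝 x, f y = max (f x + ⟪a, y - x⟫) (f x + ⟪a', y - x⟫) ∧
      g y = max (g x + ⟪b, y - x⟫) (g x + ⟪b', y - x⟫) := by
    filter_upwards [h] with y hy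
    have e1 : tangent f a y = f x + ⟪a, y - x⟫ := by rw [tangent_eq_add f a x, ← h1.1]
    have e2 : tangent f a' y = f x + ⟪a', y - x⟫ := by rw [tangent_eq_add f a' x, ← h2.1]
    have e3 : tangent g b y = g x + ⟪b, y - x⟫ := by rw [tangent_eq_add g b x, ← h1.2]
    have e4 : tangent g b' y = g x + ⟪b', y - x⟫ := by rw [tangent_eq_add g b' x, ← h2.2]
    have l1 := tangent_le hf (O := univ) ⟨p, mem_univ _, ha⟩ y
    have l2 := tangent_le hf (O := univ) ⟨q, mem_univ _, ha'⟩ y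
    have l3 := tangent_le hg (O := univ) ⟨p, mem_univ _, hb⟩ y
    have l4 := tangent_le hg (O := univ) ⟨q, mem_univ _, hb'⟩ y
    rw [e1] at l1
    rw [e2] at l2
    rw [e3] at l3
    rw [e4] at l4
    rcases max_choice (f x + g x + ⟪a + b, y - x⟫) (f x + g x + ⟪a' + b', y - x⟫) with hm | hm
    · have := eq_tangent_of_add hf hg ha hb (y := y) (by
        rw [hy, hm, tangent_eq_add _ _ x, ← hx])
      rw [e1, e3] at this
      rw [max_eq_left (by linarith [this.1]), max_eq_left (by linarith [this.2])]
      exact this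
    · have := eq_tangent_of_add hf hg ha' hb' (y := y) (by
        rw [hy, hm, tangent_eq_add _ _ x, ← hx'])
      rw [e2, e4] at this
      rw [max_eq_right (by linarith [this.1]), max_eq_right (by linarith [this.2])]
      exact this
  exact ⟨hboth.mono fun y hy => hy.1, hboth.mono fun y hy => hy.2⟩

/-- If two convex functions with finitely many slopes have the same normal vectors, then the
difference of their slopes is constant. Otherwise the slopes of `f + g` fall into two classes, and
at a facet of `f + g` separating these the jumps of the slopes of `f` and of `g`, which agree up to
sign, would be different, hence opposite; but then `f + g` would have no jump. -/
theorem sub_eq_sub_of_isNormalVector_iff {f g : E n → ℝ} (hf : ConvexOn ℝ univ f)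
    (hg : ConvexOn ℝ univ g) (hfgen : GenericallyAffine f) (hggen : GenericallyAffine g)
    (hfin : (slopes (fun y => f y + g y) univ).Finite)
    (hgen : GenericallyAffine fun y => f y + g y)
    (h : ∀ x v, IsNormalVector f x v ↔ IsNormalVector g x v) {p a b p' a' b' : E n}
    (ha : AffineNear f p a) (hb : AffineNear g p b) (ha' : AffineNear f p' a')
    (hb' : AffineNear g p' b') : a' - b' = a - b := by
  by_contra hne
  set K : Set (E n) := {c | ∀ q e e', AffineNear f q e → AffineNear g q e' → c = e + e' →
    e - e' = a - b} with hK
  have hmem : a + b ∈ K := by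
    intro q e e' he he' hsum
    have hev : ∀ᶠ y in 𝓝 q, f y = tangent f a y ∧ g y = tangent g b y := by
      filter_upwards [(he.add he').eventually_eq_tangent (hf.add hg)] with y hy
      exact eq_tangent_of_add hf hg ha hb (by rw [hsum]; exact hy)
    have hat := hev.self_of_nhds
    have h1 : AffineNear f q a := by
      filter_upwards [hev] with y hy
      rw [hy.1, hat.1, tangent_eq_add f a q]
    have h2 : AffineNear g q b := by
      filter_upwards [hev] with y hy
      rw [hy.2, hat.2, tangent_eq_add g b q]
    rw [he.unique h1, he'.unique h2]
  obtain ⟨c, hc, hcK, d, -, hdK, x, -, hxc, hxd, -, hx⟩ := exists_facet_point (hf.add hg)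
    (hf.continuous_of_univ.add hg.continuous_of_univ) hgen isOpen_univ convex_univ hfin (K := K)
    ⟨p, mem_univ _, ha.add hb⟩ hmem ⟨p', mem_univ _, ha'.add hb'⟩
    fun h => hne (h p' a' b' ha' hb' rfl)
  have hcd : c ≠ d := fun h => hdK (h ▸ hcK)
  obtain ⟨q, -, e, e', he, he', rfl⟩ := exists_eq_add_of_mem_slopes hfgen hggen isOpen_univ hc
  have hee := hcK q e e' he he' rfl
  simp only [hK, mem_ofPred_eq, not_forall] at hdK
  obtain ⟨q', k, k', hk, hk', rfl, hkk⟩ := hdK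
  obtain ⟨hfx, hgx⟩ := eventually_eq_max_of_add hf hg he he' hk hk' hxc hxd hx
  -- a function without a jump has no normal vector, so the case of only one jump is included
  have hpm : e - k = e' - k' ∨ e - k = -(e' - k') := by
    by_cases hek : e = k
    · have hek' : e' ≠ k' := fun h => hcd (by rw [hek, h])
      obtain ⟨s, t, -, hst, hev⟩ := (h x _).2 ⟨e', k', hek', rfl, hgx⟩
      rw [hst]
      refine sub_eq_or_eq_neg_of_max_eq (x := x) ?_
      filter_upwards [hfx, hev] with y h1 h2
      rw [h1, max_add_add_left, max_add_add_left] at h2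
      exact add_left_cancel h2
    · obtain ⟨s, t, -, hst, hev⟩ := (h x _).1 ⟨e, k, hek, rfl, hfx⟩
      rw [hst, eq_comm, eq_neg_iff_add_eq_zero, add_comm, ← eq_neg_iff_add_eq_zero]
      refine sub_eq_or_eq_neg_of_max_eq (x := x) ?_
      filter_upwards [hgx, hev] with y h1 h2
      rw [h1, max_add_add_left, max_add_add_left] at h2
      exact add_left_cancel h2
  rcases hpm with hpm | hpm
  · refine hkk ?_
    rw [sub_eq_sub_iff_add_eq_add] at hpm
    rw [← hee, sub_eq_sub_iff_add_eq_add, hpm, add_comm]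
  · refine hcd ?_
    rw [← sub_eq_zero, add_sub_add_comm, hpm, neg_add_cancel]

theorem exists_affine_of_isNormalVector_iff {f g : E n → ℝ} (hf : IsTropicalPolynomial f)
    (hg : IsTropicalPolynomial g) (h : ∀ x v, IsNormalVector f x v ↔ IsNormalVector g x v) :
    ∃ (c : ℝ) (a : E n), ∀ y, f y = g y + (c + ⟪a, y⟫) := by
  have hfc := hf.convexOn
  have hgc := hg.convexOn
  have hgen : GenericallyAffine fun y => f y + g y := by
    intro O hO hne
    obtain ⟨a, x, hx, ha⟩ := hf.genericallyAffine O hO hne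
    obtain ⟨V, hV, hVo, hxV⟩ := mem_nhds_iff.1 ha.eventually
    obtain ⟨b, p, hp, hb⟩ := hg.genericallyAffine (V ∩ O) (hVo.inter hO) ⟨x, hxV, hx⟩
    exact ⟨a + b, p, hp.2, (hV hp.1).add hb⟩
  have hdec : ∀ c ∈ slopes (fun y => f y + g y) univ, ∃ p, ∃ a b, AffineNear f p a ∧
      AffineNear g p b ∧ c = a + b := by
    intro c hc
    obtain ⟨p, -, hp⟩ := exists_eq_add_of_mem_slopes hf.genericallyAffine hg.genericallyAffine
      isOpen_univ hc
    exact ⟨p, hp⟩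
  have hfin : (slopes (fun y => f y + g y) univ).Finite := by
    refine (hf.finite_slopes.add hg.finite_slopes).subset fun c hc => ?_
    obtain ⟨p, a, b, ha, hb, rfl⟩ := hdec c hc
    exact add_mem_add ⟨p, mem_univ _, ha⟩ ⟨p, mem_univ _, hb⟩
  obtain ⟨c₀, hc₀⟩ := hgen univ isOpen_univ univ_nonempty
  obtain ⟨p₀, a₀, b₀, ha₀, hb₀, -⟩ := hdec c₀ hc₀
  set D : E n → ℝ := fun y => f y - g y - ⟪a₀ - b₀, y⟫ with hD
  have hDc : Continuous D := (hf.continuous.sub hg.continuous).sub (by fun_prop)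
  -- the continuous function `D` takes only finitely many values
  have hDfin : (range D).Finite := by
    refine (((hf.finite_slopes.image fun a => tangent f a 0).sub
      (hg.finite_slopes.image fun b => tangent g b 0))).subset ?_
    rintro _ ⟨y, rfl⟩
    obtain ⟨c, hc, hy⟩ := exists_eq_tangent (hfc.add hgc) (hf.continuous.add hg.continuous) hgen
      isOpen_univ hfin (mem_univ y)
    obtain ⟨p, a, b, ha, hb, rfl⟩ := hdec c hc
    obtain ⟨h1, h2⟩ := eq_tangent_of_add hfc hgc ha hb hy
    have e := sub_eq_sub_of_isNormalVector_iff hfc hgc hf.genericallyAffine hg.genericallyAffine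
      hfin hgen h ha₀ hb₀ ha hb
    refine ⟨_, ⟨a, ⟨p, mem_univ _, ha⟩, rfl⟩, _, ⟨b, ⟨p, mem_univ _, hb⟩, rfl⟩, ?_⟩
    rw [hD]
    simp only
    rw [h1, h2, ← e, tangent_eq_add f a 0 y, tangent_eq_add g b 0 y, sub_zero, inner_sub_left]
    ring
  have hconst : (range D).Subsingleton :=
    hDfin.countable.isTotallyDisconnected _ subset_rfl (isPreconnected_range hDc)
  refine ⟨D 0, a₀ - b₀, fun y => ?_⟩
  have : D y = D 0 := hconst ⟨y, rfl⟩ ⟨0, rfl⟩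
  rw [← this, hD]
  ring

/-! ### Tropical polynomials and tropical currents -/

theorem ddSharp_eq_of_affine {f g : E n → ℝ} (hf : Continuous f) (hg : Continuous g) {c : ℝ}
    {a : E n} (h : ∀ y, f y = g y + (c + ⟪a, y⟫)) : ddSharp f = ddSharp g := by
  have hA : Continuous fun y : E n => c + ⟪a, y⟫ := by fun_prop
  ext i j φ
  rw [ddSharp_apply, ddSharp_apply, ← sub_eq_zero]
  have e : ofFun (fun y => c + ⟪a, y⟫) = ofFun f - ofFun g := by
    rw [← ofFun_sub hf hg]
    congr 1
    funext y
    rw [h]; ring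
  refine (DFunLike.congr_fun e _).symm.trans ?_
  rw [ofFun_lineDerivOp hA (continuous_const (y := ⟪a, stdVec j⟫)) (stdVec j) fun x => ?_,
    ofFun_lineDerivOp continuous_const (continuous_const (y := (0 : ℝ))) (stdVec i) fun x => ?_,
    ofFun_apply continuous_const]
  · simp
  · exact (hasFDerivAt_const ⟪a, stdVec j⟫ x).hasLineDerivAt (stdVec i)
  · exact (((innerSL ℝ a).hasFDerivAt (x := x)).const_add c).hasLineDerivAt (stdVec j)

section Tropical

variable {f g : E n → ℝ}

theorem IsTropicalPolynomial.support_ddSharp_eq (hf : IsTropicalPolynomial f) :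
    support (ddSharp f) = singularSet f :=
  (support_ddSharp hf.continuous).trans
    (kinks_eq_singularSet hf.convexOn hf.continuous hf.genericallyAffine hf.finite_slopes)

theorem IsTropicalPolynomial.isCurrentNormal_iff (hf : IsTropicalPolynomial f) {x v : E n} :
    IsCurrentNormal (ddSharp f) x v ↔ IsNormalVector f x v := by
  refine ⟨?_, fun h => ⟨f, hf.convexOn, rfl, h⟩⟩
  rintro ⟨g, hg, he, h⟩
  obtain ⟨c, a, hca⟩ := exists_affine_of_ddSharp_eq hf.continuous hg.continuous_of_univ he
  exact h.add_affine hca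

theorem IsTropicalPolynomial.isTropicalCurrent (hf : IsTropicalPolynomial f) :
    IsTropicalCurrent (ddSharp f) where
  closed := isDClosed_ddSharp f
  positive := isPositive_ddSharp hf.convexOn hf.continuous
  support_dim := by
    rw [support_ddSharp hf.continuous]
    exact isPiecewiseSmoothHypersurface_kinks hf.convexOn hf.continuous hf.genericallyAffine
      hf.finite_slopes
  integral x v hv := by
    obtain ⟨a, ha, b, hb, rfl⟩ := (hf.isCurrentNormal_iff.1 hv).exists_slopes
    exact (hf.isIntegral_of_mem_slopes ha).sub (hf.isIntegral_of_mem_slopes hb)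

theorem IsTropicalPolynomial.ofPolynomial_eq (hf : IsTropicalPolynomial f)
    (hg : IsTropicalPolynomial g) (h : ddSharp f = ddSharp g) :
    TropicalHypersurface.ofPolynomial f hf = TropicalHypersurface.ofPolynomial g hg := by
  ext x v
  · change x ∈ singularSet f ↔ x ∈ singularSet g
    rw [← hf.support_ddSharp_eq, ← hg.support_ddSharp_eq, h]
  · change IsNormalVector f x v ↔ IsNormalVector g x v
    rw [← hf.isCurrentNormal_iff, ← hg.isCurrentNormal_iff, h]

theorem IsTropicalPolynomial.ddSharp_eq (hf : IsTropicalPolynomial f)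
    (hg : IsTropicalPolynomial g) (h : ∀ x v, IsNormalVector f x v ↔ IsNormalVector g x v) :
    ddSharp f = ddSharp g := by
  obtain ⟨c, a, hca⟩ := exists_affine_of_isNormalVector_iff hf hg h
  exact ddSharp_eq_of_affine hf.continuous hg.continuous hca

theorem IsTropicalCurrent.exists_isTropicalPolynomial_add {T : Current11 n}
    (hT : IsTropicalCurrent T) (hf : ConvexOn ℝ univ f) (hTf : T = ddSharp f) :
    ∃ a : E n, IsTropicalPolynomial fun x => f x + ⟪a, x⟫ := by
  have hc := hf.continuous_of_univ
  have hS : IsPiecewiseSmoothHypersurface (kinks f) := by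
    rw [← support_ddSharp hc, ← hTf]
    exact hT.support_dim
  obtain ⟨hfin, hint⟩ := finite_slopes_and_isIntegral_sub hf hc hS fun x v hv =>
    hT.integral x v ⟨f, hf, hTf, hv⟩
  exact SuperCurrent.exists_isTropicalPolynomial_add hf hc (genericallyAffine_of_kinks hS) hfin hint

theorem IsTropicalCurrent.exists_isTropicalPolynomial {T : Current11 n}
    (hT : IsTropicalCurrent T) : ∃ f : E n → ℝ, IsTropicalPolynomial f ∧ T = ddSharp f := by
  obtain ⟨f, hf, hTf⟩ := exists_convexOn_eq_ddSharp hT.closed hT.positive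
  obtain ⟨a, ha⟩ := hT.exists_isTropicalPolynomial_add hf hTf
  refine ⟨_, ha, ?_⟩
  rw [hTf]
  exact (ddSharp_eq_of_affine ha.continuous hf.continuous_of_univ (c := 0) (a := a)
    fun y => by rw [zero_add]).symm

end Tropical

end SuperCurrent

open SuperCurrent in
theorem mainTheorem1 (n : ℕ) :
    ∃ Φ : TropicalHypersurface n ≃ {T : Current11 n // IsTropicalCurrent T},
      (∀ (f : E n → ℝ) (hf : IsTropicalPolynomial f),
        (Φ (TropicalHypersurface.ofPolynomial f hf) : Current11 n) = ddSharp f) ∧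
      (∀ V : TropicalHypersurface n,
        support (Φ V : Current11 n) = V.carrier ∧
        ∀ x v, IsCurrentNormal (Φ V : Current11 n) x v ↔ v ∈ V.normals x) ∧
      (∀ T : Current11 n, IsTropicalCurrent T →
        (∃ f : E n → ℝ, IsTropicalPolynomial f ∧ T = ddSharp f) ∧
        ∀ f : E n → ℝ, ConvexOn ℝ univ f → T = ddSharp f →
          ∃ a : E n, IsTropicalPolynomial fun x => f x + ⟪a, x⟫) := by
  choose p hp hpc hpn using fun V : TropicalHypersurface n => V.exists_polynomial
  have hmem : ∀ V x v, v ∈ V.normals x ↔ IsNormalVector (p V) x v := fun V x v => by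
    rw [hpn V]; rfl
  let Ψ : TropicalHypersurface n → {T : Current11 n // IsTropicalCurrent T} := fun V =>
    ⟨ddSharp (p V), (hp V).isTropicalCurrent⟩
  have hΨ : ∀ (f : E n → ℝ) (hf : IsTropicalPolynomial f),
      (Ψ (TropicalHypersurface.ofPolynomial f hf) : Current11 n) = ddSharp f := fun f hf =>
    (hp _).ddSharp_eq hf fun x v => (hmem (TropicalHypersurface.ofPolynomial f hf) x v).symm
  have hbij : Function.Bijective Ψ := by
    constructor
    · intro V V' h
      have := (hp V).ofPolynomial_eq (hp V') (congrArg Subtype.val h)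
      have e : ∀ V, V = TropicalHypersurface.ofPolynomial (p V) (hp V) := fun V =>
        TropicalHypersurface.ext (hpc V) (hpn V)
      rw [e V, e V', this]
    · rintro ⟨T, hT⟩
      obtain ⟨f, hf, rfl⟩ := hT.exists_isTropicalPolynomial
      exact ⟨TropicalHypersurface.ofPolynomial f hf, Subtype.ext (hΨ f hf)⟩
  refine ⟨Equiv.ofBijective Ψ hbij, hΨ, fun V => ⟨?_, fun x v => ?_⟩, fun T hT =>
    ⟨hT.exists_isTropicalPolynomial, fun f hf hTf => hT.exists_isTropicalPolynomial_add hf hTf⟩⟩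
  · rw [hpc V]
    exact (hp V).support_ddSharp_eq
  · rw [hmem]
    exact (hp V).isCurrentNormal_iff
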